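/- Fix a group $\Gamma$, an associative unital ring $\Lambda$, an equivariant homology theory $\mathcal H^?_*$ over $\Gamma$ with values in $\Lambda$-modules, and a class $\mathcal C$ of groups closed under isomorphisms, subgroups and quotients. All groups are discrete. Here a group over $\Gamma$ is a pair $(G,\xi)$ with $\xi\colon G\to\Gamma$ a homomorphism. The theory $\mathcal H^?_*$ assigns to each $(G,\xi)$ a $G$-homology theory $\mathcal H^G_*$ on $G$-CW-pairs (functors $\mathcal H^G_n$, $n\in\mathbb Z$, with natural boundary maps, satisfying $G$-homotopy invariance, the long exact sequence of a pair, excision, and the disjoint union axiom). It comes with an induction structure: for every morphism $\alpha\colon (H,\xi)\to(G,\mu)$ of groups over $\Gamma$, natural maps $\operatorname{ind}_\alpha\colon\mathcal H^H_n(X,A)\to\mathcal H^G_n(\alpha_*(X,A))$, where $\alpha_*X=G\times_\alpha X$, which are compatible with the boundary maps, functorial in $\alpha$, compatible with conjugation by any $g\in G$ with $\xi(g)=1$ for $(G,\xi)$ a group over $\Gamma$, and bijective for $(X,A)=(\{\bullet\},\emptyset)$ if $\alpha$ is injective. For a directed system of groups $\{G_i\mid i\in I\}$ with compatible homomorphisms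 $\psi_i\colon G_i\to G$, view each $G_i$ as a group over $\Gamma$ via $\xi\circ\psi_i$, and let $$t^G_n\colon \operatorname{colim}_{i\in I}\mathcal H^{G_i}_n(\{\bullet\})\to\mathcal H^G_n(\{\bullet\})$$ be induced by $\operatorname{ind}_{\psi_i}$ followed by the projection $(\psi_i)_*\{\bullet\}\to\{\bullet\}$. The theory is \emph{continuous} if $t^G_n$ is an isomorphism for all $n\in\mathbb Z$ whenever $(G,\xi)$ is a group over $\Gamma$ and $G$ is the directed union of subgroups $G_i$; it is \emph{strongly continuous} if this holds whenever $(G,\xi)$ is a group over $\Gamma$ and $G=\operatorname{colim}_{i\in I} G_i$ for a directed system of groups with not necessarily injective structure maps. For a family $\mathcal F$ of subgroups of $G$ (closed under conjugation and subgroups), let $E_{\mathcal F}(G)$ be its classifying space: a $G$-CW-complex whose $L$-fixed point set is contractible for $L\in\mathcal F$ and empty for subgroups $L\notin\mathcal F$. The \emph{Isomorphism Conjecture} for $(G,\xi)$ and $\mathcal F$ says that $E_{\mathcal F}(G)\to\{\bullet\}$ induces an isomorphism $\mathcal H^G_n(E_{\mathcal F}(G))\to\mathcal H^G_n(\{\bullet\})$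 for all $n\in\mathbb Z$. The \emph{Fibered Isomorphism Conjecture} for $(G,\xi)$ and $\mathcal F$ says that for every group homomorphism $\phi\colon K\to G$ the Isomorphism Conjecture holds for $(K,\xi\circ\phi)$ and $\phi^*\mathcal F=\{L\le K\mid \phi(L)\in\mathcal F\}$. Let $\mathcal C(G)$ be the family of subgroups of $G$ that belong to $\mathcal C$. (i) Suppose that $\mathcal H^?_*$ is continuous. Then the Isomorphism Conjecture for $(G,\xi)$ and $\mathcal C(G)$ is true for all groups $(G,\xi)$ over $\Gamma$ if and only if it is true for all such $(G,\xi)$ with $G$ finitely generated. Likewise, the Fibered Isomorphism Conjecture for $(G,\xi)$ and $\mathcal C(G)$ is true for all groups $(G,\xi)$ over $\Gamma$ if and only if it is true for all such $(G,\xi)$ with $G$ finitely generated. (ii) Suppose that $\mathcal H^?_*$ is strongly continuous. Then the Fibered Isomorphism Conjecture for $(G,\xi)$ and $\mathcal C(G)$ is true for all groups $(G,\xi)$ over $\Gamma$ if and only if it is true for all such $(G,\xi)$ with $G$ finitely presented. -/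

import Mathlib

open CategoryTheory

universe u v w x

namespace EquivariantHomology

/-! ### Equivariant CW-complexes of a discrete group -/

/-- The closed unit disc `D^n` in Euclidean `n`-space. -/
abbrev Disc (n : ℕ) : Type := Metric.closedBall (0 : EuclideanSpace ℝ (Fin n)) 1

/-- A `G`-CW-structure on a `G`-space `X`, for a discrete group `G`: an exhausting filtration such
that `X` carries the colimit topology and the `n`-skeleton arises from the `(n-1)`-skeleton by
attaching equivariant cells `G/H × D^n` along `G/H × S^(n-1)`, i.e. by a pushout of `G`-spaces.
Here `skel n` is the `(n-1)`-skeleton (the union of the cells of dimension `< n`). -/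
structure GCWStructure (G : Type u) [Group G] (X : Type u) [TopologicalSpace X]
    [MulAction G X] where
  /-- the index set of the equivariant `n`-cells -/
  cell : ℕ → Type u
  /-- the subgroup `H` of an equivariant cell `G/H × D^n` -/
  stab : ∀ n, cell n → Subgroup G
  /-- the characteristic map `G/H × D^n → X` of an equivariant cell -/
  charMap : ∀ (n : ℕ) (i : cell n), G ⧸ stab n i → Disc n → X
  continuous_charMap : ∀ n i c, Continuous (charMap n i c)
  charMap_smul : ∀ n i (g : G) c d, charMap n i (g • c) d = g • charMap n i c d
  skel : ℕ → Set X
  skel_zero : skel 0 = ∅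
  skel_succ : ∀ n, skel (n + 1) = skel n ∪ {p | ∃ i c d, charMap n i c d = p}
  iUnion_skel : ⋃ n, skel n = Set.univ
  /-- the boundary of an `n`-cell is attached to the `(n-1)`-skeleton -/
  charMap_mem_of_boundary : ∀ n i c (d : Disc n), ‖(d : EuclideanSpace ℝ (Fin n))‖ = 1 →
    charMap n i c d ∈ skel n
  /-- the open `n`-cells are disjoint from the `(n-1)`-skeleton -/
  charMap_notMem_of_interior : ∀ n i c (d : Disc n), ‖(d : EuclideanSpace ℝ (Fin n))‖ < 1 →
    charMap n i c d ∉ skel n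
  /-- the characteristic maps are jointly injective on the open `n`-cells -/
  charMap_injective : ∀ n (a b : Σ i : cell n, (G ⧸ stab n i) × Disc n),
    ‖(a.2.2 : EuclideanSpace ℝ (Fin n))‖ < 1 → ‖(b.2.2 : EuclideanSpace ℝ (Fin n))‖ < 1 →
    charMap n a.1 a.2.1 a.2.2 = charMap n b.1 b.2.1 b.2.2 → a = b
  isClosed_skel : ∀ n, IsClosed (skel n)
  /-- the `n`-skeleton carries the pushout topology -/
  isClosed_inter_skel_succ : ∀ n (S : Set X), IsClosed (S ∩ skel n) →
    (∀ i c, IsClosed (charMap n i c ⁻¹' S)) → IsClosed (S ∩ skel (n + 1))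
  /-- `X` carries the colimit topology -/
  isClosed_of_skel : ∀ S : Set X, (∀ n, IsClosed (S ∩ skel n)) → IsClosed S

namespace GCWStructure

variable {G : Type u} [Group G] {X : Type u} [TopologicalSpace X] [MulAction G X]

/-- A subcomplex: a closed subset which contains the whole closed equivariant cell as soon as it
contains a point of the open equivariant cell. -/
structure IsSubcomplex (S : GCWStructure G X) (A : Set X) : Prop where
  isClosed : IsClosed A
  charMap_mem : ∀ n i c (d : Disc n), ‖(d : EuclideanSpace ℝ (Fin n))‖ < 1 →
    S.charMap n i c d ∈ A → ∀ c' d', S.charMap n i c' d' ∈ A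

theorem norm_lt_or_eq {n : ℕ} (d : Disc n) : ‖(d : EuclideanSpace ℝ (Fin n))‖ < 1 ∨
    ‖(d : EuclideanSpace ℝ (Fin n))‖ = 1 :=
  lt_or_eq_of_le (mem_closedBall_zero_iff.1 d.2)

theorem isSubcomplex_empty (S : GCWStructure G X) : S.IsSubcomplex ∅ :=
  ⟨isClosed_empty, fun _ _ _ _ _ h => h.elim⟩

theorem smul_mem_skel (S : GCWStructure G X) (n : ℕ) (g : G) {p : X} (hp : p ∈ S.skel n) :
    g • p ∈ S.skel n := by
  induction n with
  | zero => simp [S.skel_zero] at hp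
  | succ n ih =>
    rw [S.skel_succ] at hp ⊢
    rcases hp with hp | ⟨i, c, d, rfl⟩
    · exact Or.inl (ih hp)
    · exact Or.inr ⟨i, g • c, d, S.charMap_smul n i g c d⟩

theorem exists_open_cell (S : GCWStructure G X) (n : ℕ) {p : X} (hp : p ∈ S.skel n) :
    ∃ m, m < n ∧ ∃ i c, ∃ d : Disc m, ‖(d : EuclideanSpace ℝ (Fin m))‖ < 1 ∧
      S.charMap m i c d = p := by
  induction n with
  | zero => simp [S.skel_zero] at hp
  | succ n ih =>
    by_cases h : p ∈ S.skel n
    · obtain ⟨m, hm, hh⟩ := ih h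
      exact ⟨m, by omega, hh⟩
    · rw [S.skel_succ] at hp
      rcases hp with hp | ⟨i, c, d, rfl⟩
      · exact absurd hp h
      · rcases norm_lt_or_eq d with hd | hd
        · exact ⟨n, by omega, i, c, d, hd, rfl⟩
        · exact absurd (S.charMap_mem_of_boundary n i c d hd) h

theorem IsSubcomplex.smul_mem {S : GCWStructure G X} {A : Set X} (hA : S.IsSubcomplex A)
    (g : G) {p : X} (hp : p ∈ A) : g • p ∈ A := by
  have : p ∈ ⋃ n, S.skel n := by rw [S.iUnion_skel]; trivial
  obtain ⟨n, hn⟩ := Set.mem_iUnion.1 this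
  obtain ⟨m, -, i, c, d, hd, rfl⟩ := S.exists_open_cell n hn
  rw [← S.charMap_smul]
  exact hA.charMap_mem m i c d hd hp _ _

/-- The action on an invariant subset. -/
abbrev subAction (A : Set X) (hA : ∀ (g : G) (p : X), p ∈ A → g • p ∈ A) : MulAction G A where
  smul g p := ⟨g • (p : X), hA g p p.2⟩
  one_smul p := Subtype.ext (one_smul G (p : X))
  mul_smul g h p := Subtype.ext (mul_smul g h (p : X))

/-- A subcomplex is itself a `G`-CW-complex. -/
def restrict (S : GCWStructure G X) (A : Set X) (hA : S.IsSubcomplex A) :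
    letI := subAction (G := G) A fun g _ hp => hA.smul_mem g hp
    GCWStructure G A :=
  letI := subAction (G := G) A fun g _ hp => hA.smul_mem g hp
  { cell := fun n => {i : S.cell n // ∀ c d, S.charMap n i c d ∈ A}
    stab := fun n i => S.stab n i.1
    charMap := fun n i c d => ⟨S.charMap n i.1 c d, i.2 c d⟩
    continuous_charMap := fun n i c => (S.continuous_charMap n i.1 c).subtype_mk _
    charMap_smul := fun n i g c d => Subtype.ext (S.charMap_smul n i.1 g c d)
    skel := fun n => Subtype.val ⁻¹' S.skel n
    skel_zero := by simp [S.skel_zero]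
    skel_succ := by
      intro n
      ext ⟨p, hp⟩
      simp only [Set.mem_preimage, Set.mem_union, Set.mem_ofPred_eq, Subtype.mk.injEq]
      constructor
      · intro h
        by_cases hn : p ∈ S.skel n
        · exact Or.inl hn
        · rw [S.skel_succ] at h
          rcases h with h | ⟨i, c, d, rfl⟩
          · exact absurd h hn
          · rcases norm_lt_or_eq d with hd | hd
            · exact Or.inr ⟨⟨i, hA.charMap_mem n i c d hd hp⟩, c, d, rfl⟩
            · exact absurd (S.charMap_mem_of_boundary n i c d hd) hn
      · rw [S.skel_succ]
        rintro (h | ⟨i, c, d, h⟩)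
        · exact Or.inl h
        · exact Or.inr ⟨i.1, c, d, h⟩
    iUnion_skel := by
      rw [← Set.preimage_iUnion, S.iUnion_skel, Set.preimage_univ]
    charMap_mem_of_boundary := fun n i c d hd => S.charMap_mem_of_boundary n i.1 c d hd
    charMap_notMem_of_interior := fun n i c d hd => S.charMap_notMem_of_interior n i.1 c d hd
    charMap_injective := by
      rintro n ⟨i, c, d⟩ ⟨j, c', d'⟩ h h' e
      have := S.charMap_injective n ⟨i.1, c, d⟩ ⟨j.1, c', d'⟩ h h' (congrArg Subtype.val e)
      obtain ⟨i, hi⟩ := i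
      obtain ⟨j, hj⟩ := j
      simp only [Sigma.mk.injEq] at this
      obtain ⟨rfl, h2⟩ := this
      simpa using h2
    isClosed_skel := fun n => (S.isClosed_skel n).preimage continuous_subtype_val
    isClosed_inter_skel_succ := by
      intro n T hT hc
      have key : ∀ m, Subtype.val '' (T ∩ (Subtype.val ⁻¹' S.skel m : Set A)) =
          (Subtype.val '' T) ∩ S.skel m := fun m => by
        rw [Set.image_inter_preimage]
      rw [hA.isClosed.isClosedEmbedding_subtypeVal.isClosed_iff_image_isClosed, key] at hT ⊢
      refine S.isClosed_inter_skel_succ n _ hT fun i c => ?_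
      by_cases hi : ∀ c d, S.charMap n i c d ∈ A
      · convert hc ⟨i, hi⟩ c using 1
        ext d
        constructor
        · rintro ⟨q, hq, e⟩
          have : q = ⟨S.charMap n i c d, hi c d⟩ := Subtype.ext e
          rw [this] at hq
          exact hq
        · intro h
          exact ⟨_, h, rfl⟩
      · have hb : S.charMap n i c ⁻¹' (Subtype.val '' T) =
            S.charMap n i c ⁻¹' (Subtype.val '' T ∩ S.skel n) := by
          ext d
          refine ⟨fun h => ⟨h, ?_⟩, fun h => h.1⟩
          rcases norm_lt_or_eq d with hd | hd
          · obtain ⟨q, -, e⟩ := h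
            exact absurd (hA.charMap_mem n i c d hd (e ▸ q.2)) hi
          · exact S.charMap_mem_of_boundary n i c d hd
        rw [hb]
        exact hT.preimage (S.continuous_charMap n i c)
    isClosed_of_skel := by
      intro T hT
      rw [hA.isClosed.isClosedEmbedding_subtypeVal.isClosed_iff_image_isClosed]
      refine S.isClosed_of_skel _ fun n => ?_
      have := hT n
      rw [hA.isClosed.isClosedEmbedding_subtypeVal.isClosed_iff_image_isClosed,
        Set.image_inter_preimage] at this
      exact this }

/-- The one-point space, as a single `0`-cell `G/G`. -/
def point (G : Type u) [Group G] : GCWStructure G PUnit.{u + 1} where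
  cell n := {_p : PUnit.{u + 1} // n = 0}
  stab _ _ := ⊤
  charMap _ _ _ _ := PUnit.unit
  continuous_charMap _ _ _ := continuous_const
  charMap_smul _ _ _ _ _ := rfl
  skel n := {_p | n ≠ 0}
  skel_zero := by simp
  skel_succ n := by
    ext p
    refine iff_of_true (Nat.succ_ne_zero n) ?_
    by_cases hn : n = 0
    · subst hn
      exact Or.inr ⟨⟨PUnit.unit, rfl⟩, ((1 : G) : G ⧸ (⊤ : Subgroup G)), ⟨0, by simp⟩, rfl⟩
    · exact Or.inl hn
  iUnion_skel := by
    ext p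
    simp only [Set.mem_iUnion, Set.mem_univ, iff_true]
    exact ⟨1, one_ne_zero⟩
  charMap_mem_of_boundary := by
    rintro n ⟨-, rfl⟩ c d hd
    have h0 : (d : EuclideanSpace ℝ (Fin 0)) = 0 := Subsingleton.elim _ _
    rw [h0, norm_zero] at hd
    exact absurd hd zero_ne_one
  charMap_notMem_of_interior := by
    rintro n ⟨-, rfl⟩ c d hd h
    exact h rfl
  charMap_injective := by
    rintro n ⟨⟨⟨⟩, rfl⟩, c, d⟩ ⟨⟨⟨⟩, _⟩, c', d'⟩ _ _ _
    have hc : c = c' := by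
      induction c using QuotientGroup.induction_on
      induction c' using QuotientGroup.induction_on
      exact QuotientGroup.eq.2 (Subgroup.mem_top _)
    have hd : d = d' := Subtype.ext (Subsingleton.elim _ _)
    rw [hc, hd]
  isClosed_skel _ := isClosed_discrete _
  isClosed_inter_skel_succ _ _ _ _ := isClosed_discrete _
  isClosed_of_skel _ _ := isClosed_discrete _

/-- The disjoint union of `G`-CW-complexes. -/
def sigma {I : Type u} {Y : I → Type u} [∀ i, TopologicalSpace (Y i)] [∀ i, MulAction G (Y i)]
    (S : ∀ i, GCWStructure G (Y i)) : GCWStructure G (Σ i, Y i) where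
  cell n := Σ i, (S i).cell n
  stab n a := (S a.1).stab n a.2
  charMap n a c d := ⟨a.1, (S a.1).charMap n a.2 c d⟩
  continuous_charMap n a c := continuous_sigmaMk.comp ((S a.1).continuous_charMap n a.2 c)
  charMap_smul n a g c d := by
    rw [(S a.1).charMap_smul, Sigma.smul_mk]
  skel n := {p | p.2 ∈ (S p.1).skel n}
  skel_zero := by
    ext ⟨i, p⟩
    simp [(S i).skel_zero]
  skel_succ n := by
    ext ⟨i, p⟩
    simp only [Set.mem_ofPred_eq, Set.mem_union, (S i).skel_succ]
    refine or_congr Iff.rfl ⟨?_, ?_⟩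
    · rintro ⟨a, c, d, rfl⟩
      exact ⟨⟨i, a⟩, c, d, rfl⟩
    · rintro ⟨⟨j, a⟩, c, d, h⟩
      obtain ⟨rfl, h⟩ := Sigma.mk.inj_iff.1 h
      exact ⟨a, c, d, eq_of_heq h⟩
  iUnion_skel := by
    ext ⟨i, p⟩
    have : p ∈ ⋃ n, (S i).skel n := by rw [(S i).iUnion_skel]; trivial
    simpa using this
  charMap_mem_of_boundary n a c d hd := (S a.1).charMap_mem_of_boundary n a.2 c d hd
  charMap_notMem_of_interior n a c d hd := (S a.1).charMap_notMem_of_interior n a.2 c d hd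
  charMap_injective := by
    rintro n ⟨⟨i, a⟩, c, d⟩ ⟨⟨j, b⟩, c', d'⟩ h h' e
    obtain ⟨h1, e⟩ := Sigma.mk.inj_iff.1 e
    dsimp only at h1
    subst h1
    have := (S i).charMap_injective n ⟨a, c, d⟩ ⟨b, c', d'⟩ h h' (eq_of_heq e)
    simp only [Sigma.mk.injEq] at this
    obtain ⟨rfl, h2⟩ := this
    simpa using h2
  isClosed_skel n := isClosed_sigma_iff.2 fun i => (S i).isClosed_skel n
  isClosed_inter_skel_succ n T hT hc := by
    rw [isClosed_sigma_iff] at hT ⊢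
    exact fun i => (S i).isClosed_inter_skel_succ n (Sigma.mk i ⁻¹' T) (hT i)
      fun a c => hc ⟨i, a⟩ c
  isClosed_of_skel T hT := by
    rw [isClosed_sigma_iff]
    exact fun i => (S i).isClosed_of_skel _ fun n => isClosed_sigma_iff.1 (hT n) i

end GCWStructure

/-! ### Induction of spaces along a group homomorphism -/

section Induced

variable {H G K : Type u} [Group H] [Group G] [Group K]

/-- The relation `(g, x) ~ (g α(h), h⁻¹ x)` on `G × X`. -/
def inducedSetoid (α : H →* G) (X : Type u) [MulAction H X] : Setoid (G × X) where
  r a b := ∃ h : H, b = (a.1 * α h, h⁻¹ • a.2)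
  iseqv :=
    { refl := fun a => ⟨1, by simp⟩
      symm := by
        rintro a b ⟨h, rfl⟩
        exact ⟨h⁻¹, by simp⟩
      trans := by
        rintro a b c ⟨h, rfl⟩ ⟨k, rfl⟩
        exact ⟨h * k, by simp [mul_assoc, mul_smul]⟩ }

/-- The induction `α_* X = G ×_α X` of an `H`-space `X` with `α : H → G`. -/
def Induced (α : H →* G) (X : Type u) [MulAction H X] : Type u := Quotient (inducedSetoid α X)

namespace Induced

variable (α : H →* G) {X : Type u} [MulAction H X]

/-- The class of `(g, x)` in `G ×_α X`. -/
def mk (g : G) (p : X) : Induced α X := Quotient.mk (inducedSetoid α X) (g, p)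

variable {α}

theorem mk_eq_mk {g g' : G} {p p' : X} :
    mk α g p = mk α g' p' ↔ ∃ h : H, g' = g * α h ∧ p' = h⁻¹ • p := by
  refine Quotient.eq.trans ?_
  exact exists_congr fun h => Prod.ext_iff

theorem ind {motive : Induced α X → Prop} (h : ∀ g p, motive (mk α g p)) (q : Induced α X) :
    motive q :=
  Quotient.ind (fun a => h a.1 a.2) q

theorem mk_mul (g : G) (h : H) (p : X) : mk α (g * α h) p = mk α g (h • p) :=
  mk_eq_mk.2 ⟨h⁻¹, by simp⟩

/-- Functions out of `G ×_α X`. -/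
def lift {Z : Type*} (f : G → X → Z) (hf : ∀ g h p, f (g * α h) p = f g (h • p)) :
    Induced α X → Z :=
  Quotient.lift (fun a : G × X => f a.1 a.2) (by
    rintro a b ⟨h, rfl⟩
    rw [hf, smul_inv_smul])

@[simp] theorem lift_mk {Z : Type*} (f : G → X → Z) (hf) (g : G) (p : X) :
    lift (α := α) f hf (mk α g p) = f g p := rfl

instance : MulAction G (Induced α X) where
  smul k := lift (fun g p => mk α (k * g) p) fun g h p => by rw [← mul_assoc, mk_mul]
  one_smul := ind fun g p => congrArg (fun t => mk α t p) (one_mul g)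
  mul_smul k l := ind fun g p => congrArg (fun t => mk α t p) (mul_assoc k l g)

@[simp] theorem smul_mk (k g : G) (p : X) : k • mk α g p = mk α (k * g) p := rfl

/-- The quotient topology, where `G` is discrete. -/
instance [TopologicalSpace X] : TopologicalSpace (Induced α X) :=
  letI : TopologicalSpace G := ⊥
  TopologicalSpace.coinduced (Quotient.mk (inducedSetoid α X)) inferInstance

section topology

variable [TopologicalSpace X]

theorem continuous_lift {Z : Type*} [TopologicalSpace Z] (f : G → X → Z) (hf)
    (hc : ∀ g, Continuous (f g)) : Continuous (lift (α := α) f hf) := by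
  let _ : TopologicalSpace G := ⊥
  have : DiscreteTopology G := ⟨rfl⟩
  refine continuous_coinduced_dom.2 ?_
  exact continuous_prod_of_discrete_left.2 hc

theorem continuous_mk (g : G) : Continuous (mk α g : X → Induced α X) := by
  let _ : TopologicalSpace G := ⊥
  have h : Continuous (Quotient.mk (inducedSetoid α X)) := continuous_coinduced_rng
  exact h.comp (Continuous.prodMk_right g)

theorem isClosed_iff {T : Set (Induced α X)} :
    IsClosed T ↔ ∀ g, IsClosed (mk α g ⁻¹' T) := by
  refine ⟨fun h g => h.preimage (continuous_mk g), fun h => ?_⟩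
  let _ : TopologicalSpace G := ⊥
  have : DiscreteTopology G := ⟨rfl⟩
  refine isClosed_coinduced.2 ?_
  rw [← isOpen_compl_iff, isOpen_prod_iff]
  rintro g p hp
  refine ⟨{g}, (mk α g ⁻¹' T)ᶜ, isOpen_discrete _, (h g).isOpen_compl, rfl, hp, ?_⟩
  rintro ⟨g', p'⟩ ⟨rfl, hp'⟩
  exact hp'

instance : ContinuousConstSMul G (Induced α X) where
  continuous_const_smul k := continuous_lift _ _ fun g => continuous_mk (k * g)

end topology

/-- The subset `α_* A` of `α_* X`. -/
def image (α : H →* G) (A : Set X) : Set (Induced α X) := {q | ∃ g, ∃ p ∈ A, mk α g p = q}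

theorem mk_mem_image {A : Set X} (hA : ∀ (h : H) (p : X), p ∈ A → h • p ∈ A) {g : G} {p : X} :
    mk α g p ∈ image α A ↔ p ∈ A := by
  constructor
  · rintro ⟨g', p', hp', e⟩
    obtain ⟨h, -, rfl⟩ := mk_eq_mk.1 e
    exact hA _ _ hp'
  · exact fun hp => ⟨g, p, hp, rfl⟩

theorem preimage_mk_image {A : Set X} (hA : ∀ (h : H) (p : X), p ∈ A → h • p ∈ A) (g : G) :
    mk α g ⁻¹' image α A = A := by
  ext p
  exact mk_mem_image hA

end Induced

variable {X : Type u} [TopologicalSpace X] [MulAction H X]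

namespace GCWStructure

/-- The characteristic map `G/α(L) × D^n → α_* X` of the cell induced by `H/L × D^n → X`. -/
def inducedCharMap (α : H →* G) (S : GCWStructure H X) (n : ℕ) (i : S.cell n)
    (c : G ⧸ (S.stab n i).map α) (d : Disc n) : Induced α X :=
  Quotient.liftOn' c (fun g => Induced.mk α g (S.charMap n i ((1 : H) : H ⧸ S.stab n i) d)) (by
    intro g g' hg
    rw [QuotientGroup.leftRel_apply] at hg
    obtain ⟨h, hh, e⟩ := hg
    have : g' = g * α h := by rw [e]; simp
    rw [this, Induced.mk_mul, ← S.charMap_smul]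
    congr 2
    refine QuotientGroup.eq.2 ?_
    simpa using hh)

theorem inducedCharMap_mk (α : H →* G) (S : GCWStructure H X) (n : ℕ) (i : S.cell n)
    (g : G) (d : Disc n) : S.inducedCharMap α n i (g : G ⧸ (S.stab n i).map α) d =
      Induced.mk α g (S.charMap n i ((1 : H) : H ⧸ S.stab n i) d) := rfl

theorem mk_charMap (α : H →* G) (S : GCWStructure H X) (n : ℕ) (i : S.cell n)
    (g : G) (h : H) (d : Disc n) : Induced.mk α g (S.charMap n i (h : H ⧸ S.stab n i) d) =
      S.inducedCharMap α n i ((g * α h : G) : G ⧸ (S.stab n i).map α) d := by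
  rw [inducedCharMap_mk, Induced.mk_mul, ← S.charMap_smul]
  congr 2
  refine QuotientGroup.eq.2 ?_
  simp

/-- The induction of an `H`-CW-complex is a `G`-CW-complex. -/
def induced (α : H →* G) (S : GCWStructure H X) : GCWStructure G (Induced α X) where
  cell := S.cell
  stab n i := (S.stab n i).map α
  charMap := S.inducedCharMap α
  continuous_charMap n i c := by
    induction c using QuotientGroup.induction_on with
    | H g => exact (Induced.continuous_mk g).comp (S.continuous_charMap n i _)
  charMap_smul n i g c d := by
    induction c using QuotientGroup.induction_on with
    | H k => rfl
  skel n := Induced.image α (S.skel n)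
  skel_zero := by
    ext q
    simp [Induced.image, S.skel_zero]
  skel_succ n := by
    ext q
    induction q using Induced.ind with
    | h g p =>
    rw [Set.mem_union, Induced.mk_mem_image fun h p => S.smul_mem_skel _ h,
      Induced.mk_mem_image fun h p => S.smul_mem_skel _ h, S.skel_succ, Set.mem_union]
    refine or_congr Iff.rfl ⟨?_, ?_⟩
    · rintro ⟨i, c, d, rfl⟩
      induction c using QuotientGroup.induction_on with
      | H h => exact ⟨i, _, d, (S.mk_charMap α n i g h d).symm⟩
    · rintro ⟨i, c, d, e⟩
      induction c using QuotientGroup.induction_on with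
      | H k =>
        obtain ⟨h, -, rfl⟩ := Induced.mk_eq_mk.1 e
        exact ⟨i, _, d, S.charMap_smul n i _ _ d⟩
  iUnion_skel := by
    ext q
    simp only [Set.mem_iUnion, Set.mem_univ, iff_true]
    induction q using Induced.ind with
    | h g p =>
      have : p ∈ ⋃ n, S.skel n := by rw [S.iUnion_skel]; trivial
      obtain ⟨n, hn⟩ := Set.mem_iUnion.1 this
      exact ⟨n, g, p, hn, rfl⟩
  charMap_mem_of_boundary n i c d hd := by
    induction c using QuotientGroup.induction_on with
    | H g => exact ⟨g, _, S.charMap_mem_of_boundary n i _ d hd, rfl⟩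
  charMap_notMem_of_interior n i c d hd := by
    induction c using QuotientGroup.induction_on with
    | H g =>
      rw [inducedCharMap_mk, Induced.mk_mem_image fun h p => S.smul_mem_skel _ h]
      exact S.charMap_notMem_of_interior n i _ d hd
  charMap_injective := by
    rintro n ⟨i, c, d⟩ ⟨j, c', d'⟩ hd hd' e
    induction c using QuotientGroup.induction_on with
    | H g =>
    induction c' using QuotientGroup.induction_on with
    | H g' =>
      dsimp only at hd hd' e
      rw [inducedCharMap_mk, inducedCharMap_mk] at e
      obtain ⟨h, rfl, e'⟩ := Induced.mk_eq_mk.1 e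
      clear e
      have e := e'
      clear e'
      rw [← S.charMap_smul] at e
      have := S.charMap_injective n ⟨j, ((1 : H) : H ⧸ S.stab n j), d'⟩
        ⟨i, h⁻¹ • ((1 : H) : H ⧸ S.stab n i), d⟩ hd' hd e
      simp only [Sigma.mk.injEq] at this
      obtain ⟨rfl, h2⟩ := this
      obtain ⟨h3, rfl⟩ := Prod.ext_iff.1 (eq_of_heq h2)
      have hm : h ∈ S.stab n j := by
        have := QuotientGroup.eq.1 (h3 : ((1 : H) : H ⧸ S.stab n j) = ((h⁻¹ * 1 : H) : _))
        simpa using this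
      have : ((g : G) : G ⧸ (S.stab n j).map α) = ((g * α h : G) : G ⧸ (S.stab n j).map α) :=
        QuotientGroup.eq.2 (by simpa using Subgroup.mem_map_of_mem α hm)
      rw [this]
  isClosed_skel n := by
    rw [Induced.isClosed_iff]
    intro g
    rw [Induced.preimage_mk_image fun h p => S.smul_mem_skel _ h]
    exact S.isClosed_skel n
  isClosed_inter_skel_succ n T hT hc := by
    rw [Induced.isClosed_iff] at hT ⊢
    intro g
    have hT := hT g
    rw [Set.preimage_inter, Induced.preimage_mk_image fun h p => S.smul_mem_skel _ h] at hT ⊢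
    refine S.isClosed_inter_skel_succ n _ hT fun i c => ?_
    induction c using QuotientGroup.induction_on with
    | H h =>
      convert hc i ((g * α h : G) : G ⧸ (S.stab n i).map α) using 1
      ext d
      simp only [Set.mem_preimage, S.mk_charMap]
  isClosed_of_skel T hT := by
    rw [Induced.isClosed_iff]
    intro g
    refine S.isClosed_of_skel _ fun n => ?_
    have := Induced.isClosed_iff.1 (hT n) g
    rwa [Set.preimage_inter, Induced.preimage_mk_image fun h p => S.smul_mem_skel _ h] at this

theorem IsSubcomplex.induced (α : H →* G) {S : GCWStructure H X} {A : Set X}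
    (hA : S.IsSubcomplex A) : (S.induced α).IsSubcomplex (Induced.image α A) where
  isClosed := by
    rw [Induced.isClosed_iff]
    intro g
    rw [Induced.preimage_mk_image fun h p => hA.smul_mem h]
    exact hA.isClosed
  charMap_mem n i c d hd := by
    intro hm c' d'
    induction c using QuotientGroup.induction_on with
    | H g =>
    induction c' using QuotientGroup.induction_on with
    | H g' =>
      have h1 : S.charMap n i ((1 : H) : H ⧸ S.stab n i) d ∈ A :=
        (Induced.mk_mem_image fun h p => hA.smul_mem h).1 hm
      exact ⟨g', _, hA.charMap_mem n i _ d hd h1 _ _, rfl⟩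

end GCWStructure

end Induced

/-! ### The category of `G`-CW-pairs -/

/-- A `G`-CW-complex: a `G`-space admitting a `G`-CW-structure.  As the morphisms below are all
continuous `G`-maps, choosing the structure would give an equivalent category. -/
structure GCWComplex (G : Type u) [Group G] where
  carrier : Type u
  [top : TopologicalSpace carrier]
  [action : MulAction G carrier]
  [continuous_action : ContinuousConstSMul G carrier]
  exists_structure : Nonempty (GCWStructure G carrier)

/-- A `G`-CW-pair `(X, A)`: a `G`-CW-complex `X` with a subcomplex `A`. -/
structure GCWPair (G : Type u) [Group G] where
  carrier : Type u
  [top : TopologicalSpace carrier]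
  [action : MulAction G carrier]
  [continuous_action : ContinuousConstSMul G carrier]
  sub : Set carrier
  exists_structure : ∃ S : GCWStructure G carrier, S.IsSubcomplex sub

attribute [instance] GCWComplex.top GCWComplex.action GCWComplex.continuous_action
attribute [instance] GCWPair.top GCWPair.action GCWPair.continuous_action

section Pairs

variable {G : Type u} [Group G]

/-- A map of `G`-CW-pairs: a continuous `G`-map (not necessarily cellular) of pairs. -/
@[ext] structure GCWPair.Hom (P Q : GCWPair G) where
  toFun : P.carrier → Q.carrier
  continuous_toFun : Continuous toFun
  map_smul : ∀ (g : G) (p : P.carrier), toFun (g • p) = g • toFun p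
  mapsTo : Set.MapsTo toFun P.sub Q.sub

instance : Category (GCWPair G) where
  Hom := GCWPair.Hom
  id P := ⟨id, continuous_id, fun _ _ => rfl, fun _ h => h⟩
  comp f g := ⟨g.toFun ∘ f.toFun, g.continuous_toFun.comp f.continuous_toFun,
    fun k p => by simp [f.map_smul, g.map_smul], g.mapsTo.comp f.mapsTo⟩

@[ext] theorem GCWPair.hom_ext {P Q : GCWPair G} {f g : P ⟶ Q}
    (h : ∀ p, f.toFun p = g.toFun p) : f = g :=
  GCWPair.Hom.ext (funext h)

/-- A `G`-CW-complex `X` as the pair `(X, ∅)`. -/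
abbrev GCWComplex.toPair (X : GCWComplex G) : GCWPair G where
  carrier := X.carrier
  sub := ∅
  exists_structure := ⟨X.exists_structure.some, X.exists_structure.some.isSubcomplex_empty⟩

/-- The one-point space. -/
abbrev GCWComplex.point (G : Type u) [Group G] : GCWComplex G where
  carrier := PUnit.{u + 1}
  continuous_action := ⟨fun _ => continuous_const⟩
  exists_structure := ⟨GCWStructure.point G⟩

/-- The projection onto the one-point space. -/
def GCWComplex.toPoint (X : GCWComplex G) : X.toPair ⟶ (GCWComplex.point G).toPair where
  toFun _ := PUnit.unit
  continuous_toFun := continuous_const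
  map_smul _ _ := rfl
  mapsTo _ h := h

/-- The disjoint union of a family of `G`-CW-complexes. -/
abbrev GCWComplex.sigma {I : Type u} (X : I → GCWComplex G) : GCWComplex G where
  carrier := Σ i, (X i).carrier
  continuous_action := ⟨fun g => continuous_sigma fun _ =>
    continuous_sigmaMk.comp (continuous_const_smul g)⟩
  exists_structure := ⟨GCWStructure.sigma fun i => (X i).exists_structure.some⟩

/-- The inclusion of a summand into the disjoint union. -/
def GCWComplex.sigmaInclusion {I : Type u} (X : I → GCWComplex G) (i : I) :
    (X i).toPair ⟶ (GCWComplex.sigma X).toPair where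
  toFun p := ⟨i, p⟩
  continuous_toFun := continuous_sigmaMk (σ := fun i => (X i).carrier)
  map_smul _ _ := rfl
  mapsTo _ h := h

namespace GCWPair

theorem smul_mem_sub (P : GCWPair G) (g : G) {p : P.carrier} (hp : p ∈ P.sub) : g • p ∈ P.sub :=
  P.exists_structure.choose_spec.smul_mem g hp

instance (P : GCWPair G) : MulAction G P.sub :=
  GCWStructure.subAction P.sub fun g _ => P.smul_mem_sub g

/-- The `G`-CW-complex `X` of a pair `(X, A)`. -/
abbrev total (P : GCWPair G) : GCWComplex G where
  carrier := P.carrier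
  exists_structure := ⟨P.exists_structure.choose⟩

/-- The `G`-CW-complex `A` of a pair `(X, A)`. -/
abbrev subcomplex (P : GCWPair G) : GCWComplex G where
  carrier := P.sub
  continuous_action := ⟨fun g =>
    ((continuous_const_smul g).comp continuous_subtype_val).subtype_mk _⟩
  exists_structure :=
    ⟨P.exists_structure.choose.restrict P.sub P.exists_structure.choose_spec⟩

/-- The inclusion `i : A → X`. -/
def inclSub (P : GCWPair G) : P.subcomplex.toPair ⟶ P.total.toPair where
  toFun p := p.1
  continuous_toFun := continuous_subtype_val
  map_smul _ _ := rfl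
  mapsTo _ h := h

/-- The inclusion `j : X → (X, A)`. -/
def inclTotal (P : GCWPair G) : P.total.toPair ⟶ P where
  toFun p := p
  continuous_toFun := continuous_id
  map_smul _ _ := rfl
  mapsTo _ h := h.elim

/-- The restriction `A → B` of a map of pairs `(X, A) → (Y, B)`. -/
def subMap {P Q : GCWPair G} (f : P ⟶ Q) : P.subcomplex.toPair ⟶ Q.subcomplex.toPair where
  toFun p := ⟨f.toFun p.1, f.mapsTo p.2⟩
  continuous_toFun := (f.continuous_toFun.comp continuous_subtype_val).subtype_mk _
  map_smul g p := Subtype.ext (f.map_smul g p.1)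
  mapsTo _ h := h

/-- The functor `(X, A) ↦ (A, ∅)`. -/
abbrev subFunctor (G : Type u) [Group G] : GCWPair G ⥤ GCWPair G where
  obj P := P.subcomplex.toPair
  map f := subMap f

/-- Two maps of `G`-CW-pairs are `G`-homotopic (through maps of pairs). -/
def Homotopic {P Q : GCWPair G} (f₀ f₁ : P ⟶ Q) : Prop :=
  ∃ h : P.carrier × unitInterval → Q.carrier, Continuous h ∧
    (∀ p, h (p, 0) = f₀.toFun p) ∧ (∀ p, h (p, 1) = f₁.toFun p) ∧
    (∀ (g : G) p t, h (g • p, t) = g • h (p, t)) ∧ (∀ p ∈ P.sub, ∀ t, h (p, t) ∈ Q.sub)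

/-- `F : (X, A) → (Y, B)` exhibits `Y` as the pushout `X ∪_f B` of `G`-spaces along the
restriction `f : A → B` of `F`. -/
def IsPushout {P Q : GCWPair G} (F : P ⟶ Q) : Prop :=
  Set.BijOn F.toFun P.subᶜ Q.subᶜ ∧
    ∀ T : Set Q.carrier, IsClosed (T ∩ Q.sub) → IsClosed (F.toFun ⁻¹' T) → IsClosed T

/-- The restriction `A → B` of `F : (X, A) → (Y, B)` is cellular (for suitable structures). -/
def IsCellularOnSub {P Q : GCWPair G} (F : P ⟶ Q) : Prop :=
  ∃ (S : GCWStructure G P.carrier) (T : GCWStructure G Q.carrier),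
    S.IsSubcomplex P.sub ∧ T.IsSubcomplex Q.sub ∧
      ∀ n, Set.MapsTo F.toFun (P.sub ∩ S.skel n) (T.skel n)

end GCWPair

end Pairs

namespace GCWPair

variable {H G K : Type u} [Group H] [Group G] [Group K]

/-- The induction `α_*(X, A)` of an `H`-CW-pair. -/
abbrev induced (α : H →* G) (P : GCWPair H) : GCWPair G where
  carrier := Induced α P.carrier
  sub := Induced.image α P.sub
  exists_structure :=
    ⟨P.exists_structure.choose.induced α, P.exists_structure.choose_spec.induced α⟩

/-- The map `α_* f`, `(g, x) ↦ (g, f(x))`. -/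
def inducedMap (α : H →* G) {P Q : GCWPair H} (f : P ⟶ Q) : P.induced α ⟶ Q.induced α where
  toFun := Induced.lift (fun g p => Induced.mk α g (f.toFun p)) fun g h p => by
    rw [Induced.mk_mul, f.map_smul]
  continuous_toFun := Induced.continuous_lift _ _ fun g =>
    (Induced.continuous_mk g).comp f.continuous_toFun
  map_smul k := Induced.ind fun g p => rfl
  mapsTo := by
    rintro _ ⟨g, p, hp, rfl⟩
    exact ⟨g, _, f.mapsTo hp, rfl⟩

/-- Induction as a functor on equivariant CW-pairs. -/
abbrev inducedFunctor (α : H →* G) : GCWPair H ⥤ GCWPair G where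
  obj P := P.induced α
  map f := inducedMap α f
  map_id P := GCWPair.hom_ext (Induced.ind fun g p => rfl)
  map_comp f f' := GCWPair.hom_ext (Induced.ind fun g p => rfl)

/-- The canonical identification of `α_* A` with the subcomplex of `α_*(X, A)`. -/
def inducedSub (α : H →* G) (P : GCWPair H) :
    P.subcomplex.toPair.induced α ⟶ (P.induced α).subcomplex.toPair where
  toFun := Induced.lift
    (fun g (p : P.sub) => (⟨Induced.mk α g p.1, g, p.1, p.2, rfl⟩ : Induced.image α P.sub))
    fun g h p => Subtype.ext (Induced.mk_mul g h p.1)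
  continuous_toFun := Induced.continuous_lift _ _ fun g =>
    ((Induced.continuous_mk g).comp continuous_subtype_val).subtype_mk _
  map_smul k := Induced.ind fun g p => rfl
  mapsTo := by
    rintro _ ⟨g, p, hp, rfl⟩
    exact hp.elim

/-- `β_* α_* (X, A) → (β ∘ α)_* (X, A)`, `(k, (g, x)) ↦ (k β(g), x)`. -/
def inducedComp (α : H →* G) (β : G →* K) (P : GCWPair H) :
    (P.induced α).induced β ⟶ P.induced (β.comp α) where
  toFun := Induced.lift
    (fun k => Induced.lift (fun g p => Induced.mk (β.comp α) (k * β g) p) fun g h p => by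
      rw [map_mul, ← mul_assoc]
      exact Induced.mk_mul (α := β.comp α) _ h p)
    fun k g => Induced.ind fun g' p => by
      change Induced.mk (β.comp α) (k * β g * β g') p = Induced.mk (β.comp α) (k * β (g * g')) p
      rw [map_mul, mul_assoc]
  continuous_toFun := Induced.continuous_lift _ _ fun k =>
    Induced.continuous_lift _ _ fun g => Induced.continuous_mk _
  map_smul l := Induced.ind fun k => Induced.ind fun g p =>
    congrArg (fun t => Induced.mk (β.comp α) t p) (mul_assoc l k (β g))
  mapsTo := by
    rintro _ ⟨k, _, ⟨g, p, hp, rfl⟩, rfl⟩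
    exact ⟨k * β g, p, hp, rfl⟩

/-- `(X, A) → c(g)_* (X, A)`, `x ↦ (1, g⁻¹ x)`, for the conjugation `c(g) : k ↦ g k g⁻¹`. -/
def toInducedConj (g : G) (P : GCWPair G) : P ⟶ P.induced (MulAut.conj g).toMonoidHom where
  toFun p := Induced.mk _ 1 (g⁻¹ • p)
  continuous_toFun := (Induced.continuous_mk 1).comp (continuous_const_smul g⁻¹)
  map_smul k p := by
    refine Induced.mk_eq_mk.2 ⟨g⁻¹ * k * g, ?_, ?_⟩
    · simp [mul_assoc]
    · simp [mul_smul]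
  mapsTo p hp := ⟨1, _, P.smul_mem_sub _ hp, rfl⟩

end GCWPair

/-! ### Equivariant homology theories -/

/-- A `G`-homology theory with values in `Λ`-modules.  The boundary operator `bdry n` is
`∂_(n+1) : H_(n+1)(X, A) → H_n(A)`. -/
structure GHomologyTheory (Λ : Type v) [Ring Λ] (G : Type u) [Group G] where
  H : ℤ → (GCWPair G ⥤ ModuleCat.{w} Λ)
  bdry : ∀ n, H (n + 1) ⟶ GCWPair.subFunctor G ⋙ H n
  map_eq_of_homotopic : ∀ {P Q : GCWPair G} (f₀ f₁ : P ⟶ Q), GCWPair.Homotopic f₀ f₁ →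
    ∀ n, (H n).map f₀ = (H n).map f₁
  exact_sub : ∀ (P : GCWPair G) n,
    Function.Exact ((bdry n).app P).hom ((H n).map P.inclSub).hom
  exact_total : ∀ (P : GCWPair G) n,
    Function.Exact ((H n).map P.inclSub).hom ((H n).map P.inclTotal).hom
  exact_pair : ∀ (P : GCWPair G) n,
    Function.Exact ((H (n + 1)).map P.inclTotal).hom ((bdry n).app P).hom
  excision : ∀ {P Q : GCWPair G} (F : P ⟶ Q), GCWPair.IsPushout F → GCWPair.IsCellularOnSub F →
    ∀ n, Function.Bijective ((H n).map F).hom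
  disjoint_union : ∀ {I : Type u} [DecidableEq I] (X : I → GCWComplex G) n,
    Function.Bijective (DirectSum.toModule Λ I ((H n).obj (GCWComplex.sigma X).toPair)
      fun i => ((H n).map (GCWComplex.sigmaInclusion X i)).hom)

/-- A group `(G, ξ)` over `Γ`. -/
structure GroupOver (Γ : Type x) [Group Γ] where
  carrier : Type u
  [group : Group carrier]
  hom : carrier →* Γ

attribute [instance] GroupOver.group

namespace GroupOver

variable {Γ : Type x} [Group Γ]

/-- A morphism of groups over `Γ`. -/
@[ext] structure Hom (G₁ G₂ : GroupOver.{u} Γ) where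
  toMonoidHom : G₁.carrier →* G₂.carrier
  comp_eq : G₂.hom.comp toMonoidHom = G₁.hom

/-- The composite `β ∘ α` of morphisms of groups over `Γ`. -/
abbrev Hom.comp {G₁ G₂ G₃ : GroupOver.{u} Γ} (β : Hom G₂ G₃) (α : Hom G₁ G₂) : Hom G₁ G₃ where
  toMonoidHom := β.toMonoidHom.comp α.toMonoidHom
  comp_eq := by rw [← MonoidHom.comp_assoc, β.comp_eq, α.comp_eq]

/-- Conjugation `c(g)` with an element `g` with `ξ(g) = 1`, as a morphism over `Γ`. -/
abbrev Hom.conj (G : GroupOver.{u} Γ) (g : G.carrier) (hg : G.hom g = 1) : Hom G G where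
  toMonoidHom := (MulAut.conj g).toMonoidHom
  comp_eq := by
    ext k
    simp [hg]

/-- The group `(K, ξ ∘ φ)` over `Γ` for a homomorphism `φ : K → G`. -/
abbrev pull (G : GroupOver.{u} Γ) {K : Type u} [Group K] (φ : K →* G.carrier) : GroupOver.{u} Γ where
  carrier := K
  hom := G.hom.comp φ

end GroupOver

/-- An equivariant homology theory over `Γ` with values in `Λ`-modules. -/
structure EquivariantHomologyTheory (Λ : Type v) [Ring Λ] (Γ : Type x) [Group Γ] where
  theory : ∀ G : GroupOver.{u} Γ, GHomologyTheory.{u, v, w} Λ G.carrier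
  /-- the induction structure -/
  ind : ∀ {H G : GroupOver.{u} Γ} (α : H.Hom G) (n : ℤ),
    (theory H).H n ⟶ GCWPair.inducedFunctor α.toMonoidHom ⋙ (theory G).H n
  ind_bdry : ∀ {H G : GroupOver.{u} Γ} (α : H.Hom G) (n : ℤ) (P : GCWPair H.carrier),
    (ind α (n + 1)).app P ≫ ((theory G).bdry n).app (P.induced α.toMonoidHom) =
      ((theory H).bdry n).app P ≫ (ind α n).app P.subcomplex.toPair ≫
        ((theory G).H n).map (P.inducedSub α.toMonoidHom)
  ind_comp : ∀ {H G K : GroupOver.{u} Γ} (α : H.Hom G) (β : G.Hom K) (n : ℤ)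
    (P : GCWPair H.carrier),
    (ind (β.comp α) n).app P =
      (ind α n).app P ≫ (ind β n).app (P.induced α.toMonoidHom) ≫
        ((theory K).H n).map (P.inducedComp α.toMonoidHom β.toMonoidHom)
  ind_conj : ∀ (G : GroupOver.{u} Γ) (g : G.carrier) (hg : G.hom g = 1) (n : ℤ)
    (P : GCWPair G.carrier),
    (ind (GroupOver.Hom.conj G g hg) n).app P = ((theory G).H n).map (P.toInducedConj g)
  ind_bijective : ∀ {H G : GroupOver.{u} Γ} (α : H.Hom G),
    Function.Injective α.toMonoidHom → ∀ n : ℤ,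
    Function.Bijective ((ind α n).app (GCWComplex.point H.carrier).toPair).hom

/-! ### Continuity -/

/-- A directed system of groups `G_i` together with compatible homomorphisms `ψ_i : G_i → G`. -/
structure DirectedCocone (G : Type u) [Group G] where
  I : Type u
  [preorder : Preorder I]
  [directed : IsDirectedOrder I]
  [nonempty : Nonempty I]
  obj : I → Type u
  [group : ∀ i, Group (obj i)]
  map : ∀ i j, i ≤ j → obj i →* obj j
  map_self : ∀ i, map i i le_rfl = MonoidHom.id (obj i)
  map_map : ∀ i j k (hij : i ≤ j) (hjk : j ≤ k),
    (map j k hjk).comp (map i j hij) = map i k (hij.trans hjk)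
  toG : ∀ i, obj i →* G
  toG_map : ∀ i j (hij : i ≤ j), (toG j).comp (map i j hij) = toG i

attribute [instance] DirectedCocone.preorder DirectedCocone.directed DirectedCocone.nonempty
  DirectedCocone.group

/-- `G` is the colimit of the directed system, in the category of groups. -/
def DirectedCocone.IsColimit {G : Type u} [Group G] (D : DirectedCocone G) : Prop :=
  ∀ (L : Type u) [Group L] (η : ∀ i, D.obj i →* L),
    (∀ i j (hij : i ≤ j), (η j).comp (D.map i j hij) = η i) →
    ∃! f : G →* L, ∀ i, f.comp (D.toG i) = η i

/-- A directed system of subgroups of `G`. -/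
def DirectedCocone.ofSubgroups {G : Type u} [Group G] {I : Type u} [Preorder I]
    [IsDirectedOrder I] [Nonempty I] (S : I → Subgroup G) (hS : Monotone S) :
    DirectedCocone G where
  I := I
  obj i := S i
  map i j hij := Subgroup.inclusion (hS hij)
  map_self _ := rfl
  map_map _ _ _ _ _ := rfl
  toG i := (S i).subtype
  toG_map _ _ _ := rfl

/-- A family of subgroups, closed under conjugation and taking subgroups. -/
structure SubgroupFamily (G : Type u) [Group G] where
  mem : Subgroup G → Prop
  conj : ∀ (L : Subgroup G) (g : G), mem L → mem (L.map (MulAut.conj g).toMonoidHom)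
  mono : ∀ L M : Subgroup G, L ≤ M → mem M → mem L

/-- The family `φ^* F` of the subgroups of `K` with image in `F`. -/
def SubgroupFamily.pullback {G K : Type u} [Group G] [Group K] (φ : K →* G)
    (F : SubgroupFamily G) : SubgroupFamily K where
  mem L := F.mem (L.map φ)
  conj L k h := by
    have := F.conj _ (φ k) h
    rw [Subgroup.map_map] at this ⊢
    have e : φ.comp (MulAut.conj k).toMonoidHom = (MulAut.conj (φ k)).toMonoidHom.comp φ := by
      ext l
      simp
    rwa [e]
  mono L M hLM h := F.mono _ _ (Subgroup.map_mono hLM) h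

/-- A class of groups closed under isomorphisms, taking subgroups and taking quotients. -/
structure GroupClass where
  mem : ∀ (G : Type u) [Group G], Prop
  of_iso : ∀ (G G' : Type u) [Group G] [Group G'], (G ≃* G') → mem G → mem G'
  subgroup : ∀ (G : Type u) [Group G] (L : Subgroup G), mem G → mem L
  quotient : ∀ (G : Type u) [Group G] (N : Subgroup G) [N.Normal], mem G → mem (G ⧸ N)

/-- The family `C(G)` of the subgroups of `G` which belong to `C`. -/
def GroupClass.family (C : GroupClass.{u}) (G : Type u) [Group G] : SubgroupFamily G where
  mem L := C.mem L
  conj L g h := C.of_iso _ _ (L.equivMapOfInjective _ (MulAut.conj g).injective) h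
  mono L M hLM h := C.of_iso _ _ (Subgroup.subgroupOfEquivOfLe hLM) (C.subgroup M _ h)

/-- `E` is a model for the classifying space of the family `F`: the fixed point set of a subgroup
`L` is contractible if `L` is in `F` and empty otherwise.  Such an `E` exists and is unique up to
`G`-homotopy equivalence. -/
def IsClassifyingSpace {G : Type u} [Group G] (F : SubgroupFamily G) (E : GCWComplex G) : Prop :=
  ∀ L : Subgroup G,
    (F.mem L → ContractibleSpace (MulAction.fixedPoints L E.carrier)) ∧
    (¬ F.mem L → MulAction.fixedPoints L E.carrier = ∅)

namespace EquivariantHomologyTheory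

variable {Λ : Type v} [Ring Λ] {Γ : Type x} [Group Γ]
  (E : EquivariantHomologyTheory.{u, v, w, x} Λ Γ)

/-- The value `H_n^G({•})` at the one-point space. -/
abbrev atPoint (G : GroupOver.{u} Γ) (n : ℤ) : ModuleCat.{w} Λ :=
  ((E.theory G).H n).obj (GCWComplex.point G.carrier).toPair

/-- For `α : H → G`, the `G`-map `α_* α^* {•} = α_* {•} → {•}`, `(g, x) ↦ g x`. -/
def counitPoint {H G : Type u} [Group H] [Group G] (α : H →* G) :
    (GCWComplex.point H).toPair.induced α ⟶ (GCWComplex.point G).toPair where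
  toFun _ := PUnit.unit
  continuous_toFun := continuous_const
  map_smul _ _ := rfl
  mapsTo := by
    rintro _ ⟨g, p, hp, rfl⟩
    exact hp

/-- The map `a_n({•}, α) : H_n^H({•}) → H_n^G(α_* {•}) → H_n^G({•})`. -/
def pointMap {H G : GroupOver.{u} Γ} (α : H.Hom G) (n : ℤ) : E.atPoint H n ⟶ E.atPoint G n :=
  (E.ind α n).app (GCWComplex.point H.carrier).toPair ≫
    ((E.theory G).H n).map (counitPoint α.toMonoidHom)

theorem pointMap_comp {H G K : GroupOver.{u} Γ} (α : H.Hom G) (β : G.Hom K) (n : ℤ) :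
    E.pointMap α n ≫ E.pointMap β n = E.pointMap (β.comp α) n := by
  have nat := (E.ind β n).naturality (counitPoint α.toMonoidHom)
  have e : GCWPair.inducedMap β.toMonoidHom (counitPoint α.toMonoidHom) ≫
      counitPoint β.toMonoidHom =
        (GCWComplex.point H.carrier).toPair.inducedComp α.toMonoidHom β.toMonoidHom ≫
          counitPoint (β.comp α).toMonoidHom := rfl
  have e' := congrArg ((E.theory K).H n).map e
  simp only [Functor.map_comp] at e'
  simp only [pointMap, E.ind_comp, Category.assoc]
  rw [reassoc_of% nat]
  exact congrArg (fun t => (E.ind α n).app (GCWComplex.point H.carrier).toPair ≫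
    (E.ind β n).app (GCWPair.induced α.toMonoidHom (GCWComplex.point H.carrier).toPair) ≫ t) e'

variable {G : GroupOver.{u} Γ} (D : DirectedCocone G.carrier)

/-- `G_i` as a group over `Γ`. -/
abbrev stage (D : DirectedCocone G.carrier) (i : D.I) : GroupOver.{u} Γ := G.pull (D.toG i)

/-- The structure map `ψ_i` as a morphism of groups over `Γ`. -/
def stageToG (D : DirectedCocone G.carrier) (i : D.I) : (stage D i).Hom G := ⟨D.toG i, rfl⟩

/-- The structure map `φ_{i,j}` as a morphism of groups over `Γ`. -/
def stageMap (D : DirectedCocone G.carrier) (i j : D.I) (hij : i ≤ j) :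
    (stage D i).Hom (stage D j) :=
  ⟨D.map i j hij, by
    change (G.hom.comp (D.toG j)).comp (D.map i j hij) = G.hom.comp (D.toG i)
    rw [MonoidHom.comp_assoc, D.toG_map]⟩

theorem stageToG_comp (i j : D.I) (hij : i ≤ j) :
    (stageToG D j).comp (stageMap D i j hij) = stageToG D i := by
  exact GroupOver.Hom.ext (D.toG_map i j hij)

open Classical in
/-- The map `t_n^G({•}) : colim_i H_n^{G_i}({•}) → H_n^G({•})`. -/
noncomputable def colimMap (n : ℤ) :
    Module.DirectLimit (fun i => E.atPoint (stage D i) n)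
      (fun i j hij => (E.pointMap (stageMap D i j hij) n).hom) →ₗ[Λ] E.atPoint G n :=
  Module.DirectLimit.lift Λ D.I _ _ (fun i => (E.pointMap (stageToG D i) n).hom)
    fun i j hij p => by
      rw [← stageToG_comp D i j hij, ← E.pointMap_comp]
      rfl

/-- Continuity of an equivariant homology theory over `Γ`. -/
def IsContinuous : Prop :=
  ∀ (G : GroupOver.{u} Γ) (I : Type u) [Preorder I] [IsDirectedOrder I] [Nonempty I]
    (S : I → Subgroup G.carrier) (hS : Monotone S), (∀ g, ∃ i, g ∈ S i) →
    ∀ n : ℤ, Function.Bijective (E.colimMap (DirectedCocone.ofSubgroups S hS) n)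

/-- Strong continuity of an equivariant homology theory over `Γ`. -/
def IsStronglyContinuous : Prop :=
  ∀ (G : GroupOver.{u} Γ) (D : DirectedCocone G.carrier), D.IsColimit →
    ∀ n : ℤ, Function.Bijective (E.colimMap D n)

/-- The Isomorphism Conjecture for `(G, ξ)` and the family `F`.  The classifying space is any model
of it; by homotopy invariance the choice does not matter. -/
def IsomorphismConjecture (G : GroupOver.{u} Γ) (F : SubgroupFamily G.carrier) : Prop :=
  ∀ X : GCWComplex G.carrier, IsClassifyingSpace F X →
    ∀ n : ℤ, Function.Bijective (((E.theory G).H n).map X.toPoint).hom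

/-- The Fibered Isomorphism Conjecture for `(G, ξ)` and the family `F`. -/
def FiberedIsomorphismConjecture (G : GroupOver.{u} Γ) (F : SubgroupFamily G.carrier) : Prop :=
  ∀ (K : Type u) [Group K] (φ : K →* G.carrier),
    E.IsomorphismConjecture (G.pull φ) (F.pullback φ)

end EquivariantHomologyTheory

end EquivariantHomology

/-!
The homology of a group `G` at a classifying space is compared with the homology of groups mapping
to `G` by a five lemma argument over cells.  To avoid general mapping spaces and cellular
approximation, all spaces which occur are order complexes of ranked posets with a `G`-action
(`GPoset`); the rank makes the order complex a `G`-CW-complex, and its fixed points are the order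
complex of the fixed points (`GPoset.fixedHomeomorph`).

*Homology on posets.*  A `G`-homology theory restricted to `G`-posets has Mayer–Vietoris sequences,
is additive, and identifies comparable maps; `PosetTheory` records just this.  Let a directed
system of such theories map to a further one, the target.  If the target is the colimit of the
system on the orbits `G/L`, then this is so on posets of finite rank, where elements of top rank are
attached by coning off their links (`GPoset.rankSquare`).  To reach infinite rank, `X` is replaced
by its telescope in the product of `X` with the fence `0 < 1 > 2 < ⋯`, which is covered by two
subposets whose components have finite rank (`TheorySystem.isColim_telescope`).  The same induction,
applied to the system with one member, proves that a transformation is an isomorphism.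

*Classifying spaces.*  For a family `F`, the nonempty words in the letters `⨿ G/L`, `L ∈ F`, ordered
by being a subword, are a poset model: putting a fixed letter in front of a word gives a contraction
of the fixed points.  The telescope of this poset satisfies the weak form `Models` of the definition
of a classifying space, and by equivariant obstruction theory any two models have the same homology
(`Models.bijective_iff`), so that the conjecture can be tested on it.

*Colimits and transitivity.*  Let `G` be the colimit of groups `G_i`, and let `L_i` be the
preimages in `G_i` of `L ≤ G`.  The homology of `G/L` restricted to `G_i` is, in the colimit, that of
a point for `L_i`, so that (strong) continuity for `L_i → L` yields the colimit property on orbits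
(`isColim_orbit`).  Hence the conjecture passes from the `G_i` and the pulled back families to `G`
(`isomorphismConjecture_of_stages`).  Moreover it passes from a family `F` to a larger family `F'`
if it holds for the members of `F'` (`IsomorphismConjecture.of_le`): if `Y` and `X` model `F` and
`F'`, then `Y × X` models `F`, and `Y × X → X` is an isomorphism in homology because it is so over
each orbit `G/L` of `X`, where it is induced from `Y → pt` for the group `L`.

*Conclusion.*  Every group is the directed union of its finitely generated subgroups, which
settles continuous theories and reduces the strongly continuous case to finitely generated `G`.
Such a `G` is the colimit of finitely presented groups `G_i`.  For `K → G`, the group `K` is the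
colimit of the fiber products `K_i = G_i ×_G K`.  The conjecture holds for `K_i` and the family
pulled back from `G_i`.  As `C` is closed under quotients, this family is contained in the one
pulled back from `G`, and transitivity enlarges it; its hypothesis is again an instance of the
fibered conjecture for `G_i`.
-/


namespace EquivariantHomology

/-! ### Order complexes of posets -/

/-- The geometric realization `|X|` of the order complex of a poset `X`: the finitely supported
convex combinations of elements of `X` whose support is a chain. -/
def OrderComplex (X : Type u) [PartialOrder X] : Type u :=
  {x : X →₀ ℝ // (∀ v, 0 ≤ x v) ∧ (x.sum fun _ r => r) = 1 ∧
    IsChain (· ≤ ·) (x.support : Set X)}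

namespace OrderComplex

variable {X Y Z : Type u} {ι κ : Type*} [Fintype ι] [Fintype κ]

/-- The combination `∑ w i • c i`. -/
noncomputable def combo (c : ι → X) (w : ι → ℝ) : X →₀ ℝ := ∑ i, Finsupp.single (c i) (w i)

theorem combo_apply (c : ι → X) (w : ι → ℝ) (v : X) [DecidableEq X] :
    combo c w v = ∑ i, if c i = v then w i else 0 := by
  simp [combo, Finsupp.finsetSum_apply, Finsupp.single_apply]

theorem exists_of_combo_ne_zero {c : ι → X} {w : ι → ℝ} {v : X} (h : combo c w v ≠ 0) :
    ∃ i, c i = v ∧ w i ≠ 0 := by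
  classical
  rw [combo_apply] at h
  obtain ⟨i, -, hi⟩ := Finset.exists_ne_zero_of_sum_ne_zero h
  by_cases hc : c i = v
  · exact ⟨i, hc, by simpa [hc] using hi⟩
  · simp [hc] at hi

theorem le_combo {c : ι → X} {w : ι → ℝ} (hw : ∀ i, 0 ≤ w i) (i : ι) :
    w i ≤ combo c w (c i) := by
  classical
  rw [combo_apply]
  have := Finset.single_le_sum (f := fun j => if c j = c i then w j else 0)
    (fun j _ => by split_ifs <;> simp [hw]) (Finset.mem_univ i)
  simpa using this

theorem combo_nonneg {c : ι → X} {w : ι → ℝ} (hw : ∀ i, 0 ≤ w i) (v : X) :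
    0 ≤ combo c w v := by
  classical
  rw [combo_apply]
  exact Finset.sum_nonneg fun i _ => by split_ifs <;> simp [hw]

theorem combo_of_injective {c : ι → X} (hc : Function.Injective c) (w : ι → ℝ) (i : ι) :
    combo c w (c i) = w i := by
  classical
  simp [combo_apply, hc.eq_iff]

theorem sum_combo (c : ι → X) (w : ι → ℝ) :
    ((combo c w).sum fun _ r => r) = ∑ i, w i := by
  rw [combo, ← Finsupp.sum_finsetSum_index (fun _ => rfl) (fun _ _ _ => rfl)]
  simp

theorem combo_comp_equiv (c : ι → X) (w : ι → ℝ) (e : κ ≃ ι) :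
    combo (c ∘ e) (w ∘ e) = combo c w :=
  e.sum_comp fun i => Finsupp.single (c i) (w i)

theorem mapDomain_combo (f : X → Y) (c : ι → X) (w : ι → ℝ) :
    (combo c w).mapDomain f = combo (f ∘ c) w := by
  simp [combo, Finsupp.mapDomain_finsetSum, Finsupp.mapDomain_single]

theorem combo_of_injective_index (e : κ → ι) (he : Function.Injective e) (c : ι → X) (w : ι → ℝ)
    (hw : ∀ i, i ∉ Set.range e → w i = 0) : combo (c ∘ e) (w ∘ e) = combo c w :=
  Fintype.sum_of_injective e he _ _ (fun i hi => by rw [hw i hi, Finsupp.single_zero])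
    fun _ => rfl

theorem combo_simplexMap (c : ι → X) (e : κ → ι) (p : stdSimplex ℝ κ) :
    combo c (stdSimplex.map e p) = combo (c ∘ e) p := by
  classical
  simp only [combo, stdSimplex.map_coe, FunOnFinite.linearMap_apply_apply, Finsupp.single_finsetSum]
  rw [← Finset.sum_fiberwise Finset.univ e fun i => Finsupp.single ((c ∘ e) i) (p i)]
  refine Finset.sum_congr rfl fun j _ => Finset.sum_congr (by simp) fun i hi => ?_
  rw [Function.comp, (Finset.mem_filter.1 hi).2]

theorem exists_simplexMap_eq {e : κ → ι} (he : Function.Injective e) (p : stdSimplex ℝ ι)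
    (hp : ∀ i, i ∉ Set.range e → p i = 0) :
    ∃ q : stdSimplex ℝ κ, (∀ k, q k = p (e k)) ∧ stdSimplex.map e q = p := by
  classical
  let q : stdSimplex ℝ κ := ⟨p ∘ e, fun k => p.2.1 _, by
    rw [← p.2.2]
    exact Fintype.sum_of_injective e he _ _ hp fun _ => rfl⟩
  refine ⟨q, fun k => rfl, ?_⟩
  ext i
  simp only [stdSimplex.map_coe, FunOnFinite.linearMap_apply_apply]
  by_cases hi : i ∈ Set.range e
  · obtain ⟨k, rfl⟩ := hi
    rw [Finset.sum_eq_single k]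
    · rfl
    · intro j hj hjk
      exact absurd (he (Finset.mem_filter.1 hj).2) hjk
    · simp
  · rw [hp i hi]
    exact Finset.sum_eq_zero fun k hk => absurd ⟨k, (Finset.mem_filter.1 hk).2⟩ hi

variable [PartialOrder X] [PartialOrder Y] [PartialOrder Z]

/-- The point of `|X|` with weights `w`. -/
noncomputable def ofWeights (c : ι → X) (w : stdSimplex ℝ ι)
    (h : IsChain (· ≤ ·) (c '' {i | w i ≠ 0})) : OrderComplex X :=
  ⟨combo c w, combo_nonneg w.2.1, by rw [sum_combo]; exact w.2.2, by
    refine h.mono fun v hv => ?_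
    obtain ⟨i, rfl, hi⟩ := exists_of_combo_ne_zero (Finsupp.mem_support_iff.1 hv)
    exact ⟨i, hi, rfl⟩⟩

/-- The affine map from a simplex to `|X|` given by the chain `c`. -/
noncomputable def face (c : ι → X) (hc : IsChain (· ≤ ·) (Set.range c)) (w : stdSimplex ℝ ι) :
    OrderComplex X :=
  ofWeights c w (hc.mono (Set.image_subset_range _ _))

@[simp] theorem face_val (c : ι → X) (hc) (w : stdSimplex ℝ ι) : (face c hc w).1 = combo c w := rfl

/-- The weak topology: a set is closed if its intersection with every simplex is closed. -/
noncomputable instance : TopologicalSpace (OrderComplex X) :=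
  ⨆ t : Σ n, {c : Fin n → X // IsChain (· ≤ ·) (Set.range c)},
    TopologicalSpace.coinduced (face t.2.1 t.2.2) inferInstance

theorem isClosed_iff_face {T : Set (OrderComplex X)} : IsClosed T ↔
    ∀ n (c : Fin n → X) (hc : IsChain (· ≤ ·) (Set.range c)), IsClosed (face c hc ⁻¹' T) := by
  simp only [isClosed_iSup_iff, isClosed_coinduced]
  exact ⟨fun h n c hc => h ⟨n, c, hc⟩, fun h t => h t.1 t.2.1 t.2.2⟩

/-- The simplex relabelled along a bijection. -/
theorem face_comp_equiv (c : ι → X) (hc : IsChain (· ≤ ·) (Set.range c)) (e : κ ≃ ι)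
    (hc' : IsChain (· ≤ ·) (Set.range (c ∘ e))) (w : stdSimplex ℝ ι) :
    face c hc w = face (c ∘ e) hc' ⟨w ∘ e, fun i => w.2.1 _, by
      rw [← w.2.2]; exact e.sum_comp w.1⟩ :=
  Subtype.ext (combo_comp_equiv c w e).symm

theorem continuous_face (c : ι → X) (hc : IsChain (· ≤ ·) (Set.range c)) :
    Continuous (face c hc) := by
  let e := (Fintype.equivFin ι).symm
  have hc' : IsChain (· ≤ ·) (Set.range (c ∘ e)) := hc.mono (Set.range_comp_subset_range _ _)
  have h : Continuous (face (c ∘ e) hc') :=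
    continuous_iff_coinduced_le.2
      (le_iSup (fun t : Σ n, {c : Fin n → X // IsChain (· ≤ ·) (Set.range c)} =>
        TopologicalSpace.coinduced (face t.2.1 t.2.2) inferInstance) ⟨_, c ∘ e, hc'⟩)
  rw [funext (face_comp_equiv c hc e hc')]
  refine h.comp (Continuous.subtype_mk ?_ _)
  exact continuous_pi fun i => (continuous_apply (e i)).comp continuous_subtype_val

/-- A family of convex combinations of finitely many elements with continuously varying weights
is continuous, even if the chain supporting the combination varies. -/
theorem continuous_ofWeights {K : Type*} [TopologicalSpace K] (c : ι → X)
    (w : K → stdSimplex ℝ ι) (hw : Continuous w)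
    (h : ∀ k, IsChain (· ≤ ·) (c '' {i | w k i ≠ 0})) :
    Continuous fun k => ofWeights c (w k) (h k) := by
  classical
  let K' : {s : Set ι // IsChain (· ≤ ·) (c '' s)} → Set K := fun s => {k | ∀ i ∉ s.1, w k i = 0}
  have hwi : ∀ i, Continuous fun k => w k i := fun i =>
    (continuous_apply i).comp (continuous_subtype_val.comp hw)
  have hcl : ∀ s, IsClosed (K' s) := fun s => by
    simp only [K', Set.ofPred_forall]
    exact isClosed_iInter fun i => isClosed_iInter fun _ => isClosed_eq (hwi i) continuous_const
  refine (locallyFinite_of_finite K').continuous ?_ hcl fun s => ?_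
  · refine Set.eq_univ_of_forall fun k => Set.mem_iUnion.2 ⟨⟨_, h k⟩, fun i hi => ?_⟩
    simpa using hi
  · have hc : IsChain (· ≤ ·) (Set.range (c ∘ (Subtype.val : s.1 → ι))) := by
      rw [Set.range_comp, Subtype.range_coe]
      exact s.2
    rw [continuousOn_iff_continuous_domRestrict]
    have hsum : ∀ k : K' s, ∑ i : s.1, w k i = 1 := fun k => by
      rw [← (w k).2.2]
      exact Fintype.sum_of_injective _ Subtype.val_injective _ _
        (fun i hi => k.2 i (by simpa using hi)) fun _ => rfl
    have hw' : Continuous fun k : K' s =>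
        (⟨fun i => w k i, fun i => (w k).2.1 _, hsum k⟩ : stdSimplex ℝ s.1) :=
      Continuous.subtype_mk (continuous_pi fun i : s.1 => (hwi i).comp continuous_subtype_val) _
    convert (continuous_face _ hc).comp hw' using 1
    ext k
    exact Subtype.ext (combo_of_injective_index _ Subtype.val_injective c (w k)
      fun i hi => k.2 i (by simpa using hi)).symm

/-- A chain of `n` elements is the range of a strictly monotone sequence. -/
theorem exists_strictMono_enum (σ : Finset X) (hσ : IsChain (· ≤ ·) (σ : Set X)) :
    ∃ c : Fin σ.card → X, StrictMono c ∧ Set.range c = σ := by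
  classical
  let _ : LinearOrder σ :=
    { (inferInstance : PartialOrder σ) with
      le_total := fun a b => hσ.total a.2 b.2
      toDecidableLE := Classical.decRel _ }
  let e : Fin σ.card ≃o σ := Fintype.orderIsoFinOfCardEq σ (by simp)
  refine ⟨fun i => (e i).1, fun i j h => e.strictMono h, ?_⟩
  ext v
  constructor
  · rintro ⟨i, rfl⟩
    exact (e i).2
  · exact fun hv => ⟨e.symm ⟨v, hv⟩, by simp⟩

theorem isClosed_iff_strictMono {T : Set (OrderComplex X)} : IsClosed T ↔
    ∀ n (c : Fin n → X) (hc : StrictMono c),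
      IsClosed (face c hc.monotone.isChain_range ⁻¹' T) := by
  classical
  refine ⟨fun h n c hc => h.preimage (continuous_face _ _), fun h => ?_⟩
  rw [isClosed_iff_face]
  intro n c hc
  obtain ⟨c', hc', hr⟩ := exists_strictMono_enum (Finset.univ.image c) (by simpa using hc)
  have : ∀ i, ∃ j, c' j = c i := fun i => by
    have : c i ∈ Set.range c' := by rw [hr]; simp
    exact this
  choose e he using this
  have hface : ∀ p : stdSimplex ℝ (Fin n),
      face c hc p = face c' hc'.monotone.isChain_range (stdSimplex.map e p) := fun p => by
    apply Subtype.ext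
    change combo c p = combo c' (stdSimplex.map e p)
    rw [combo_simplexMap, show c' ∘ e = c from funext he]
  have := (h _ c' hc').preimage (stdSimplex.continuous_map (S := ℝ) e)
  rw [← Set.preimage_comp] at this
  rwa [show face c hc = _ from funext hface]

theorem continuous_iff_strictMono {K : Type*} [TopologicalSpace K] {f : OrderComplex X → K} :
    Continuous f ↔ ∀ n (c : Fin n → X) (hc : StrictMono c),
      Continuous (f ∘ face c hc.monotone.isChain_range) := by
  refine ⟨fun h n c hc => h.comp (continuous_face _ _), fun h => ?_⟩
  refine continuous_iff_isClosed.2 fun T hT => isClosed_iff_strictMono.2 fun n c hc => ?_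
  exact hT.preimage (h n c hc)

/-- A point as an interior point of the simplex spanned by its support. -/
theorem exists_face_eq (x : OrderComplex X) : ∃ (n : ℕ) (c : Fin n → X) (hc : StrictMono c)
    (p : stdSimplex ℝ (Fin n)), (∀ i, 0 < p i) ∧ face c hc.monotone.isChain_range p = x := by
  obtain ⟨c, hc, hr⟩ := exists_strictMono_enum x.1.support x.2.2.2
  have hx : combo c (fun i => x.1 (c i)) = x.1 := by
    ext v
    by_cases hv : v ∈ Set.range c
    · obtain ⟨i, rfl⟩ := hv
      exact combo_of_injective hc.injective _ i
    · have h0 : x.1 v = 0 := by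
        rw [hr] at hv
        simpa using hv
      rw [h0]
      by_contra h
      obtain ⟨i, rfl, -⟩ := exists_of_combo_ne_zero h
      exact hv ⟨i, rfl⟩
  refine ⟨_, c, hc, ⟨fun i => x.1 (c i), fun i => x.2.1 _, ?_⟩, fun i => ?_, Subtype.ext hx⟩
  · rw [← sum_combo c, hx]
    exact x.2.2.1
  · refine lt_of_le_of_ne (x.2.1 _) (Ne.symm ?_)
    have : c i ∈ Set.range c := ⟨i, rfl⟩
    rw [hr] at this
    exact Finsupp.mem_support_iff.1 this

theorem support_face {c : ι → X} {hc} {p : stdSimplex ℝ ι} :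
    ((face c hc p).1.support : Set X) = c '' {i | p i ≠ 0} := by
  ext v
  simp only [Finset.mem_coe, Finsupp.mem_support_iff, face_val]
  constructor
  · intro h
    obtain ⟨i, hi, h0⟩ := exists_of_combo_ne_zero h
    exact ⟨i, h0, hi⟩
  · rintro ⟨i, hi, rfl⟩
    have := le_combo (c := c) p.2.1 i
    exact ((lt_of_le_of_ne (p.2.1 i) (Ne.symm hi)).trans_le this).ne'

/-! ### Functoriality -/

/-- The map `|f|`. -/
noncomputable def map (f : X →o Y) (x : OrderComplex X) : OrderComplex Y :=
  ⟨x.1.mapDomain f, fun v => by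
      classical
      simp only [Finsupp.mapDomain, Finsupp.sum_apply, Finsupp.single_apply]
      exact Finset.sum_nonneg fun i _ => by dsimp only; split_ifs <;> simp [x.2.1],
    by rw [Finsupp.sum_mapDomain_index (fun _ => rfl) (fun _ _ _ => rfl)]; exact x.2.2.1, by
      classical
      refine IsChain.mono (Finset.coe_subset.2 Finsupp.mapDomain_support) ?_
      rw [Finset.coe_image]
      exact (by
        rintro _ ⟨a, ha, rfl⟩ _ ⟨b, hb, rfl⟩ -
        exact (x.2.2.2.total ha hb).imp (f.monotone ·) (f.monotone ·))⟩

theorem map_face (f : X →o Y) (c : ι → X) (hc) (hc') (p : stdSimplex ℝ ι) :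
    map f (face c hc p) = face (f ∘ c) hc' p :=
  Subtype.ext (mapDomain_combo f c p)

theorem continuous_map (f : X →o Y) : Continuous (map f) := by
  refine continuous_iff_strictMono.2 fun n c hc => ?_
  have hc' : IsChain (· ≤ ·) (Set.range (f ∘ c)) :=
    (f.monotone.comp hc.monotone).isChain_range
  exact (continuous_face (f ∘ c) hc').congr fun p => (map_face f c _ hc' p).symm

@[simp] theorem map_id : map (OrderHom.id : X →o X) = id :=
  funext fun _ => Subtype.ext Finsupp.mapDomain_id

theorem map_map (f : X →o Y) (g : Y →o Z) (x : OrderComplex X) :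
    map g (map f x) = map (g.comp f) x :=
  Subtype.ext Finsupp.mapDomain_comp.symm

theorem support_map [DecidableEq Y] (f : X →o Y) (x : OrderComplex X) :
    (map f x).1.support = x.1.support.image f := by
  obtain ⟨n, c, hc, p, hp, rfl⟩ := exists_face_eq x
  rw [← Finset.coe_inj, Finset.coe_image,
    map_face _ _ _ (f.monotone.comp hc.monotone).isChain_range, support_face, support_face,
    Set.image_comp]

theorem support_nonempty (x : OrderComplex X) : x.1.support.Nonempty := by
  rw [Finsupp.support_nonempty_iff]
  intro h
  have := x.2.2.1
  simp [h] at this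

/-- The vertex `v` as a point of `|X|`. -/
noncomputable def vertex (v : X) : OrderComplex X :=
  face (fun _ : Unit => v) (by simp) ⟨fun _ => 1, fun _ => zero_le_one, by simp⟩

theorem vertex_val (v : X) : (vertex v).1 = Finsupp.single v 1 := by
  simp [vertex, combo]

theorem eq_vertex {x : OrderComplex X} {v : X} (h : ∀ u ∈ x.1.support, u = v) :
    x = vertex v := by
  apply Subtype.ext
  rw [vertex_val]
  have h1 : x.1.support = {v} := by
    obtain ⟨u, hu⟩ := x.support_nonempty
    exact Finset.eq_singleton_iff_unique_mem.2 ⟨h u hu ▸ hu, h⟩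
  have h2 := x.2.2.1
  rw [Finsupp.sum, h1, Finset.sum_singleton] at h2
  rw [Finsupp.support_eq_singleton.1 h1 |>.2, h2]

theorem map_const (v : Y) (x : OrderComplex X) : map (OrderHom.const X v) x = vertex v := by
  classical
  refine eq_vertex fun u hu => ?_
  rw [support_map] at hu
  obtain ⟨_, -, rfl⟩ := Finset.mem_image.1 hu
  rfl

/-! ### Closed embeddings -/

section Embedding

variable (i : X →o Y) (hi : ∀ a b, i a ≤ i b → a ≤ b)
include hi

theorem injective_of_reflects : Function.Injective i := fun a b h =>
  le_antisymm (hi a b h.le) (hi b a h.ge)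

theorem map_injective : Function.Injective (map i) := fun _ _ h =>
  Subtype.ext (Finsupp.mapDomain_injective (injective_of_reflects i hi) (congrArg Subtype.val h))

theorem isClosedMap_map : IsClosedMap (map i) := by
  intro T hT
  refine isClosed_iff_strictMono.2 fun n c hc => ?_
  classical
  choose a ha using fun j : {j // c j ∈ Set.range i} => j.2
  have hac : IsChain (· ≤ ·) (Set.range a) := by
    rintro _ ⟨j, rfl⟩ _ ⟨k, rfl⟩ -
    refine (le_total j.1 k.1).imp (fun h => hi _ _ ?_) fun h => hi _ _ ?_
    · rw [ha, ha]; exact hc.monotone h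
    · rw [ha, ha]; exact hc.monotone h
  have hia : ∀ q : stdSimplex ℝ {j // c j ∈ Set.range i}, map i (face a hac q) =
      face c hc.monotone.isChain_range (stdSimplex.map Subtype.val q) := fun q => by
    apply Subtype.ext
    rw [face_val, combo_simplexMap]
    refine (mapDomain_combo i a q).trans ?_
    rw [show i ∘ a = c ∘ Subtype.val from funext ha]
  have key : face c hc.monotone.isChain_range ⁻¹' (map i '' T) =
      stdSimplex.map Subtype.val '' (face a hac ⁻¹' T) := by
    ext p
    constructor
    · rintro ⟨x, hx, e⟩
      have hp : ∀ j, j ∉ Set.range (Subtype.val : {j // c j ∈ Set.range i} → Fin n) → p j = 0 := by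
        intro j hj
        by_contra h0
        have hj' : c j ∈ ((map i x).1.support : Set Y) := by
          rw [e, support_face]
          exact ⟨j, h0, rfl⟩
        rw [support_map, Finset.coe_image] at hj'
        obtain ⟨v, -, hv⟩ := hj'
        exact hj ⟨⟨j, v, hv⟩, rfl⟩
      obtain ⟨q, -, hq⟩ := exists_simplexMap_eq Subtype.val_injective p hp
      refine ⟨q, ?_, hq⟩
      have : face a hac q = x := map_injective i hi (by rw [hia, hq, e])
      rwa [Set.mem_preimage, this]
    · rintro ⟨q, hq, rfl⟩
      exact ⟨_, hq, hia q⟩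
  rw [key]
  exact ((hT.preimage (continuous_face _ _)).isCompact.image
    (stdSimplex.continuous_map _)).isClosed

theorem isClosedEmbedding_map : Topology.IsClosedEmbedding (map i) :=
  .of_continuous_injective_isClosedMap (continuous_map i) (map_injective i hi)
    (isClosedMap_map i hi)

theorem range_map : Set.range (map i) = {x | (x.1.support : Set Y) ⊆ Set.range i} := by
  classical
  ext x
  constructor
  · rintro ⟨y, rfl⟩
    rw [Set.mem_ofPred_eq, support_map, Finset.coe_image]
    exact Set.image_subset_range _ _
  · intro h
    obtain ⟨n, c, hc, p, hp, rfl⟩ := exists_face_eq x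
    have : ∀ j, ∃ a, i a = c j := fun j => h (by
      rw [support_face]
      exact ⟨j, (hp j).ne', rfl⟩)
    choose a ha using this
    have hac : IsChain (· ≤ ·) (Set.range a) := by
      rintro _ ⟨j, rfl⟩ _ ⟨k, rfl⟩ -
      refine (le_total j k).imp (fun h => hi _ _ ?_) fun h => hi _ _ ?_
      · rw [ha, ha]; exact hc.monotone h
      · rw [ha, ha]; exact hc.monotone h
    refine ⟨face a hac p, ?_⟩
    apply Subtype.ext
    refine (mapDomain_combo i a p).trans ?_
    rw [show i ∘ a = c from funext ha]
    rfl

end Embedding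

end OrderComplex
namespace OrderComplex

variable {X Y Z : Type u} [PartialOrder X] [PartialOrder Y] [PartialOrder Z]

/-! ### Comparable monotone maps are homotopic -/

/-- If mass `r` lies in the interval `[a, a + r]`, the part of it which lies in `[0, t]`. -/
noncomputable def moved (a r t : ℝ) : ℝ := max 0 (t - a) - max 0 (t - a - r)

theorem continuous_moved : Continuous fun q : ℝ × ℝ × ℝ => moved q.1 q.2.1 q.2.2 := by
  unfold moved; fun_prop

theorem moved_zero_mass (a t : ℝ) : moved a 0 t = 0 := by simp [moved]

theorem moved_nonneg {a r t : ℝ} (hr : 0 ≤ r) : 0 ≤ moved a r t :=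
  sub_nonneg.2 (max_le_max le_rfl (by linarith))

theorem moved_le {a r t : ℝ} (hr : 0 ≤ r) : moved a r t ≤ r := by
  unfold moved
  rcases max_cases 0 (t - a) with h | h <;> rcases max_cases 0 (t - a - r) with h' | h' <;> linarith

theorem moved_of_le {a r t : ℝ} (h : t ≤ a) (hr : 0 ≤ r) : moved a r t = 0 := by
  rw [moved, max_eq_left (by linarith), max_eq_left (by linarith), sub_zero]

theorem moved_of_ge {a r t : ℝ} (h : a + r ≤ t) (hr : 0 ≤ r) : moved a r t = r := by
  rw [moved, max_eq_right (by linarith), max_eq_right (by linarith)]; ring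

open Classical in
/-- The mass of a point of `|X|` strictly above `v`. -/
noncomputable def massAbove (x : X →₀ ℝ) (v : X) : ℝ := x.sum fun w r => if v < w then r else 0

open Classical in
theorem massAbove_combo {ι : Type*} [Fintype ι] (c : ι → X) (p : ι → ℝ) (v : X) :
    massAbove (combo c p) v = ∑ i, if v < c i then p i else 0 := by
  rw [massAbove, combo, ← Finsupp.sum_finsetSum_index (fun _ => by simp)
    (fun _ _ _ => by split_ifs <;> simp)]
  simp

/-- The time `t` of the homotopy from `|f|` to `|g|` for `f ≤ g`: the topmost part of mass `t` of
the point has already been moved from `f` to `g`. -/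
noncomputable def cut (f g : X → Y) (x : X →₀ ℝ) (t : ℝ) : Y →₀ ℝ :=
  x.sum fun v r => Finsupp.single (f v) (r - moved (massAbove x v) r t) +
    Finsupp.single (g v) (moved (massAbove x v) r t)

/-- The weights of `cut` on a simplex. -/
noncomputable def cutWeights {n : ℕ} (c : Fin n → X) (p : Fin n → ℝ) (t : ℝ) (i : Fin n × Bool) :
    ℝ :=
  if i.2 then moved (massAbove (combo c p) (c i.1)) (p i.1) t
  else p i.1 - moved (massAbove (combo c p) (c i.1)) (p i.1) t

omit [PartialOrder Y] in
theorem cut_combo (f g : X → Y) {n : ℕ} (c : Fin n → X) (hc : StrictMono c) (p : Fin n → ℝ)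
    (t : ℝ) : cut f g (combo c p) t =
      combo (fun i : Fin n × Bool => if i.2 then g (c i.1) else f (c i.1)) (cutWeights c p t) := by
  classical
  have hR : combo (fun i : Fin n × Bool => if i.2 then g (c i.1) else f (c i.1))
      (cutWeights c p t) = ∑ i, (Finsupp.single (g (c i))
        (moved (massAbove (combo c p) (c i)) (p i) t) + Finsupp.single (f (c i))
          (p i - moved (massAbove (combo c p) (c i)) (p i) t)) := by
    simp [combo, Fintype.sum_prod_type, cutWeights]
  rw [hR]
  have hs : (combo c p).support ⊆ Finset.univ.image c := fun v hv => by
    obtain ⟨i, rfl, -⟩ := exists_of_combo_ne_zero (Finsupp.mem_support_iff.1 hv)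
    simp
  rw [cut, Finsupp.sum_of_support_subset _ hs _ fun v _ => by simp [moved_zero_mass],
    Finset.sum_image hc.injective.injOn]
  refine Finset.sum_congr rfl fun i _ => ?_
  rw [combo_of_injective hc.injective, add_comm]

theorem cutWeights_mem {n : ℕ} (c : Fin n → X) (p : stdSimplex ℝ (Fin n)) (t : ℝ) :
    cutWeights c p t ∈ stdSimplex ℝ (Fin n × Bool) := by
  constructor
  · rintro ⟨i, b⟩
    cases b
    · exact sub_nonneg.2 (moved_le (p.2.1 i))
    · exact moved_nonneg (p.2.1 i)
  · rw [Fintype.sum_prod_type]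
    simp only [cutWeights, Fintype.sum_bool, if_true, Bool.false_eq_true, if_false]
    rw [← p.2.2]
    exact Finset.sum_congr rfl fun i _ => add_sub_cancel _ _

theorem cut_isChain {f g : X → Y} (hf : Monotone f) (hg : Monotone g) (h : ∀ v, f v ≤ g v) {n : ℕ}
    (c : Fin n → X) (hc : StrictMono c) (p : stdSimplex ℝ (Fin n)) (t : ℝ) :
    IsChain (· ≤ ·) ((fun i : Fin n × Bool => if i.2 then g (c i.1) else f (c i.1)) ''
      {i | cutWeights c p t i ≠ 0}) := by
  classical
  -- mass is moved from the top, so that `f (c i)` and `g (c j)` both occur only for `i ≤ j`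
  have key : ∀ i j, cutWeights c p t (i, false) ≠ 0 → cutWeights c p t (j, true) ≠ 0 →
      f (c i) ≤ g (c j) := by
    intro i j hi hj
    refine le_trans (hf (hc.monotone ?_)) (h _)
    by_contra hij
    rw [not_le] at hij
    have h1 : massAbove (combo c p) (c j) < t := by
      by_contra h1
      exact hj (moved_of_le (not_lt.1 h1) (p.2.1 j))
    have h2 : massAbove (combo c p) (c i) + p i ≤ massAbove (combo c p) (c j) := by
      simp only [massAbove_combo, hc.lt_iff_lt]
      rw [← Finset.sum_ite_eq' Finset.univ i (fun k => p k) |>.trans (if_pos (Finset.mem_univ i)),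
        ← Finset.sum_add_distrib]
      refine Finset.sum_le_sum fun k _ => ?_
      have : 0 ≤ p k := p.2.1 k
      by_cases hk : i < k
      · simp [hk, hk.ne', hij.trans hk]
      · by_cases hk' : k = i
        · subst hk'; simp [hij]
        · simp only [hk, hk', if_false, add_zero]
          split_ifs <;> simp [this]
    exact hi (sub_eq_zero.2 (moved_of_ge (h2.trans h1.le) (p.2.1 i)).symm)
  rintro _ ⟨⟨i, b⟩, hi, rfl⟩ _ ⟨⟨j, b'⟩, hj, rfl⟩ -
  cases b <;> cases b'
  · exact (le_total i j).imp (fun h => hf (hc.monotone h)) fun h => hf (hc.monotone h)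
  · exact Or.inl (key i j hi hj)
  · exact Or.inr (key j i hj hi)
  · exact (le_total i j).imp (fun h => hg (hc.monotone h)) fun h => hg (hc.monotone h)

variable (f g : X →o Y) (h : ∀ v, f v ≤ g v)

/-- The homotopy from `|f|` to `|g|` for `f ≤ g`. -/
noncomputable def homotopyFun (x : OrderComplex X) (t : ℝ) : OrderComplex Y :=
  ⟨cut f g x.1 t, by
    obtain ⟨n, c, hc, p, -, rfl⟩ := exists_face_eq x
    rw [face_val, cut_combo f g c hc]
    exact (ofWeights _ ⟨_, cutWeights_mem c p t⟩
      (cut_isChain f.monotone g.monotone h c hc p t)).2⟩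

theorem homotopyFun_face {n : ℕ} (c : Fin n → X) (hc : StrictMono c) (p : stdSimplex ℝ (Fin n))
    (t : ℝ) : homotopyFun f g h (face c hc.monotone.isChain_range p) t =
      ofWeights _ ⟨_, cutWeights_mem c p t⟩ (cut_isChain f.monotone g.monotone h c hc p t) :=
  Subtype.ext (cut_combo f g c hc p t)

/-- A map on `|X| × I` is continuous if it is so on `Δ × I` for every simplex `Δ` of `|X|`. -/
theorem continuous_prod_unitInterval {K : Type*} [TopologicalSpace K]
    {F : OrderComplex X × unitInterval → K}
    (hF : ∀ n (c : Fin n → X) (hc : StrictMono c),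
      Continuous fun q : stdSimplex ℝ (Fin n) × unitInterval =>
        F (face c hc.monotone.isChain_range q.1, q.2)) : Continuous F := by
  have hslice : ∀ x, Continuous fun t => F (x, t) := fun x => by
    obtain ⟨n, c, hc, p, -, rfl⟩ := exists_face_eq x
    exact (hF n c hc).comp (Continuous.prodMk_right p)
  let F' : OrderComplex X → C(unitInterval, K) := fun x => ⟨fun t => F (x, t), hslice x⟩
  have hF' : Continuous F' := continuous_iff_strictMono.2 fun n c hc =>
    (ContinuousMap.curry ⟨_, hF n c hc⟩).continuous
  exact (ContinuousMap.uncurry ⟨F', hF'⟩).continuous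

theorem continuous_homotopyFun :
    Continuous fun q : OrderComplex X × unitInterval => homotopyFun f g h q.1 q.2 := by
  classical
  refine continuous_prod_unitInterval fun n c hc => ?_
  simp only [homotopyFun_face f g h c hc]
  refine continuous_ofWeights _
    (fun q : stdSimplex ℝ (Fin n) × unitInterval =>
      (⟨_, cutWeights_mem c q.1 q.2⟩ : stdSimplex ℝ (Fin n × Bool))) ?_ _
  refine Continuous.subtype_mk (continuous_pi ?_) _
  have hp : ∀ i, Continuous fun q : stdSimplex ℝ (Fin n) × unitInterval => q.1 i := fun i =>
    (continuous_apply i).comp (continuous_subtype_val.comp continuous_fst)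
  have hm : ∀ i, Continuous fun q : stdSimplex ℝ (Fin n) × unitInterval =>
      moved (massAbove (combo c q.1) (c i)) (q.1 i) q.2 := fun i => by
    refine continuous_moved.comp (.prodMk ?_ (.prodMk (hp i)
      (continuous_subtype_val.comp continuous_snd)))
    have : ∀ j, Continuous fun q : stdSimplex ℝ (Fin n) × unitInterval =>
        if c i < c j then q.1 j else 0 := fun j => by
      split_ifs
      exacts [hp j, continuous_const]
    exact (continuous_finsetSum Finset.univ fun j _ => this j).congr
      fun q => (massAbove_combo c q.1 (c i)).symm
  rintro ⟨i, b⟩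
  cases b
  · exact (hp i).sub (hm i)
  · exact hm i

theorem homotopyFun_zero (x : OrderComplex X) : homotopyFun f g h x 0 = map f x := by
  apply Subtype.ext
  have h0 : ∀ v, moved (massAbove x.1 v) (x.1 v) 0 = 0 := fun v =>
    moved_of_le (Finset.sum_nonneg fun w _ => by
      dsimp only
      split_ifs
      exacts [x.2.1 w, le_rfl]) (x.2.1 v)
  change cut f g x.1 0 = x.1.mapDomain f
  simp [cut, Finsupp.mapDomain, Finsupp.sum, h0]

theorem homotopyFun_one (x : OrderComplex X) : homotopyFun f g h x 1 = map g x := by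
  classical
  apply Subtype.ext
  have h0 : ∀ v, moved (massAbove x.1 v) (x.1 v) 1 = x.1 v := fun v => by
    refine moved_of_ge ?_ (x.2.1 v)
    obtain ⟨n, c, hc, p, -, rfl⟩ := exists_face_eq x
    rw [face_val, massAbove_combo, combo_apply, ← Finset.sum_add_distrib, ← p.2.2]
    refine Finset.sum_le_sum fun i _ => ?_
    have := p.2.1 i
    by_cases h1 : v < c i
    · simp [h1, h1.ne']; exact le_rfl
    · by_cases h2 : c i = v
      · simp [h2]; exact le_rfl
      · simpa [h1, h2] using this
  change cut f g x.1 1 = x.1.mapDomain g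
  simp [cut, Finsupp.mapDomain, Finsupp.sum, h0]

/-- The homotopy is natural for embeddings of posets. -/
theorem map_homotopyFun {X' Y' : Type u} [PartialOrder X'] [PartialOrder Y'] (f' g' : X' →o Y') (h')
    (a : X →o X') (ha : ∀ u v, a u ≤ a v → u ≤ v) (b : Y →o Y') (hf : ∀ v, f' (a v) = b (f v))
    (hg : ∀ v, g' (a v) = b (g v)) (x : OrderComplex X) (t : ℝ) :
    homotopyFun f' g' h' (map a x) t = map b (homotopyFun f g h x t) := by
  obtain ⟨n, c, hc, p, hp, rfl⟩ := exists_face_eq x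
  have hac : StrictMono (a ∘ c) := fun i j hij =>
    (a.monotone.comp hc.monotone).strictMono_of_injective
      ((injective_of_reflects a ha).comp hc.injective) hij
  rw [map_face _ _ _ hac.monotone.isChain_range]
  apply Subtype.ext
  change cut f' g' (combo _ _) t = Finsupp.mapDomain b (cut f g (combo _ _) t)
  rw [cut_combo _ _ _ hac, cut_combo _ _ _ hc, mapDomain_combo]
  congr 1
  · ext ⟨i, b'⟩
    cases b' <;> simp [hf, hg]
  · classical
    ext ⟨i, b'⟩
    have hlt : ∀ u v, a u < a v ↔ u < v := fun u v => by
      rw [lt_iff_le_not_ge, lt_iff_le_not_ge]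
      exact and_congr ⟨ha _ _, fun h => a.monotone h⟩ (not_congr ⟨ha _ _, fun h => a.monotone h⟩)
    simp [cutWeights, massAbove_combo, hlt]

end OrderComplex

/-! ### Compact subsets of order complexes -/

namespace OrderComplex

variable {X : Type u} [PartialOrder X]

instance : T1Space (OrderComplex X) where
  t1 y := isClosed_iff_strictMono.2 fun n c hc => by
    refine Set.Subsingleton.isClosed fun p hp q hq => ?_
    have h : face c hc.monotone.isChain_range p = face c hc.monotone.isChain_range q :=
      (Set.mem_singleton_iff.1 hp).trans (Set.mem_singleton_iff.1 hq).symm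
    ext i
    rw [← combo_of_injective hc.injective p i, ← combo_of_injective hc.injective q i]
    exact DFunLike.congr_fun (congrArg Subtype.val h) (c i)

omit [PartialOrder X] in
theorem exists_stage_of_finite {N : ℕ → Set X} (hN : Monotone N) (hc : ∀ v, ∃ n, v ∈ N n)
    (s : Finset X) : ∃ n, (s : Set X) ⊆ N n := by
  choose k hk using hc
  exact ⟨s.sup k, fun v hv => hN (Finset.le_sup (f := k) hv) (hk v)⟩

/-- A compact subset of `|X|` is contained in a stage of any exhaustion of `X`. -/
theorem exists_stage_of_isCompact {N : ℕ → Set X} (hN : Monotone N) (hc : ∀ v, ∃ n, v ∈ N n)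
    {K : Set (OrderComplex X)} (hK : IsCompact K) :
    ∃ n, ∀ x ∈ K, (x.1.support : Set X) ⊆ N n := by
  by_contra! hcon
  choose x hxK hx using hcon
  have hlt : ∀ m n, ((x n).1.support : Set X) ⊆ N m → n < m := fun m n h => by
    by_contra hmn
    exact hx n (h.trans (hN (not_lt.1 hmn)))
  have hcl : ∀ m, IsClosed (x '' Set.Ici m) := fun m => by
    refine isClosed_iff_strictMono.2 fun k c hc' => ?_
    obtain ⟨m', hm'⟩ := exists_stage_of_finite hN hc (Finset.univ.map ⟨c, hc'.injective⟩)
    -- the simplex only meets the points `x n` with `n < m'`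
    have : face c hc'.monotone.isChain_range ⁻¹' (x '' Set.Ici m) =
        face c hc'.monotone.isChain_range ⁻¹' (x '' (Set.Ici m ∩ Set.Iio m')) := by
      ext p
      refine ⟨?_, fun ⟨n, hn, h⟩ => ⟨n, hn.1, h⟩⟩
      rintro ⟨n, hn, h⟩
      refine ⟨n, ⟨hn, hlt m' n ?_⟩, h⟩
      rw [h, support_face]
      refine (Set.image_subset_range _ _).trans (le_trans ?_ hm')
      simp
    rw [this]
    exact (((Set.finite_Iio m').inter_of_right _).image x).isClosed.preimage (continuous_face _ _)
  obtain ⟨y, hy⟩ := IsCompact.nonempty_iInter_of_sequence_nonempty_isCompact_isClosed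
    (fun m => x '' Set.Ici m) (fun m => Set.image_mono (Set.Ici_subset_Ici.2 m.le_succ))
    (fun m => ⟨x m, m, Set.mem_Ici.2 le_rfl, rfl⟩)
    (hK.of_isClosed_subset (hcl 0) (by rintro _ ⟨n, -, rfl⟩; exact hxK n)) hcl
  obtain ⟨m, hm⟩ := exists_stage_of_finite hN hc y.1.support
  obtain ⟨n, hn, rfl⟩ := Set.mem_iInter.1 hy m
  exact absurd (hlt m n hm) (not_lt.2 hn)

end OrderComplex

/-! ### Discs, simplices and prisms -/

/-- Every map from a sphere to `Z` extends to the disc, in all dimensions. -/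
def DiscExtension (Z : Type u) [TopologicalSpace Z] : Prop :=
  ∀ (n : ℕ) (f : Disc n → Z), ContinuousOn f {d | ‖(d : EuclideanSpace ℝ (Fin n))‖ = 1} →
    ∃ g : Disc n → Z, Continuous g ∧ ∀ d : Disc n, ‖(d : EuclideanSpace ℝ (Fin n))‖ = 1 → g d = f d

/-- The unit sphere `S^(n-1)`, as a subset of `D^n`. -/
abbrev DiscBoundary (n : ℕ) : Type := {d : Disc n // ‖(d : EuclideanSpace ℝ (Fin n))‖ = 1}

instance (n : ℕ) : CompactSpace (DiscBoundary n) :=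
  isCompact_iff_compactSpace.1 (isClosed_eq (by fun_prop) continuous_const).isCompact

/-- A null-homotopy of a map on the sphere gives an extension to the disc. -/
theorem exists_extension_of_nullhomotopy {Z : Type u} [TopologicalSpace Z] {n : ℕ}
    (F : DiscBoundary n × unitInterval → Z) (hF : Continuous F) (z : Z) (h1 : ∀ s, F (s, 1) = z) :
    ∃ g : Disc n → Z, Continuous g ∧ ∀ s : DiscBoundary n, g s = F (s, 0) := by
  by_cases hne : Nonempty (DiscBoundary n)
  · obtain ⟨s₀⟩ := hne
    have hmem : ∀ q : DiscBoundary n × unitInterval,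
        (1 - (q.2 : ℝ)) • (q.1 : EuclideanSpace ℝ (Fin n)) ∈
          Metric.closedBall (0 : EuclideanSpace ℝ (Fin n)) 1 := fun q => by
      rw [mem_closedBall_zero_iff, norm_smul, q.1.2, mul_one, Real.norm_eq_abs, abs_le]
      constructor <;> linarith [q.2.2.1, q.2.2.2]
    let π : DiscBoundary n × unitInterval → Disc n := fun q => ⟨_, hmem q⟩
    have hπ : Continuous π := Continuous.subtype_mk (by fun_prop) _
    have hsurj : Function.Surjective π := fun d => by
      by_cases hd : (d : EuclideanSpace ℝ (Fin n)) = 0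
      · exact ⟨(s₀, 1), Subtype.ext (by simp [π, hd])⟩
      · have hd0 : 0 < ‖(d : EuclideanSpace ℝ (Fin n))‖ := norm_pos_iff.2 hd
        have hd1 := mem_closedBall_zero_iff.1 d.2
        have hu : ‖‖(d : EuclideanSpace ℝ (Fin n))‖⁻¹ • (d : EuclideanSpace ℝ (Fin n))‖ = 1 := by
          rw [norm_smul, norm_inv, norm_norm, inv_mul_cancel₀ hd0.ne']
        refine ⟨(⟨⟨_, mem_closedBall_zero_iff.2 hu.le⟩, hu⟩,
          ⟨1 - ‖(d : EuclideanSpace ℝ (Fin n))‖, by linarith, by linarith⟩), Subtype.ext ?_⟩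
        simp only [π, sub_sub_cancel]
        rw [smul_smul, mul_inv_cancel₀ hd0.ne', one_smul]
    have hq : Topology.IsQuotientMap π := hπ.isClosedMap.isQuotientMap hπ hsurj
    have hfac : ∀ q q', π q = π q' → F q = F q' := by
      rintro ⟨s, t⟩ ⟨s', t'⟩ h
      have h : (1 - (t : ℝ)) • (s : EuclideanSpace ℝ (Fin n)) =
        (1 - (t' : ℝ)) • (s' : EuclideanSpace ℝ (Fin n)) := congrArg Subtype.val h
      have hn := congrArg norm h
      rw [norm_smul, norm_smul, s.2, s'.2, mul_one, mul_one, Real.norm_of_nonneg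
        (by linarith [t.2.2]), Real.norm_of_nonneg (by linarith [t'.2.2])] at hn
      have ht : t = t' := Subtype.ext (by linarith)
      subst ht
      by_cases ht1 : t = 1
      · subst ht1
        rw [h1, h1]
      · have : (1 - (t : ℝ)) ≠ 0 := fun h0 => ht1 (Subtype.ext (sub_eq_zero.1 h0).symm)
        rw [Subtype.ext (Subtype.ext (smul_right_injective _ this h) : s.1 = s'.1)]
    refine ⟨Function.surjInv hsurj |> (F ∘ ·), ?_, fun s => ?_⟩
    · rw [hq.continuous_iff]
      exact hF.congr fun q => (hfac _ _ (Function.surjInv_eq hsurj (π q))).symm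
    · refine hfac _ _ ((Function.surjInv_eq hsurj _).trans (Subtype.ext ?_))
      simp [π]
  · exact ⟨fun _ => z, continuous_const, fun s => (hne ⟨s⟩).elim⟩

theorem DiscExtension.of_nullhomotopy {Z : Type u} [TopologicalSpace Z]
    (h : ∀ (n : ℕ) (f : DiscBoundary n → Z), Continuous f →
      ∃ (F : DiscBoundary n × unitInterval → Z) (z : Z), Continuous F ∧
        (∀ s, F (s, 0) = f s) ∧ ∀ s, F (s, 1) = z) : DiscExtension Z := by
  intro n f hf
  obtain ⟨F, z, hF, h0, h1⟩ := h n _ (continuousOn_iff_continuous_domRestrict.1 hf)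
  obtain ⟨g, hg, e⟩ := exists_extension_of_nullhomotopy F hF z h1
  exact ⟨g, hg, fun d hd => (e ⟨d, hd⟩).trans (h0 _)⟩

theorem DiscExtension.of_contractible {Z : Type u} [TopologicalSpace Z] [ContractibleSpace Z] :
    DiscExtension Z := by
  refine .of_nullhomotopy fun n f hf => ?_
  obtain ⟨z, ⟨H⟩⟩ := id_nullhomotopic Z
  exact ⟨fun q => H (q.2, f q.1), z, by fun_prop, fun s => by simp, fun s => by simp⟩

/-- A compact convex body of dimension `n` is homeomorphic to the disc. -/
theorem exists_homeomorph_disc {E : Type*} [NormedAddCommGroup E] [NormedSpace ℝ E]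
    [FiniteDimensional ℝ E] {n : ℕ} (hn : Module.finrank ℝ E = n) (K : Set E) (hK : IsCompact K)
    (hc : Convex ℝ K) (hne : (interior K).Nonempty) :
    ∃ φ : Disc n ≃ₜ K, ∀ d : Disc n,
      ‖(d : EuclideanSpace ℝ (Fin n))‖ < 1 ↔ (φ d : E) ∈ interior K := by
  let L : E ≃L[ℝ] EuclideanSpace ℝ (Fin n) := ContinuousLinearEquiv.ofFinrankEq (by simp [hn])
  have hi : interior (L '' K) = L '' interior K := (L.toHomeomorph.image_interior K).symm
  obtain ⟨h, h1, h2, -⟩ := exists_homeomorph_image_interior_closure_frontier_eq_unitBall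
    (s := L '' K) (hc.linear_image L.toLinearMap) (by rw [hi]; exact hne.image L)
    (hK.image L.continuous).isBounded
  rw [(hK.image L.continuous).isClosed.closure_eq] at h2
  let ψ : E ≃ₜ EuclideanSpace ℝ (Fin n) := L.toHomeomorph.trans h
  have hψ : ψ '' K = Metric.closedBall 0 1 := by rw [← h2, ← Set.image_comp]; rfl
  have hψ' : ψ '' interior K = Metric.ball 0 1 := by rw [← h1, hi, ← Set.image_comp]; rfl
  let θ : K ≃ₜ Disc n := (ψ.image K).trans (Homeomorph.setCongr hψ)
  have hθ : ∀ k, (θ k : EuclideanSpace ℝ (Fin n)) = ψ k := fun k => rfl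
  refine ⟨θ.symm, fun d => ?_⟩
  obtain ⟨k, rfl⟩ := θ.surjective d
  rw [θ.symm_apply_apply, hθ, ← mem_ball_zero_iff, ← hψ', ψ.injective.mem_set_image]

/-- The disc and the simplex of the same dimension. -/
theorem exists_homeomorph_disc_stdSimplex (n : ℕ) :
    ∃ φ : Disc n ≃ₜ stdSimplex ℝ (Fin (n + 1)), ∀ d : Disc n,
      ‖(d : EuclideanSpace ℝ (Fin n))‖ < 1 ↔ ∀ i, 0 < φ d i := by
  let K : Set (Fin n → ℝ) := {y | (∀ i, 0 ≤ y i) ∧ ∑ i, y i ≤ 1}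
  have hcl : IsClosed K := by
    have : K = (⋂ i, {y : Fin n → ℝ | 0 ≤ y i}) ∩ {y | ∑ i, y i ≤ 1} := by
      ext y; simp [K]
    rw [this]
    exact (isClosed_iInter fun i => isClosed_le continuous_const (continuous_apply i)).inter
      (isClosed_le (by fun_prop) continuous_const)
  have hK : IsCompact K := by
    refine (isCompact_Icc (a := (0 : Fin n → ℝ)) (b := 1)).of_isClosed_subset hcl fun y hy => ?_
    exact ⟨hy.1, fun i => (Finset.single_le_sum (fun j _ => hy.1 j) (Finset.mem_univ i)).trans hy.2⟩
  have hconv : Convex ℝ K := by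
    rintro y ⟨hy, hy'⟩ z ⟨hz, hz'⟩ a b ha hb hab
    refine ⟨fun i => add_nonneg (mul_nonneg ha (hy i)) (mul_nonneg hb (hz i)), ?_⟩
    simp only [Pi.add_apply, Pi.smul_apply, smul_eq_mul, Finset.sum_add_distrib, ← Finset.mul_sum]
    nlinarith
  have hopen : IsOpen {y : Fin n → ℝ | (∀ i, 0 < y i) ∧ ∑ i, y i < 1} := by
    have : {y : Fin n → ℝ | (∀ i, 0 < y i) ∧ ∑ i, y i < 1} =
        (⋂ i, {y : Fin n → ℝ | 0 < y i}) ∩ {y | ∑ i, y i < 1} := by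
      ext y; simp
    rw [this]
    exact (isOpen_iInter_of_finite fun i => isOpen_lt continuous_const (continuous_apply i)).inter
      (isOpen_lt (by fun_prop) continuous_const)
  let b : Fin n → ℝ := fun _ => ((n : ℝ) + 1)⁻¹
  have hn : (0 : ℝ) < (n : ℝ) + 1 := by positivity
  have hb : (∀ i, 0 < b i) ∧ ∑ i, b i < 1 := by
    refine ⟨fun i => by positivity, ?_⟩
    simp only [b, Finset.sum_const, Finset.card_univ, Fintype.card_fin, nsmul_eq_mul]
    rw [← div_eq_mul_inv, div_lt_one hn]
    linarith
  have hint : interior K = {y | (∀ i, 0 < y i) ∧ ∑ i, y i < 1} := by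
    refine subset_antisymm (fun y hy => ?_)
      (interior_maximal (fun y hy => ⟨fun i => (hy.1 i).le, hy.2.le⟩) hopen)
    -- move a little away from the interior point `b`
    have hcont : Continuous fun t : ℝ => y + t • (y - b) := by fun_prop
    have hnh : (fun t : ℝ => y + t • (y - b)) ⁻¹' interior K ∈ nhds (0 : ℝ) :=
      hcont.continuousAt.preimage_mem_nhds (by simpa using isOpen_interior.mem_nhds hy)
    obtain ⟨ε, hε, hsub⟩ := Metric.mem_nhds_iff.1 hnh
    have hm : y + (ε / 2) • (y - b) ∈ K := interior_subset (hsub (by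
      rw [Metric.mem_ball, dist_zero_right, Real.norm_of_nonneg (by linarith)]; linarith))
    have hyK := interior_subset hy
    constructor
    · intro i
      refine lt_of_le_of_ne (hyK.1 i) fun h0 => ?_
      have := hm.1 i
      simp only [Pi.add_apply, Pi.smul_apply, Pi.sub_apply, smul_eq_mul, ← h0] at this
      nlinarith [hb.1 i]
    · refine lt_of_le_of_ne hyK.2 fun h0 => ?_
      have := hm.2
      simp only [Pi.add_apply, Pi.smul_apply, Pi.sub_apply, smul_eq_mul, Finset.sum_add_distrib,
        ← Finset.mul_sum, Finset.sum_sub_distrib, h0] at this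
      nlinarith [hb.2]
  obtain ⟨φ, hφ⟩ := exists_homeomorph_disc (n := n) (by simp) K hK hconv (hint ▸ ⟨b, hb⟩)
  let e : K ≃ₜ stdSimplex ℝ (Fin (n + 1)) :=
    { toFun := fun y => ⟨Fin.cons (1 - ∑ i, y.1 i) y.1, fun i => by
          refine Fin.cases ?_ (fun j => ?_) i
          · simpa using y.2.2
          · simpa using y.2.1 j, by simp [Fin.sum_univ_succ]⟩
      invFun := fun p => ⟨fun i => p.1 i.succ, fun i => p.2.1 _, by
          have := p.2.2
          rw [Fin.sum_univ_succ] at this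
          linarith [p.2.1 0]⟩
      left_inv := fun y => by ext i; simp
      right_inv := fun p => by
        have := p.2.2
        rw [Fin.sum_univ_succ] at this
        apply Subtype.ext
        funext i
        refine Fin.cases ?_ (fun j => ?_) i
        · simp only [Fin.cons_zero]; linarith
        · simp
      continuous_toFun := by
        refine Continuous.subtype_mk (continuous_pi fun i => ?_) _
        refine Fin.cases ?_ (fun j => ?_) i
        · simp only [Fin.cons_zero]; fun_prop
        · exact (continuous_apply j).comp continuous_subtype_val
      continuous_invFun := by
        exact Continuous.subtype_mk
          (continuous_pi fun i => (continuous_apply i.succ).comp continuous_subtype_val) _ }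
  refine ⟨φ.trans e, fun d => ?_⟩
  rw [hφ, hint]
  change ((∀ i, 0 < (φ d).1 i) ∧ ∑ i, (φ d).1 i < 1) ↔
    ∀ i, 0 < (Fin.cons (1 - ∑ i, (φ d).1 i) (φ d).1 : Fin (n + 1) → ℝ) i
  rw [Fin.forall_fin_succ]
  simp [and_comm]

/-- The prism over a disc and the disc of the same dimension. -/
theorem exists_homeomorph_disc_prism (n : ℕ) :
    ∃ φ : Disc (n + 1) ≃ₜ Disc n × unitInterval, ∀ d : Disc (n + 1),
      ‖(d : EuclideanSpace ℝ (Fin (n + 1)))‖ < 1 ↔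
        ‖((φ d).1 : EuclideanSpace ℝ (Fin n))‖ < 1 ∧ 0 < (φ d).2 ∧ (φ d).2 < 1 := by
  let K : Set (EuclideanSpace ℝ (Fin n) × ℝ) := Metric.closedBall 0 1 ×ˢ Set.Icc 0 1
  have hint : interior K = Metric.ball 0 1 ×ˢ Set.Ioo 0 1 := by
    rw [interior_prod_eq, interior_closedBall _ one_ne_zero, interior_Icc]
  obtain ⟨φ, hφ⟩ := exists_homeomorph_disc (n := n + 1) (by simp) K
    ((isCompact_closedBall _ _).prod isCompact_Icc)
    ((convex_closedBall _ _).prod (convex_Icc _ _))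
    (hint ▸ ⟨(0, 1 / 2), by simp, by norm_num⟩)
  let e : K ≃ₜ Disc n × unitInterval :=
    { toFun := fun y => (⟨y.1.1, y.2.1⟩, ⟨y.1.2, y.2.2⟩)
      invFun := fun p => ⟨(p.1, p.2), p.1.2, p.2.2⟩
      left_inv := fun y => rfl
      right_inv := fun y => rfl
      continuous_toFun := by fun_prop
      continuous_invFun := by fun_prop }
  refine ⟨φ.trans e, fun d => ?_⟩
  rw [hφ, hint, Set.mem_prod, mem_ball_zero_iff]
  rfl


/-! ### Ranked posets with a group action -/

/-- A `G`-poset with an invariant, strictly monotone rank function.  The rank function guarantees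
that the stabilizer of a chain fixes the chain pointwise, so that the order complex is a
`G`-CW-complex. -/
structure GPoset (G : Type u) [Group G] where
  carrier : Type u
  [order : PartialOrder carrier]
  [action : MulAction G carrier]
  smul_le : ∀ (g : G) {a b : carrier}, a ≤ b → g • a ≤ g • b
  rank : carrier → ℕ
  rank_strictMono : StrictMono rank
  rank_smul : ∀ (g : G) (a : carrier), rank (g • a) = rank a

attribute [instance] GPoset.order GPoset.action

namespace GPoset

variable {G : Type u} [Group G]

/-- An equivariant monotone map. -/
structure Hom (X Y : GPoset G) extends X.carrier →o Y.carrier where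
  map_smul : ∀ (g : G) (a : X.carrier), toFun (g • a) = g • toFun a

instance : Category (GPoset G) where
  Hom := Hom
  id X := ⟨OrderHom.id, fun _ _ => rfl⟩
  comp f g := ⟨g.toOrderHom.comp f.toOrderHom, fun k a => by
    change g.toFun (f.toFun (k • a)) = k • g.toFun (f.toFun a)
    rw [f.map_smul, g.map_smul]⟩

/-- The underlying function of a morphism of `G`-posets. -/
abbrev fn {X Y : GPoset G} (f : X ⟶ Y) (a : X.carrier) : Y.carrier := f.toFun a

theorem fn_mono {X Y : GPoset G} (f : X ⟶ Y) {a b : X.carrier} (h : a ≤ b) : fn f a ≤ fn f b :=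
  f.monotone' h

theorem fn_smul {X Y : GPoset G} (f : X ⟶ Y) (g : G) (a : X.carrier) :
    fn f (g • a) = g • fn f a := f.map_smul g a

variable (X : GPoset G)

theorem smul_le_smul_iff (g : G) {a b : X.carrier} : g • a ≤ g • b ↔ a ≤ b :=
  ⟨fun h => by simpa using X.smul_le g⁻¹ h, X.smul_le g⟩

theorem smul_lt_smul (g : G) {a b : X.carrier} (h : a < b) : g • a < g • b :=
  lt_of_le_of_ne (X.smul_le g h.le) fun e => h.ne (smul_left_cancel g e)

/-- Comparable elements of the same rank are equal. -/
theorem eq_of_rank_eq {a b : X.carrier} (h : a ≤ b) (hr : X.rank a = X.rank b) : a = b := by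
  by_contra hne
  exact (X.rank_strictMono (lt_of_le_of_ne h hne)).ne hr

/-- The translation by `g`. -/
def smulHom (g : G) : X.carrier →o X.carrier := ⟨fun a => g • a, fun _ _ h => X.smul_le g h⟩

noncomputable instance : MulAction G (OrderComplex X.carrier) where
  smul g := OrderComplex.map (X.smulHom g)
  one_smul x := by
    change OrderComplex.map (X.smulHom 1) x = x
    rw [show X.smulHom 1 = OrderHom.id from OrderHom.ext _ _ (funext fun a => one_smul G a),
      OrderComplex.map_id]
    rfl
  mul_smul g h x := by
    change OrderComplex.map (X.smulHom (g * h)) x =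
      OrderComplex.map (X.smulHom g) (OrderComplex.map (X.smulHom h) x)
    rw [OrderComplex.map_map]
    congr 1
    exact OrderHom.ext _ _ (funext fun a => mul_smul g h a)

theorem smul_def (g : G) (x : OrderComplex X.carrier) : g • x = OrderComplex.map (X.smulHom g) x :=
  rfl

theorem mem_support_smul (g : G) (x : OrderComplex X.carrier) {a : X.carrier} :
    g • a ∈ (g • x).1.support ↔ a ∈ x.1.support := by
  classical
  rw [smul_def, OrderComplex.support_map, Finset.mem_image]
  exact ⟨fun ⟨b, hb, e⟩ => smul_left_cancel g e ▸ hb, fun h => ⟨a, h, rfl⟩⟩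

instance : ContinuousConstSMul G (OrderComplex X.carrier) :=
  ⟨fun g => OrderComplex.continuous_map (X.smulHom g)⟩

/-! ### The `G`-CW-structure of the order complex -/

/-- The strict chains of `n` elements. -/
abbrev Chains (n : ℕ) : Type u := {c : Fin n → X.carrier // StrictMono c}

instance (n : ℕ) : MulAction G (X.Chains n) where
  smul g c := ⟨fun i => g • c.1 i, fun _ _ h => X.smul_lt_smul g (c.2 h)⟩
  one_smul c := Subtype.ext (funext fun i => one_smul G (c.1 i))
  mul_smul g h c := Subtype.ext (funext fun i => mul_smul g h (c.1 i))

variable {X}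

/-- The simplex of a strict chain. -/
noncomputable def simplex {n : ℕ} (c : X.Chains n) (p : stdSimplex ℝ (Fin n)) :
    OrderComplex X.carrier := OrderComplex.face c.1 c.2.monotone.isChain_range p

theorem continuous_simplex {n : ℕ} (c : X.Chains n) : Continuous (simplex c) :=
  OrderComplex.continuous_face c.1 c.2.monotone.isChain_range

theorem smul_simplex {n : ℕ} (g : G) (c : X.Chains n) (p : stdSimplex ℝ (Fin n)) :
    g • simplex c p = simplex (g • c) p :=
  OrderComplex.map_face (X.smulHom g) c.1 c.2.monotone.isChain_range
    (g • c).2.monotone.isChain_range p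

theorem exists_simplex_eq (x : OrderComplex X.carrier) : ∃ (n : ℕ) (c : X.Chains n)
    (p : stdSimplex ℝ (Fin n)), (∀ i, 0 < p i) ∧ simplex c p = x := by
  obtain ⟨n, c, hc, p, hp, h⟩ := x.exists_face_eq
  exact ⟨n, ⟨c, hc⟩, p, hp, h⟩

theorem isClosed_iff_simplex {T : Set (OrderComplex X.carrier)} :
    IsClosed T ↔ ∀ n (c : X.Chains n), IsClosed (simplex c ⁻¹' T) :=
  OrderComplex.isClosed_iff_strictMono.trans
    ⟨fun h n c => h n c.1 c.2, fun h n c hc => h n ⟨c, hc⟩⟩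

theorem card_support_simplex {n : ℕ} (c : X.Chains n) (p : stdSimplex ℝ (Fin n)) :
    (simplex c p).1.support.card = (Finset.univ.filter fun i => p i ≠ 0).card := by
  classical
  rw [← Finset.card_image_of_injective _ c.2.injective]
  congr 1
  rw [← Finset.coe_inj, simplex, OrderComplex.support_face]
  simp

theorem card_support_simplex_le {n : ℕ} (c : X.Chains n) (p : stdSimplex ℝ (Fin n)) :
    (simplex c p).1.support.card ≤ n := by
  rw [card_support_simplex]
  exact (Finset.card_filter_le _ _).trans (by simp)

theorem card_support_simplex_of_pos {n : ℕ} (c : X.Chains n) {p : stdSimplex ℝ (Fin n)}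
    (hp : ∀ i, 0 < p i) : (simplex c p).1.support.card = n := by
  rw [card_support_simplex, Finset.filter_true_of_mem fun i _ => (hp i).ne']
  simp

theorem simplex_injective {n : ℕ} {c c' : X.Chains n} {p p' : stdSimplex ℝ (Fin n)}
    (hp : ∀ i, 0 < p i) (hp' : ∀ i, 0 < p' i) (h : simplex c p = simplex c' p') :
    c = c' ∧ p = p' := by
  have hr : Set.range c.1 = Set.range c'.1 := by
    have h1 : ∀ (c : X.Chains n) {p : stdSimplex ℝ (Fin n)}, (∀ i, 0 < p i) →
        ((simplex c p).1.support : Set X.carrier) = Set.range c.1 := fun c p hp => by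
      rw [simplex, OrderComplex.support_face, ← Set.image_univ]
      congr 1
      exact Set.eq_univ_of_forall fun i => (hp i).ne'
    rw [← h1 c hp, h, h1 c' hp']
  obtain rfl : c = c' := Subtype.ext ((StrictMono.range_inj c.2 c'.2).1 hr)
  refine ⟨rfl, ?_⟩
  ext i
  rw [← OrderComplex.combo_of_injective c.2.injective p i,
    ← OrderComplex.combo_of_injective c.2.injective p' i]
  exact DFunLike.congr_fun (congrArg Subtype.val h) (c.1 i)

/-- The homeomorphism from the disc to the simplex used for the characteristic maps. -/
noncomputable def discSimplex (n : ℕ) : Disc n ≃ₜ stdSimplex ℝ (Fin (n + 1)) :=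
  (exists_homeomorph_disc_stdSimplex n).choose

theorem norm_lt_one_iff_discSimplex {n : ℕ} (d : Disc n) :
    ‖(d : EuclideanSpace ℝ (Fin n))‖ < 1 ↔ ∀ i, 0 < discSimplex n d i :=
  (exists_homeomorph_disc_stdSimplex n).choose_spec d

theorem isClosed_skeleton (n : ℕ) :
    IsClosed {x : OrderComplex X.carrier | x.1.support.card ≤ n} := by
  classical
  refine isClosed_iff_simplex.2 fun m c => ⟨?_⟩
  have : (simplex c ⁻¹' {x : OrderComplex X.carrier | x.1.support.card ≤ n})ᶜ =
      ⋃ J : {J : Finset (Fin m) // n < J.card}, {p | ∀ i ∈ J.1, p i ≠ 0} := by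
    ext p
    simp only [Set.mem_compl_iff, Set.mem_preimage, Set.mem_ofPred_eq, card_support_simplex, not_le,
      Set.mem_iUnion]
    constructor
    · exact fun h => ⟨⟨_, h⟩, fun i hi => (Finset.mem_filter.1 hi).2⟩
    · rintro ⟨J, hJ⟩
      exact J.2.trans_le (Finset.card_le_card fun i hi => by simpa using hJ i hi)
  rw [this]
  refine isOpen_iUnion fun J => ?_
  simp only [Set.ofPred_forall]
  exact isOpen_biInter_finset fun i _ => isOpen_ne_fun
    ((continuous_apply i).comp continuous_subtype_val) continuous_const

variable (X) in
/-- The `G`-CW-structure on the order complex of `X`: the equivariant `n`-cells are the orbits of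
strict chains of `n + 1` elements. -/
noncomputable def gcwStructure : GCWStructure G (OrderComplex X.carrier) where
  cell n := MulAction.orbitRel.Quotient G (X.Chains (n + 1))
  stab n i := MulAction.stabilizer G (Quotient.out i : X.Chains (n + 1))
  charMap n i c d := simplex (MulAction.ofQuotientStabilizer G _ c) (discSimplex n d)
  continuous_charMap n i c := (continuous_simplex _).comp (discSimplex n).continuous
  charMap_smul n i g c d := by rw [MulAction.ofQuotientStabilizer_smul, smul_simplex]
  skel n := {x | x.1.support.card ≤ n}
  skel_zero := by
    ext x
    simpa using Finset.nonempty_iff_ne_empty.1 x.support_nonempty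
  skel_succ n := by
    ext x
    constructor
    · intro h
      rcases Nat.lt_or_ge n x.1.support.card with h' | h'
      · right
        obtain ⟨m, c, p, hp, rfl⟩ := exists_simplex_eq x
        rw [Set.mem_ofPred_eq] at h
        rw [card_support_simplex_of_pos c hp] at h h'
        obtain rfl : m = n + 1 := le_antisymm h h'
        obtain ⟨g, hg⟩ : c ∈ MulAction.orbit G (Quotient.out (Quotient.mk
            (MulAction.orbitRel G (X.Chains (n + 1))) c)) :=
          (MulAction.orbitRel G _).symm (Quotient.mk_out c)
        refine ⟨Quotient.mk (MulAction.orbitRel G (X.Chains (n + 1))) c, ((g : G) : G ⧸ _),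
          (discSimplex n).symm p, ?_⟩
        rw [MulAction.ofQuotientStabilizer_mk, Homeomorph.apply_symm_apply]
        congr 1
      · exact Or.inl h'
    · rintro (h | ⟨i, c, d, rfl⟩)
      · exact Nat.le_succ_of_le h
      · exact card_support_simplex_le _ _
  iUnion_skel := Set.eq_univ_of_forall fun x => Set.mem_iUnion.2 ⟨_, Nat.le_refl x.1.support.card⟩
  charMap_mem_of_boundary n i c d hd := by
    rw [Set.mem_ofPred_eq, card_support_simplex, ← Nat.lt_succ_iff]
    have := mt (norm_lt_one_iff_discSimplex d).2 (by rw [hd]; exact lt_irrefl _)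
    push Not at this
    obtain ⟨j, hj⟩ := this
    refine (Finset.card_lt_univ_of_notMem (x := j) ?_).trans_eq (by simp)
    simpa using le_antisymm hj ((discSimplex n d).2.1 j)
  charMap_notMem_of_interior n i c d hd h := by
    rw [Set.mem_ofPred_eq,
      card_support_simplex_of_pos _ ((norm_lt_one_iff_discSimplex d).1 hd)] at h
    omega
  charMap_injective := by
    rintro n ⟨i, c, d⟩ ⟨j, c', d'⟩ hd hd' e
    obtain ⟨h1, h2⟩ := simplex_injective ((norm_lt_one_iff_discSimplex d).1 hd)
      ((norm_lt_one_iff_discSimplex d').1 hd') e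
    obtain rfl := (discSimplex n).injective h2
    have hij : i = j := by
      rw [← Quotient.out_eq i, ← Quotient.out_eq j]
      have hi := MulAction.ofQuotientStabilizer_mem_orbit G _ c
      have hj := MulAction.ofQuotientStabilizer_mem_orbit G _ c'
      dsimp only at h1
      rw [h1] at hi
      exact Quotient.sound ((MulAction.orbitRel G _).trans
        ((MulAction.orbitRel G _).symm hi) hj)
    subst hij
    obtain rfl := MulAction.injective_ofQuotientStabilizer G _ h1
    rfl
  isClosed_skel := isClosed_skeleton
  isClosed_inter_skel_succ n S hS hc := by
    classical
    refine isClosed_iff_simplex.2 fun m c => ?_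
    have hcl : ∀ e : Fin (n + 1) ↪o Fin m, IsClosed (stdSimplex.map e ''
        (simplex (⟨c.1 ∘ e, c.2.comp e.strictMono⟩ : X.Chains (n + 1)) ⁻¹' S)) := fun e => by
      refine (IsClosed.isCompact ?_ |>.image (stdSimplex.continuous_map _)).isClosed
      set b : X.Chains (n + 1) := ⟨c.1 ∘ e, c.2.comp e.strictMono⟩
      obtain ⟨g, hg⟩ : b ∈ MulAction.orbit G (Quotient.out (Quotient.mk
            (MulAction.orbitRel G (X.Chains (n + 1))) b)) :=
          (MulAction.orbitRel G _).symm (Quotient.mk_out b)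
      have := (hc (Quotient.mk (MulAction.orbitRel G (X.Chains (n + 1))) b)
        ((g : G) : G ⧸ _)).preimage (discSimplex n).symm.continuous
      convert this using 1
      ext q
      simp only [Set.mem_preimage, Homeomorph.apply_symm_apply,
        MulAction.ofQuotientStabilizer_mk]
      rw [show g • _ = b from hg]
    have hface : ∀ (e : Fin (n + 1) ↪o Fin m) (q : stdSimplex ℝ (Fin (n + 1))),
        simplex c (stdSimplex.map e q) =
          simplex (⟨c.1 ∘ e, c.2.comp e.strictMono⟩ : X.Chains (n + 1)) q := fun e q =>
      Subtype.ext (OrderComplex.combo_simplexMap c.1 e q)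
    convert (hS.preimage (continuous_simplex c)).union (isClosed_iUnion_of_finite hcl) using 1
    ext p
    simp only [Set.mem_preimage, Set.mem_inter_iff, Set.mem_ofPred_eq, Set.mem_union,
      Set.mem_iUnion]
    constructor
    · rintro ⟨hp, hcard⟩
      rcases Nat.lt_or_ge n (simplex c p).1.support.card with h | h
      · right
        rw [card_support_simplex] at h hcard
        let e := (Finset.univ.filter fun i => p i ≠ 0).orderEmbOfFin (le_antisymm hcard h)
        obtain ⟨q, -, hq⟩ := OrderComplex.exists_simplexMap_eq e.injective p fun i hi => by
          rw [Finset.range_orderEmbOfFin] at hi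
          simpa using hi
        exact ⟨e, q, by rwa [Set.mem_preimage, ← hface, hq], hq⟩
      · exact Or.inl ⟨hp, h⟩
    · rintro (⟨hp, h⟩ | ⟨e, q, hq, rfl⟩)
      · exact ⟨hp, Nat.le_succ_of_le h⟩
      · rw [hface]
        exact ⟨hq, card_support_simplex_le _ _⟩
  isClosed_of_skel T hT := isClosed_iff_simplex.2 fun n c => by
    convert (hT n).preimage (continuous_simplex c) using 1
    ext p
    exact ⟨fun h => ⟨h, card_support_simplex_le _ _⟩, fun h => h.1⟩

theorem gcwStructure_charMap_mk (n : ℕ) (i : X.gcwStructure.cell n) (g : G) (d : Disc n) :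
    X.gcwStructure.charMap n i (g : G ⧸ X.gcwStructure.stab n i) d =
      simplex (g • (Quotient.out i : X.Chains (n + 1))) (discSimplex n d) := rfl

/-- The order complex as a `G`-CW-complex. -/
noncomputable abbrev complex (X : GPoset G) : GCWComplex G where
  carrier := OrderComplex X.carrier
  exists_structure := ⟨X.gcwStructure⟩

/-- A morphism of `G`-posets which is an order embedding. -/
def IsEmbedding {A X : GPoset G} (i : A ⟶ X) : Prop := ∀ a b, fn i a ≤ fn i b → a ≤ b

/-- The map of order complexes. -/
noncomputable abbrev realFun {X Y : GPoset G} (f : X ⟶ Y) :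
    OrderComplex X.carrier → OrderComplex Y.carrier := OrderComplex.map f.toOrderHom

theorem realFun_smul {X Y : GPoset G} (f : X ⟶ Y) (g : G) (x : OrderComplex X.carrier) :
    realFun f (g • x) = g • realFun f x := by
  rw [smul_def, smul_def, realFun, OrderComplex.map_map, OrderComplex.map_map]
  congr 1
  exact OrderHom.ext _ _ (funext fun a => f.map_smul g a)

theorem isSubcomplex_range {A X : GPoset G} (i : A ⟶ X) (hi : IsEmbedding i) :
    X.gcwStructure.IsSubcomplex (Set.range (realFun i)) where
  isClosed := (OrderComplex.isClosedEmbedding_map _ hi).isClosed_range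
  charMap_mem n c k d hd := by
    intro h k' d'
    rw [realFun, OrderComplex.range_map _ hi] at h ⊢
    rw [Set.mem_ofPred_eq] at h ⊢
    induction k using QuotientGroup.induction_on with
    | H g =>
    induction k' using QuotientGroup.induction_on with
    | H g' =>
      rw [gcwStructure_charMap_mk, simplex, OrderComplex.support_face] at h ⊢
      rintro _ ⟨j, -, rfl⟩
      obtain ⟨a, ha⟩ := h ⟨j, ((norm_lt_one_iff_discSimplex d).1 hd j).ne', rfl⟩
      refine ⟨g' • g⁻¹ • a, ?_⟩
      change fn i _ = _
      rw [fn_smul, fn_smul]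
      change fn i a = g • _ at ha
      rw [ha, inv_smul_smul]
      rfl

/-- The pair `(|X|, |A|)` for an embedding `A → X`. -/
noncomputable abbrev pair {A X : GPoset G} (i : A ⟶ X) (hi : IsEmbedding i) : GCWPair G where
  carrier := OrderComplex X.carrier
  sub := Set.range (realFun i)
  exists_structure := ⟨X.gcwStructure, isSubcomplex_range i hi⟩

/-- Geometric realization as a functor. -/
noncomputable def real (G : Type u) [Group G] : GPoset G ⥤ GCWPair G where
  obj X := X.complex.toPair
  map f :=
    { toFun := realFun f
      continuous_toFun := OrderComplex.continuous_map _
      map_smul := realFun_smul f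
      mapsTo := fun _ h => h.elim }
  map_id _ := GCWPair.hom_ext fun x => congrFun OrderComplex.map_id x
  map_comp _ _ := GCWPair.hom_ext fun x => (OrderComplex.map_map _ _ x).symm

/-- A commutative square with embeddings `A → C` and `B → X` realizes to a map of pairs. -/
noncomputable def pairMap {A B C X : GPoset G} {i : A ⟶ C} {f : A ⟶ B} {F : C ⟶ X} {j : B ⟶ X}
    (hi : IsEmbedding i) (hj : IsEmbedding j) (comm : i ≫ F = f ≫ j) : pair i hi ⟶ pair j hj where
  toFun := realFun F
  continuous_toFun := OrderComplex.continuous_map _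
  map_smul := realFun_smul F
  mapsTo := by
    rintro _ ⟨a, rfl⟩
    refine ⟨realFun f a, ?_⟩
    have := congrArg (fun h => (real G).map h) comm
    simp only [Functor.map_comp] at this
    exact congrFun (congrArg GCWPair.Hom.toFun this.symm) a

/-- The identification of `|A|` with the subcomplex of `(|X|, |A|)`. -/
noncomputable def toSub {A X : GPoset G} (i : A ⟶ X) (hi : IsEmbedding i) :
    (real G).obj A ⟶ (pair i hi).subcomplex.toPair where
  toFun a := ⟨realFun i a, a, rfl⟩
  continuous_toFun := (OrderComplex.continuous_map _).subtype_mk _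
  map_smul g a := Subtype.ext (realFun_smul i g a)
  mapsTo _ h := h.elim

end GPoset

/-- A `G`-homeomorphism of pairs induces an isomorphism under every functor. -/
theorem GCWPair.isIso_of_isClosedMap {G : Type u} [Group G] {P Q : GCWPair G} (f : P ⟶ Q)
    (hf : Function.Bijective f.toFun) (hc : IsClosedMap f.toFun)
    (hs : ∀ p, f.toFun p ∈ Q.sub → p ∈ P.sub) : IsIso f := by
  let e : P.carrier ≃ Q.carrier := Equiv.ofBijective _ hf
  have he : ∀ q, f.toFun (e.symm q) = q := e.apply_symm_apply
  have hcont : Continuous e.symm := continuous_iff_isClosed.2 fun T hT => by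
    rw [← e.image_eq_preimage_symm]
    exact hc T hT
  refine ⟨⟨⟨e.symm, hcont, fun g q => hf.1 ?_, fun q hq => hs _ (by rwa [he])⟩,
    GCWPair.hom_ext fun p => e.symm_apply_apply p, GCWPair.hom_ext he⟩⟩
  rw [he, f.map_smul, he]

instance GPoset.isIso_toSub {G : Type u} [Group G] {A X : GPoset G} (i : A ⟶ X)
    (hi : GPoset.IsEmbedding i) : IsIso (GPoset.toSub i hi) :=
  GCWPair.isIso_of_isClosedMap _
    ⟨fun _ _ h => OrderComplex.map_injective _ hi (congrArg Subtype.val h),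
      fun ⟨_, a, ha⟩ => ⟨a, Subtype.ext ha⟩⟩
    (fun T hT => by
      have := (OrderComplex.isClosedMap_map _ hi T hT).preimage
        (continuous_subtype_val (p := (· ∈ Set.range (GPoset.realFun i))))
      convert this using 1
      ext ⟨y, hy⟩
      constructor
      · rintro ⟨a, ha, e⟩
        exact ⟨a, ha, congrArg Subtype.val e⟩
      · rintro ⟨a, ha, e⟩
        exact ⟨a, ha, Subtype.ext e⟩)
    fun _ h => h.elim


namespace GPoset

variable {G : Type u} [Group G]

/-! ### Pushouts of order complexes -/

/-- A commutative square of `G`-posets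
```
A --f--> B
|i       |j
C --F--> X
```
with embeddings `i` and `j`, in which `A` is the preimage of `B` and `F` maps the elements
comparable to `z` isomorphically to the elements comparable to `F z`, for every `z` outside `A`.
Its order complexes form a pushout. -/
structure PushoutSquare (G : Type u) [Group G] where
  {A B C X : GPoset G}
  i : A ⟶ C
  f : A ⟶ B
  F : C ⟶ X
  j : B ⟶ X
  comm : i ≫ F = f ≫ j
  isEmbedding_i : IsEmbedding i
  isEmbedding_j : IsEmbedding j
  mem_range : ∀ c, fn F c ∈ Set.range (fn j) → c ∈ Set.range (fn i)
  inj : ∀ z z', fn F z ∉ Set.range (fn j) → fn F z = fn F z' → z = z'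
  lift : ∀ x, x ∉ Set.range (fn j) → ∀ y, y ≤ x ∨ x ≤ y →
    ∃ z c, fn F z = x ∧ fn F c = y ∧ (c ≤ z ∨ z ≤ c)
  reflect : ∀ z, fn F z ∉ Set.range (fn j) → ∀ c c', (c ≤ z ∨ z ≤ c) → (c' ≤ z ∨ z ≤ c') →
    fn F c ≤ fn F c' → c ≤ c'

namespace PushoutSquare

variable (s : PushoutSquare G)

/-- The map of pairs `(|C|, |A|) → (|X|, |B|)`. -/
noncomputable abbrev toPairMap : pair s.i s.isEmbedding_i ⟶ pair s.j s.isEmbedding_j :=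
  pairMap s.isEmbedding_i s.isEmbedding_j s.comm

theorem exists_lift_chain {n : ℕ} (c : s.X.Chains n) (k : Fin n)
    (hk : c.1 k ∉ Set.range (fn s.j)) :
    ∃ c' : s.C.Chains n, ∀ l, fn s.F (c'.1 l) = c.1 l := by
  choose z c' hz hc' hzc using fun l => s.lift (c.1 k) hk (c.1 l)
    ((le_total l k).imp (fun h => c.2.monotone h) fun h => c.2.monotone h)
  have hzz : ∀ l, z l = z k := fun l => s.inj _ _ (by rwa [hz]) ((hz l).trans (hz k).symm)
  refine ⟨⟨c', fun l m hlm => lt_of_le_of_ne (s.reflect (z k) (by rwa [hz]) _ _ ?_ ?_ ?_) ?_⟩, hc'⟩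
  · rw [← hzz l]; exact hzc l
  · rw [← hzz m]; exact hzc m
  · rw [hc', hc']; exact c.2.monotone hlm.le
  · intro e
    have := c.2 hlm
    rw [← hc', ← hc', e] at this
    exact lt_irrefl _ this

theorem realFun_simplex {X Y : GPoset G} (f : X ⟶ Y) {n : ℕ} (c : X.Chains n) (c' : Y.Chains n)
    (h : ∀ l, fn f (c.1 l) = c'.1 l) (p : stdSimplex ℝ (Fin n)) :
    realFun f (simplex c p) = simplex c' p := by
  apply Subtype.ext
  refine (OrderComplex.mapDomain_combo f.toOrderHom c.1 p).trans ?_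
  exact congrArg (fun k : Fin n → Y.carrier => OrderComplex.combo k p) (funext h)

theorem mem_range_realFun {A X : GPoset G} {i : A ⟶ X} (hi : IsEmbedding i)
    (x : OrderComplex X.carrier) :
    x ∈ Set.range (realFun i) ↔ ∀ v ∈ x.1.support, v ∈ Set.range (fn i) := by
  rw [realFun, OrderComplex.range_map _ hi]
  rfl

theorem mem_support_realFun {X Y : GPoset G} (f : X ⟶ Y) (x : OrderComplex X.carrier)
    {v : Y.carrier} : v ∈ (realFun f x).1.support ↔ ∃ u ∈ x.1.support, fn f u = v := by
  classical
  rw [realFun, OrderComplex.support_map, Finset.mem_image]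
  rfl

theorem realFun_notMem {x : OrderComplex s.C.carrier} (hx : x ∉ Set.range (realFun s.i)) :
    realFun s.F x ∉ Set.range (realFun s.j) := by
  rw [mem_range_realFun s.isEmbedding_i] at hx
  rw [mem_range_realFun s.isEmbedding_j]
  refine fun h => hx fun v hv => s.mem_range v (h _ ?_)
  exact (mem_support_realFun _ _).2 ⟨v, hv, rfl⟩

theorem injOn : Set.InjOn (realFun s.F) (Set.range (realFun s.i))ᶜ := by
  intro x hx y hy h
  have hx' := s.realFun_notMem hx
  rw [mem_range_realFun s.isEmbedding_j] at hx'
  push Not at hx'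
  obtain ⟨_, hv, hvj⟩ := hx'
  obtain ⟨v, hvx, rfl⟩ := (mem_support_realFun _ _).1 hv
  obtain ⟨v', hvy, e⟩ := (mem_support_realFun _ _).1 (h ▸ hv)
  obtain rfl := s.inj _ _ hvj e.symm
  apply Subtype.ext
  have hinj : Set.InjOn (fn s.F) {c | c ≤ v ∨ v ≤ c} := fun a ha b hb e =>
    le_antisymm (s.reflect v hvj a b ha hb e.le) (s.reflect v hvj b a hb ha e.ge)
  exact Finsupp.mapDomain_injOn _ hinj (fun a ha => x.2.2.2.total ha hvx)
    (fun a ha => y.2.2.2.total ha hvy) (congrArg Subtype.val h)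

theorem isPushout : GCWPair.IsPushout s.toPairMap := by
  refine ⟨⟨fun x hx => s.realFun_notMem hx, s.injOn, fun y hy => ?_⟩, fun T hT hF => ?_⟩
  · obtain ⟨n, c, p, hp, rfl⟩ := exists_simplex_eq y
    have hy' : ¬ ∀ v ∈ (simplex c p).1.support, v ∈ Set.range (fn s.j) :=
      mt (mem_range_realFun s.isEmbedding_j _).2 hy
    push Not at hy'
    obtain ⟨v, hv, hvj⟩ := hy'
    rw [← Finset.mem_coe, simplex, OrderComplex.support_face] at hv
    obtain ⟨k, -, rfl⟩ := hv
    obtain ⟨c', hc'⟩ := s.exists_lift_chain c k hvj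
    refine ⟨simplex c' p, ?_, realFun_simplex _ _ _ hc' p⟩
    rintro ⟨a, ha⟩
    refine hy ⟨realFun s.f a, ?_⟩
    rw [← realFun_simplex _ _ _ hc' p, ← ha]
    have := congrArg (fun h => (real G).map h) s.comm
    simp only [Functor.map_comp] at this
    exact congrFun (congrArg GCWPair.Hom.toFun this.symm) a
  · refine isClosed_iff_simplex.2 fun n c => ?_
    by_cases h : ∃ k, c.1 k ∉ Set.range (fn s.j)
    · obtain ⟨k, hk⟩ := h
      obtain ⟨c', hc'⟩ := s.exists_lift_chain c k hk
      convert hF.preimage (continuous_simplex c') using 1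
      ext p
      change _ ↔ realFun s.F _ ∈ T
      rw [realFun_simplex _ _ _ hc' p]
      rfl
    · push Not at h
      convert hT.preimage (continuous_simplex c) using 1
      ext p
      refine ⟨fun hp => ⟨hp, (mem_range_realFun s.isEmbedding_j _).2 fun v hv => ?_⟩, fun h => h.1⟩
      rw [← Finset.mem_coe, simplex, OrderComplex.support_face] at hv
      obtain ⟨k, -, rfl⟩ := hv
      exact h k

theorem isCellularOnSub : GCWPair.IsCellularOnSub s.toPairMap := by
  classical
  refine ⟨s.C.gcwStructure, s.X.gcwStructure, isSubcomplex_range _ s.isEmbedding_i,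
    isSubcomplex_range _ s.isEmbedding_j, fun n x hx => ?_⟩
  change (OrderComplex.map s.F.toOrderHom x).1.support.card ≤ n
  rw [OrderComplex.support_map]
  exact Finset.card_image_le.trans hx.2

end PushoutSquare

/-! ### Homotopies and disjoint unions -/

theorem homotopic_of_le {X Y : GPoset G} (f g : X ⟶ Y) (h : ∀ a, fn f a ≤ fn g a) :
    GCWPair.Homotopic ((real G).map f) ((real G).map g) := by
  refine ⟨fun q => OrderComplex.homotopyFun f.toOrderHom g.toOrderHom h q.1 q.2,
    OrderComplex.continuous_homotopyFun _ _ h, fun x => OrderComplex.homotopyFun_zero _ _ h x,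
    fun x => OrderComplex.homotopyFun_one _ _ h x, fun k x t => ?_, fun _ h => h.elim⟩
  exact OrderComplex.map_homotopyFun _ _ h _ _ h (X.smulHom k)
    (fun a b => (X.smul_le_smul_iff k).1) (Y.smulHom k) (fn_smul f k) (fn_smul g k) x t

/-- `U` is the disjoint union of the `X i`, where different summands are incomparable. -/
structure IsDisjointUnion {I : Type u} {X : I → GPoset G} {U : GPoset G} (j : ∀ i, X i ⟶ U) :
    Prop where
  isEmbedding : ∀ i, IsEmbedding (j i)
  exists_eq : ∀ a, ∃ i b, fn (j i) b = a
  index_eq : ∀ i k a b, fn (j i) a ≤ fn (j k) b → i = k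

section Sigma

variable {I : Type u} {X : I → GPoset G} {U : GPoset G} (j : ∀ i, X i ⟶ U)

/-- The map from the disjoint union of the order complexes. -/
noncomputable def fromSigma : (GCWComplex.sigma fun i => (X i).complex).toPair ⟶ (real G).obj U where
  toFun p := realFun (j p.1) p.2
  continuous_toFun := continuous_sigma fun i => OrderComplex.continuous_map (j i).toOrderHom
  map_smul g p := realFun_smul (j p.1) g p.2
  mapsTo _ h := h.elim

variable {j}

theorem IsDisjointUnion.index_eq_of_realFun (hj : IsDisjointUnion j) {i k : I}
    {x : OrderComplex (X i).carrier} {y : OrderComplex (X k).carrier}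
    (h : realFun (j i) x = realFun (j k) y) : i = k := by
  obtain ⟨a, ha⟩ := x.support_nonempty
  have := (PushoutSquare.mem_support_realFun (j i) x).2 ⟨a, ha, rfl⟩
  rw [h] at this
  obtain ⟨b, -, e⟩ := (PushoutSquare.mem_support_realFun (j k) y).1 this
  exact hj.index_eq i k a b e.ge

theorem IsDisjointUnion.exists_index (hj : IsDisjointUnion j) {n : ℕ} (c : U.Chains (n + 1)) :
    ∃ i, ∀ p, simplex c p ∈ Set.range (realFun (j i)) := by
  obtain ⟨i, b, hb⟩ := hj.exists_eq (c.1 0)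
  refine ⟨i, fun p => (PushoutSquare.mem_range_realFun (hj.isEmbedding i) _).2 fun v hv => ?_⟩
  rw [← Finset.mem_coe, simplex, OrderComplex.support_face] at hv
  obtain ⟨l, -, rfl⟩ := hv
  obtain ⟨k, b', hb'⟩ := hj.exists_eq (c.1 l)
  have hle : c.1 0 ≤ c.1 l := c.2.monotone (Fin.zero_le l)
  rw [← hb, ← hb'] at hle
  obtain rfl := hj.index_eq i k b b' hle
  exact ⟨b', hb'⟩

theorem IsDisjointUnion.isIso_fromSigma (hj : IsDisjointUnion j) : IsIso (fromSigma j) := by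
  refine GCWPair.isIso_of_isClosedMap _ ⟨?_, fun x => ?_⟩ (fun T hT => ?_) fun _ h => h.elim
  · rintro ⟨i, x⟩ ⟨k, y⟩ h
    obtain rfl := hj.index_eq_of_realFun h
    exact Sigma.ext rfl (heq_of_eq (OrderComplex.map_injective _ (hj.isEmbedding i) h))
  · obtain ⟨n, c, p, -, rfl⟩ := exists_simplex_eq x
    rcases n with _ | n
    · have := p.2.2
      simp at this
    · obtain ⟨i, hi⟩ := hj.exists_index c
      obtain ⟨y, hy⟩ := hi p
      exact ⟨⟨i, y⟩, hy⟩
  · refine isClosed_iff_simplex.2 fun n c => ?_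
    rcases n with _ | n
    · convert isClosed_empty
      ext p
      have := p.2.2
      simp at this
    · obtain ⟨i, hi⟩ := hj.exists_index c
      convert (OrderComplex.isClosedMap_map _ (hj.isEmbedding i) _
        (isClosed_sigma_iff.1 hT i)).preimage (continuous_simplex c) using 1
      ext p
      constructor
      · rintro ⟨⟨k, y⟩, hy, e⟩
        obtain ⟨y', hy'⟩ := hi p
        obtain rfl := hj.index_eq_of_realFun (hy'.trans e.symm)
        exact ⟨y, hy, e⟩
      · rintro ⟨y, hy, e⟩
        exact ⟨⟨i, y⟩, hy, e⟩

end Sigma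

end GPoset


/-! ### Equivariant obstruction theory -/

section Extension

variable {G : Type u} [Group G] {X : Type u} [TopologicalSpace X] [MulAction G X]
  {M : Type u} [TopologicalSpace M] [MulAction G M]

/-- A function is a partial section over the `n`-skeleton for a relation `R`: on the skeleton it is
equivariant and continuous, and its values are related to their arguments. -/
structure IsPartialSection (S : GCWStructure G X) (R : X → M → Prop) (n : ℕ) (h : X → M) :
    Prop where
  rel : ∀ x ∈ S.skel n, R x (h x)
  map_smul : ∀ x ∈ S.skel n, ∀ g : G, h (g • x) = g • h x
  isClosed : ∀ T : Set M, IsClosed T → IsClosed (h ⁻¹' T ∩ S.skel n)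

/-- The relation `R` has the extension property for the cells of `X`: every partial solution on
the boundary of a cell, with values fixed by the stabilizer, extends to the cell. -/
def HasCellExtension (S : GCWStructure G X) (R : X → M → Prop) : Prop :=
  ∀ n (i : S.cell n) (f : Disc n → M),
    ContinuousOn f {d | ‖(d : EuclideanSpace ℝ (Fin n))‖ = 1} →
    (∀ d : Disc n, ‖(d : EuclideanSpace ℝ (Fin n))‖ = 1 →
      R (S.charMap n i ((1 : G) : G ⧸ S.stab n i) d) (f d) ∧ ∀ g ∈ S.stab n i, g • f d = f d) →
    ∃ e : Disc n → M, Continuous e ∧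
      (∀ d : Disc n, ‖(d : EuclideanSpace ℝ (Fin n))‖ = 1 → e d = f d) ∧
      ∀ d, R (S.charMap n i ((1 : G) : G ⧸ S.stab n i) d) (e d) ∧ ∀ g ∈ S.stab n i, g • e d = e d

theorem GCWStructure.charMap_mk (S : GCWStructure G X) (n : ℕ) (i : S.cell n) (g : G) (d : Disc n) :
    S.charMap n i (g : G ⧸ S.stab n i) d =
      g • S.charMap n i ((1 : G) : G ⧸ S.stab n i) d := by
  rw [← S.charMap_smul]
  congr 1
  exact congrArg (fun t : G => (t : G ⧸ S.stab n i)) (mul_one g).symm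

variable [ContinuousConstSMul G M]

theorem IsPartialSection.exists_succ [Nonempty M] {S : GCWStructure G X} {R : X → M → Prop}
    (hR : ∀ (g : G) x m, R x m → R (g • x) (g • m)) (hext : HasCellExtension S R) {n : ℕ}
    {h : X → M} (hh : IsPartialSection S R n h) :
    ∃ h', IsPartialSection S R (n + 1) h' ∧ ∀ x ∈ S.skel n, h' x = h x := by
  classical
  have hf : ∀ i : S.cell n, ContinuousOn
      (fun d => h (S.charMap n i ((1 : G) : G ⧸ S.stab n i) d))
      {d : Disc n | ‖(d : EuclideanSpace ℝ (Fin n))‖ = 1} := by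
    intro i
    rw [continuousOn_iff_isClosed]
    intro T hT
    refine ⟨_, (hh.isClosed T hT).preimage (S.continuous_charMap n i ((1 : G) : G ⧸ S.stab n i)), ?_⟩
    ext d
    constructor
    · exact fun hd => ⟨⟨hd.1, S.charMap_mem_of_boundary n i _ d hd.2⟩, hd.2⟩
    · exact fun hd => ⟨hd.1.1, hd.2⟩
  have hcell := fun i : S.cell n => hext n i _ (hf i) fun d hd => by
    have hmem := S.charMap_mem_of_boundary n i ((1 : G) : G ⧸ S.stab n i) d hd
    refine ⟨hh.rel _ hmem, fun g hg => ?_⟩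
    rw [← hh.map_smul _ hmem, ← S.charMap_mk]
    congr 2
    exact QuotientGroup.eq.2 (by simpa using hg)
  choose e hec heb her using hcell
  let h' : X → M := fun x =>
    if x ∈ S.skel n then h x
    else if hc : ∃ (i : S.cell n) (g : G) (d : Disc n),
        ‖(d : EuclideanSpace ℝ (Fin n))‖ < 1 ∧ S.charMap n i (g : G ⧸ S.stab n i) d = x
      then hc.choose_spec.choose • e hc.choose hc.choose_spec.choose_spec.choose
      else Classical.arbitrary M
  have hold : ∀ x ∈ S.skel n, h' x = h x := fun x hx => if_pos hx
  have hnew : ∀ (i : S.cell n) (g : G) (d : Disc n),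
      h' (S.charMap n i (g : G ⧸ S.stab n i) d) = g • e i d := by
    intro i g d
    rcases GCWStructure.norm_lt_or_eq d with hd | hd
    · have hc : ∃ (i' : S.cell n) (g' : G) (d' : Disc n),
          ‖(d' : EuclideanSpace ℝ (Fin n))‖ < 1 ∧
            S.charMap n i' (g' : G ⧸ S.stab n i') d' = S.charMap n i (g : G ⧸ S.stab n i) d :=
        ⟨i, g, d, hd, rfl⟩
      have hval : h' (S.charMap n i (g : G ⧸ S.stab n i) d) =
          hc.choose_spec.choose • e hc.choose hc.choose_spec.choose_spec.choose :=
        (if_neg (S.charMap_notMem_of_interior n i _ d hd)).trans (dif_pos hc)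
      rw [hval]
      have hspec := hc.choose_spec.choose_spec.choose_spec
      generalize hc.choose_spec.choose_spec.choose = d' at hspec ⊢
      generalize hc.choose_spec.choose = g' at hspec ⊢
      generalize hc.choose = i' at hspec d' g' ⊢
      have := S.charMap_injective n ⟨i', (g' : G ⧸ S.stab n i'), d'⟩
        ⟨i, (g : G ⧸ S.stab n i), d⟩ hspec.1 hd hspec.2
      simp only [Sigma.mk.injEq] at this
      obtain ⟨rfl, h2⟩ := this
      obtain ⟨h3, rfl⟩ := Prod.ext_iff.1 (eq_of_heq h2)
      have hm := QuotientGroup.eq.1 h3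
      refine (congrArg (g' • ·) ((her i' d').2 _ hm)).symm.trans ?_
      change g' • (g'⁻¹ * g) • e i' d' = g • e i' d'
      rw [smul_smul, mul_inv_cancel_left]
    · have hmem := S.charMap_mem_of_boundary n i ((1 : G) : G ⧸ S.stab n i) d hd
      rw [hold _ (S.charMap_mem_of_boundary n i _ d hd), S.charMap_mk, hh.map_smul _ hmem,
        heb i d hd]
  refine ⟨h', ⟨fun x hx => ?_, fun x hx k => ?_, fun T hT => ?_⟩, hold⟩
  · rw [S.skel_succ] at hx
    rcases hx with hx | ⟨i, c, d, rfl⟩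
    · rw [hold x hx]
      exact hh.rel x hx
    · induction c using QuotientGroup.induction_on with
      | H g =>
        rw [hnew, S.charMap_mk]
        exact hR _ _ _ (her i d).1
  · rw [S.skel_succ] at hx
    rcases hx with hx | ⟨i, c, d, rfl⟩
    · rw [hold x hx, hold _ (S.smul_mem_skel n k hx), hh.map_smul x hx]
    · induction c using QuotientGroup.induction_on with
      | H g =>
        rw [hnew, ← S.charMap_smul, smul_smul]
        exact hnew i (k * g) d
  · refine S.isClosed_inter_skel_succ n _ ?_ fun i c => ?_
    · convert hh.isClosed T hT using 1
      ext x
      refine and_congr_left fun hx => ?_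
      rw [Set.mem_preimage, hold x hx]
      rfl
    · induction c using QuotientGroup.induction_on with
      | H g =>
        convert hT.preimage ((continuous_const_smul g).comp (hec i)) using 1
        ext d
        rw [Set.mem_preimage, Set.mem_preimage, hnew]
        rfl

/-- Cell by cell construction of an equivariant map whose values solve a problem `R`. -/
theorem exists_equivariant_section [Nonempty M] (S : GCWStructure G X) (R : X → M → Prop)
    (hR : ∀ (g : G) x m, R x m → R (g • x) (g • m)) (hext : HasCellExtension S R) :
    ∃ h : X → M, Continuous h ∧ (∀ (g : G) x, h (g • x) = g • h x) ∧ ∀ x, R x (h x) := by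
  have h0 : IsPartialSection S R 0 fun _ => Classical.arbitrary M := by
    constructor <;> simp [S.skel_zero]
  choose next hnext hagree using fun (n : ℕ) (h : {h // IsPartialSection S R n h}) =>
    h.2.exists_succ hR hext
  let s : ∀ n, {h // IsPartialSection S R n h} :=
    fun n => Nat.rec ⟨_, h0⟩ (fun n h => ⟨next n h, hnext n h⟩) n
  have hmono : Monotone S.skel := monotone_nat_of_le_succ fun n => by
    rw [S.skel_succ]; exact Set.subset_union_left
  have hs : ∀ n k, ∀ x ∈ S.skel n, (s (n + k)).1 x = (s n).1 x := by
    intro n k x hx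
    induction k with
    | zero => rfl
    | succ k ih => exact (hagree (n + k) _ x (hmono (Nat.le_add_right n k) hx)).trans ih
  have hex : ∀ x, ∃ n, x ∈ S.skel n := fun x => Set.mem_iUnion.1 (S.iUnion_skel ▸ Set.mem_univ x)
  choose N hN using hex
  have hval : ∀ n, ∀ x ∈ S.skel n, (s (N x)).1 x = (s n).1 x := by
    intro n x hx
    rw [← hs n (N x) x hx, ← hs (N x) n x (hN x), add_comm]
  refine ⟨fun x => (s (N x)).1 x, ?_, fun g x => ?_, fun x => (s (N x)).2.rel x (hN x)⟩
  · rw [continuous_iff_isClosed]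
    refine fun T hT => S.isClosed_of_skel _ fun n => ?_
    convert (s n).2.isClosed T hT using 1
    ext x
    refine and_congr_left fun hx => ?_
    rw [Set.mem_preimage, hval n x hx]
    rfl
  · change (s (N (g • x))).1 (g • x) = _
    rw [hval (N x) _ (S.smul_mem_skel _ g (hN x)), (s (N x)).2.map_smul x (hN x)]

end Extension

/-! ### Models of classifying spaces -/

/-- A weak form of `IsClassifyingSpace`, where contractibility is replaced by the extension property
for discs.  It suffices for uniqueness up to homotopy, and is easier to verify. -/
structure Models {G : Type u} [Group G] (F : SubgroupFamily G) (X : GCWComplex G) : Prop where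
  mem : ∀ L : Subgroup G, (MulAction.fixedPoints L X.carrier).Nonempty → F.mem L
  nonempty : ∀ L, F.mem L → (MulAction.fixedPoints L X.carrier).Nonempty
  discExtension : ∀ L, F.mem L → DiscExtension (MulAction.fixedPoints L X.carrier)

theorem IsClassifyingSpace.models {G : Type u} [Group G] {F : SubgroupFamily G}
    {X : GCWComplex G} (h : IsClassifyingSpace F X) : Models F X where
  mem L hL := by
    by_contra hm
    exact hL.ne_empty ((h L).2 hm)
  nonempty L hm := by
    have := (h L).1 hm
    exact Set.nonempty_coe_sort.1 inferInstance
  discExtension L hm := by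
    have := (h L).1 hm
    exact .of_contractible

namespace Models

variable {G : Type u} [Group G] {F : SubgroupFamily G} {X Z : GCWComplex G}

theorem mem_stab (hX : Models F X) (S : GCWStructure G X.carrier) (n : ℕ) (i : S.cell n) :
    F.mem (S.stab n i) := by
  refine hX.mem _ ⟨S.charMap n i ((1 : G) : G ⧸ S.stab n i) ⟨0, by simp⟩, fun g => ?_⟩
  refine (S.charMap_mk n i g _).symm.trans ?_
  exact congrArg (fun c => S.charMap n i c _) (QuotientGroup.eq.2 (by simp))

theorem exists_extension (hZ : Models F Z) {L : Subgroup G} (hL : F.mem L) {n : ℕ}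
    (f : Disc n → Z.carrier) (hf : ContinuousOn f {d | ‖(d : EuclideanSpace ℝ (Fin n))‖ = 1})
    (hfix : ∀ d : Disc n, ‖(d : EuclideanSpace ℝ (Fin n))‖ = 1 → ∀ g ∈ L, g • f d = f d) :
    ∃ e : Disc n → Z.carrier, Continuous e ∧
      (∀ d : Disc n, ‖(d : EuclideanSpace ℝ (Fin n))‖ = 1 → e d = f d) ∧
      ∀ d, ∀ g ∈ L, g • e d = e d := by
  classical
  obtain ⟨z, hz⟩ := hZ.nonempty L hL
  let f' : Disc n → MulAction.fixedPoints L Z.carrier := fun d =>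
    if h : ∀ g ∈ L, g • f d = f d then ⟨f d, fun g => h g g.2⟩ else ⟨z, hz⟩
  have hf' : ∀ d : Disc n, ‖(d : EuclideanSpace ℝ (Fin n))‖ = 1 → (f' d : Z.carrier) = f d :=
    fun d hd => congrArg Subtype.val (dif_pos (hfix d hd))
  obtain ⟨e, he, hb⟩ := hZ.discExtension L hL n f'
    (Topology.IsInducing.subtypeVal.continuousOn_iff.2 (hf.congr hf'))
  exact ⟨fun d => e d, continuous_subtype_val.comp he, fun d hd => by
      rw [← hf' d hd, ← hb d hd],
    fun d g hg => (e d).2 ⟨g, hg⟩⟩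

theorem nonempty_of_nonempty (hX : Models F X) (hZ : Models F Z) [Nonempty X.carrier] :
    Nonempty Z.carrier := by
  obtain ⟨x⟩ := ‹Nonempty X.carrier›
  obtain ⟨S⟩ := X.exists_structure
  obtain ⟨n, hn⟩ := Set.mem_iUnion.1 (S.iUnion_skel ▸ Set.mem_univ x)
  obtain ⟨m, -, i, -⟩ := S.exists_open_cell n hn
  exact ⟨(hZ.nonempty _ (hX.mem_stab S m i)).some⟩

theorem exists_hom (hX : Models F X) (hZ : Models F Z) : Nonempty (X.toPair ⟶ Z.toPair) := by
  cases isEmpty_or_nonempty X.carrier with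
  | inl h =>
    exact ⟨⟨fun p => h.elim p, continuous_of_const fun p => h.elim p, fun _ p => h.elim p,
      fun p => h.elim p⟩⟩
  | inr h =>
    have := hX.nonempty_of_nonempty hZ
    obtain ⟨S⟩ := X.exists_structure
    obtain ⟨f, hf, hs, -⟩ := exists_equivariant_section S (fun _ (_ : Z.carrier) => True)
      (fun _ _ _ _ => trivial) fun n i f hf hfix => by
        obtain ⟨e, h1, h2, h3⟩ := hZ.exists_extension (hX.mem_stab S n i) f hf
          fun d hd => (hfix d hd).2
        exact ⟨e, h1, h2, fun d => ⟨trivial, h3 d⟩⟩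
    exact ⟨⟨f, hf, hs, fun p h => h.elim⟩⟩

/-- Any two maps between models are homotopic.  A homotopy is found as an equivariant map into the
path space; the extension problem for a cell `D^n` becomes one for the prism `D^n × I`. -/
theorem homotopic (hX : Models F X) (hZ : Models F Z) (f₀ f₁ : X.toPair ⟶ Z.toPair) :
    GCWPair.Homotopic f₀ f₁ := by
  classical
  suffices h : ∃ h : X.carrier → C(unitInterval, Z.carrier), Continuous h ∧
      (∀ (g : G) x, h (g • x) = g • h x) ∧ ∀ x, h x 0 = f₀.toFun x ∧ h x 1 = f₁.toFun x by
    obtain ⟨h, hc, hs, he⟩ := h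
    refine ⟨fun q => h q.1 q.2, ?_, fun p => (he p).1, fun p => (he p).2, fun g p t => ?_,
      fun p h => h.elim⟩
    · exact ContinuousMap.continuous_uncurry_of_continuous ⟨h, hc⟩
    · change h (g • p) t = _
      rw [hs]
      rfl
  cases isEmpty_or_nonempty X.carrier with
  | inl h =>
    exact ⟨fun p => h.elim p, continuous_of_const fun p => h.elim p, fun _ p => h.elim p,
      fun p => h.elim p⟩
  | inr h =>
  have := hX.nonempty_of_nonempty hZ
  obtain ⟨S⟩ := X.exists_structure
  have hne : Nonempty C(unitInterval, Z.carrier) := ⟨ContinuousMap.const _ (Classical.arbitrary _)⟩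
  refine exists_equivariant_section S
    (fun x (γ : C(unitInterval, Z.carrier)) => γ 0 = f₀.toFun x ∧ γ 1 = f₁.toFun x) ?_ ?_
  · rintro g x γ ⟨h0, h1⟩
    rw [f₀.map_smul, f₁.map_smul, ← h0, ← h1]
    exact ⟨rfl, rfl⟩
  · intro n i f hf hfix
    obtain ⟨φ, hφ⟩ := exists_homeomorph_disc_prism n
    let χ := S.charMap n i ((1 : G) : G ⧸ S.stab n i)
    have hχ : Continuous χ := S.continuous_charMap n i _
    have hstab : ∀ d, ∀ g ∈ S.stab n i, g • χ d = χ d := fun d g hg => by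
      rw [← S.charMap_mk]
      exact congrArg (fun c => S.charMap n i c d) (QuotientGroup.eq.2 (by simpa using hg))
    let B : Disc n × unitInterval → Z.carrier := fun q =>
      if q.2 = 0 then f₀.toFun (χ q.1) else if q.2 = 1 then f₁.toFun (χ q.1) else f q.1 q.2
    have hB0 : ∀ q : Disc n × unitInterval, q.2 = 0 → B q = f₀.toFun (χ q.1) :=
      fun q h => if_pos h
    have hB1 : ∀ q : Disc n × unitInterval, q.2 = 1 → B q = f₁.toFun (χ q.1) :=
      fun q h => (if_neg (by rw [h]; exact one_ne_zero)).trans (if_pos h)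
    have hBf : ∀ q : Disc n × unitInterval, ‖(q.1 : EuclideanSpace ℝ (Fin n))‖ = 1 →
        B q = f q.1 q.2 := by
      intro q hq
      by_cases h0 : q.2 = 0
      · rw [hB0 q h0, h0, (hfix q.1 hq).1.1]
      · by_cases h1 : q.2 = 1
        · rw [hB1 q h1, h1, (hfix q.1 hq).1.2]
        · exact (if_neg h0).trans (if_neg h1)
    have hcase : ∀ d : Disc (n + 1), ‖(d : EuclideanSpace ℝ (Fin (n + 1)))‖ = 1 ↔
        (φ d).2 = 0 ∨ (φ d).2 = 1 ∨ ‖((φ d).1 : EuclideanSpace ℝ (Fin n))‖ = 1 := by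
      intro d
      have h1 := mem_closedBall_zero_iff.1 d.2
      have h2 := mem_closedBall_zero_iff.1 (φ d).1.2
      have h3 := (φ d).2.2
      have := hφ d
      rw [← not_iff_not, not_or, not_or]
      have e1 : ¬ ‖(d : EuclideanSpace ℝ (Fin (n + 1)))‖ = 1 ↔
        ‖(d : EuclideanSpace ℝ (Fin (n + 1)))‖ < 1 := ⟨fun h => lt_of_le_of_ne h1 h, fun h => h.ne⟩
      rw [e1, this, unitInterval.pos_iff_ne_zero, unitInterval.lt_one_iff_ne_one]
      refine ⟨fun ⟨a, b, c⟩ => ⟨b, c, a.ne⟩, fun ⟨a, b, c⟩ => ⟨lt_of_le_of_ne h2 c, a, b⟩⟩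
    have hBc : ContinuousOn (B ∘ φ) {d | ‖(d : EuclideanSpace ℝ (Fin (n + 1)))‖ = 1} := by
      have hset : {d : Disc (n + 1) | ‖(d : EuclideanSpace ℝ (Fin (n + 1)))‖ = 1} =
          {d | (φ d).2 = 0} ∪ ({d | (φ d).2 = 1} ∪
            {d | ‖((φ d).1 : EuclideanSpace ℝ (Fin n))‖ = 1}) := Set.ext hcase
      have hφ1 : Continuous fun d => (φ d).1 := continuous_fst.comp φ.continuous
      have hφ2 : Continuous fun d => (φ d).2 := continuous_snd.comp φ.continuous
      have hc0 : IsClosed {d | (φ d).2 = 0} := isClosed_eq hφ2 continuous_const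
      have hc1 : IsClosed {d | (φ d).2 = 1} := isClosed_eq hφ2 continuous_const
      have hcb : IsClosed {d | ‖((φ d).1 : EuclideanSpace ℝ (Fin n))‖ = 1} :=
        isClosed_eq (by fun_prop) continuous_const
      rw [hset]
      refine ContinuousOn.union_of_isClosed ?_ (ContinuousOn.union_of_isClosed ?_ ?_ hc1 hcb) hc0
        (hc1.union hcb)
      · exact (f₀.continuous_toFun.comp (hχ.comp hφ1)).continuousOn.congr fun d hd => hB0 _ hd
      · exact (f₁.continuous_toFun.comp (hχ.comp hφ1)).continuousOn.congr fun d hd => hB1 _ hd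
      · refine ContinuousOn.congr (f := fun d => f (φ d).1 (φ d).2) ?_ fun d hd => hBf _ hd
        exact continuous_eval.comp_continuousOn
          ((hf.comp hφ1.continuousOn fun d hd => hd).prodMk hφ2.continuousOn)
    obtain ⟨e, hec, heb, hes⟩ := hZ.exists_extension (hX.mem_stab S n i) (B ∘ φ) hBc
      fun d hd g hg => by
        change g • B (φ d) = B (φ d)
        rcases (hcase d).1 hd with h | h | h
        · rw [hB0 _ h, ← f₀.map_smul, hstab _ g hg]
        · rw [hB1 _ h, ← f₁.map_smul, hstab _ g hg]
        · rw [hBf _ h]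
          exact congrArg (fun γ : C(unitInterval, Z.carrier) => γ (φ d).2) ((hfix _ h).2 g hg)
    have heB : ∀ q : Disc n × unitInterval,
        (q.2 = 0 ∨ q.2 = 1 ∨ ‖(q.1 : EuclideanSpace ℝ (Fin n))‖ = 1) → e (φ.symm q) = B q := by
      intro q hq
      rw [heb _ ((hcase _).2 (by simpa using hq)), Function.comp_apply, φ.apply_symm_apply]
    let E : C(Disc n × unitInterval, Z.carrier) := ⟨fun q => e (φ.symm q), hec.comp φ.symm.continuous⟩
    refine ⟨E.curry, E.curry.continuous, fun d hd => ?_, fun d => ⟨⟨?_, ?_⟩, fun g hg => ?_⟩⟩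
    · ext t
      exact (heB (d, t) (Or.inr (Or.inr hd))).trans (hBf (d, t) hd)
    · exact (heB (d, 0) (Or.inl rfl)).trans (hB0 _ rfl)
    · exact (heB (d, 1) (Or.inr (Or.inl rfl))).trans (hB1 _ rfl)
    · ext t
      exact hes _ g hg

/-- Models of the same family have the same homology. -/
theorem bijective_iff {Λ : Type v} [Ring Λ] (T : GHomologyTheory.{u, v, w} Λ G)
    (hX : Models F X) (hZ : Models F Z) (n : ℤ) :
    Function.Bijective ((T.H n).map X.toPoint).hom ↔
      Function.Bijective ((T.H n).map Z.toPoint).hom := by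
  obtain ⟨f⟩ := hX.exists_hom hZ
  obtain ⟨g⟩ := hZ.exists_hom hX
  have hfg : (T.H n).map f ≫ (T.H n).map g = 𝟙 _ := by
    rw [← Functor.map_comp, ← (T.H n).map_id]
    exact T.map_eq_of_homotopic _ _ (hX.homotopic hX _ _) n
  have hgf : (T.H n).map g ≫ (T.H n).map f = 𝟙 _ := by
    rw [← Functor.map_comp, ← (T.H n).map_id]
    exact T.map_eq_of_homotopic _ _ (hZ.homotopic hZ _ _) n
  have e : (T.H n).map X.toPoint = (T.H n).map f ≫ (T.H n).map Z.toPoint := by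
    rw [← Functor.map_comp]
    rfl
  have hb : Function.Bijective ((T.H n).map f).hom := by
    refine Function.bijective_iff_has_inverse.2 ⟨((T.H n).map g).hom, fun a => ?_, fun a => ?_⟩
    · exact congrArg (fun k => k.hom a) hfg
    · exact congrArg (fun k => k.hom a) hgf
  rw [e, ModuleCat.hom_comp, LinearMap.coe_comp]
  exact (hb.of_comp_iff _)

end Models


/-! ### Mayer–Vietoris sequences -/

/-- The map `X → Y` of total spaces underlying a map of pairs `(X, A) → (Y, B)`. -/
def GCWPair.totalMap {G : Type u} [Group G] {P Q : GCWPair G} (F : P ⟶ Q) :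
    P.total.toPair ⟶ Q.total.toPair where
  toFun := F.toFun
  continuous_toFun := F.continuous_toFun
  map_smul := F.map_smul
  mapsTo _ h := h.elim

namespace GHomologyTheory

variable {Λ : Type v} [Ring Λ] {G : Type u} [Group G] (T : GHomologyTheory.{u, v, w} Λ G)

/-- The induced map in homology. -/
abbrev ap (n : ℤ) {P Q : GCWPair G} (f : P ⟶ Q) : (T.H n).obj P →ₗ[Λ] (T.H n).obj Q :=
  ((T.H n).map f).hom

/-- The boundary operator. -/
abbrev bd (n : ℤ) (P : GCWPair G) : (T.H (n + 1)).obj P →ₗ[Λ] (T.H n).obj P.subcomplex.toPair :=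
  ((T.bdry n).app P).hom

variable {T} {n : ℤ}

theorem ap_comp {P Q R : GCWPair G} (f : P ⟶ Q) (g : Q ⟶ R) (a : (T.H n).obj P) :
    T.ap n (f ≫ g) a = T.ap n g (T.ap n f a) := by
  simp [ap]

theorem ap_id {P : GCWPair G} (a : (T.H n).obj P) : T.ap n (𝟙 P) a = a := by
  simp [ap]

theorem bd_ap {P Q : GCWPair G} (F : P ⟶ Q) (a : (T.H (n + 1)).obj P) :
    T.bd n Q (T.ap (n + 1) F a) = T.ap n (GCWPair.subMap F) (T.bd n P a) :=
  congrArg (fun k => k.hom a) ((T.bdry n).naturality F)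

theorem totalMap_inclSub {P Q : GCWPair G} (F : P ⟶ Q) (a : (T.H n).obj P.subcomplex.toPair) :
    T.ap n (GCWPair.totalMap F) (T.ap n P.inclSub a) =
      T.ap n Q.inclSub (T.ap n (GCWPair.subMap F) a) := by
  rw [← ap_comp, ← ap_comp]
  rfl

theorem totalMap_inclTotal {P Q : GCWPair G} (F : P ⟶ Q) (a : (T.H n).obj P.total.toPair) :
    T.ap n Q.inclTotal (T.ap n (GCWPair.totalMap F) a) = T.ap n F (T.ap n P.inclTotal a) := by
  rw [← ap_comp, ← ap_comp]
  rfl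

variable {P Q : GCWPair G} {F : P ⟶ Q}

section

variable (T n)

/-- The connecting map of the Mayer–Vietoris sequence of a pushout `Y = X ∪_A B`. -/
noncomputable def connecting (hF : Function.Bijective (T.ap (n + 1) F)) :
    (T.H (n + 1)).obj Q.total.toPair →ₗ[Λ] (T.H n).obj P.subcomplex.toPair :=
  T.bd n P ∘ₗ (LinearEquiv.ofBijective _ hF).symm.toLinearMap ∘ₗ T.ap (n + 1) Q.inclTotal

end

theorem connecting_eq (hF : Function.Bijective (T.ap (n + 1) F))
    {x : (T.H (n + 1)).obj Q.total.toPair} {y : (T.H (n + 1)).obj P}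
    (h : T.ap (n + 1) F y = T.ap (n + 1) Q.inclTotal x) : T.connecting n hF x = T.bd n P y := by
  have : (LinearEquiv.ofBijective _ hF).symm (T.ap (n + 1) Q.inclTotal x) = y := by
    rw [LinearEquiv.symm_apply_eq]
    exact h.symm
  exact congrArg (T.bd n P) this

theorem exists_of_totalMap_eq (hF : ∀ n, Function.Bijective (T.ap n F))
    {c : (T.H n).obj P.total.toPair} {b : (T.H n).obj Q.subcomplex.toPair}
    (h : T.ap n (GCWPair.totalMap F) c = T.ap n Q.inclSub b) :
    ∃ a, T.ap n P.inclSub a = c ∧ T.ap n (GCWPair.subMap F) a = b := by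
  have h1 : T.ap n P.inclTotal c = 0 := by
    refine (hF n).1 ?_
    rw [map_zero, ← totalMap_inclTotal, h]
    exact (T.exact_total Q n _).2 ⟨b, rfl⟩
  obtain ⟨a₀, rfl⟩ := (T.exact_total P n _).1 h1
  have h2 : T.ap n Q.inclSub (T.ap n (GCWPair.subMap F) a₀ - b) = 0 := by
    rw [map_sub, ← totalMap_inclSub, sub_eq_zero]
    exact h
  obtain ⟨z, hz⟩ := (T.exact_sub Q n _).1 h2
  obtain ⟨y, rfl⟩ := (hF (n + 1)).2 z
  have h3 : T.ap n P.inclSub (T.bd n P y) = 0 := (T.exact_sub P n _).2 ⟨y, rfl⟩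
  refine ⟨a₀ - T.bd n P y, ?_, ?_⟩
  · rw [map_sub, h3, sub_zero]
  · rw [map_sub, ← bd_ap]
    exact (congrArg _ hz).trans (sub_sub_cancel _ _)

theorem connecting_eq_zero_iff (hF : ∀ n, Function.Bijective (T.ap n F))
    {x : (T.H (n + 1)).obj Q.total.toPair} : T.connecting n (hF (n + 1)) x = 0 ↔
      ∃ c b, x = T.ap (n + 1) (GCWPair.totalMap F) c + T.ap (n + 1) Q.inclSub b := by
  constructor
  · intro h
    obtain ⟨y, hy⟩ := (hF (n + 1)).2 (T.ap (n + 1) Q.inclTotal x)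
    rw [connecting_eq _ hy] at h
    obtain ⟨c, rfl⟩ := (T.exact_pair P n _).1 h
    have h1 : T.ap (n + 1) Q.inclTotal (x - T.ap (n + 1) (GCWPair.totalMap F) c) = 0 := by
      rw [map_sub, totalMap_inclTotal, sub_eq_zero]
      exact hy.symm
    obtain ⟨b, hb⟩ := (T.exact_total Q (n + 1) _).1 h1
    exact ⟨c, b, by rw [hb, add_sub_cancel]⟩
  · rintro ⟨c, b, rfl⟩
    rw [connecting_eq (y := T.ap (n + 1) P.inclTotal c)]
    · exact (T.exact_pair P n _).2 ⟨c, rfl⟩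
    · have : T.ap (n + 1) Q.inclTotal (T.ap (n + 1) Q.inclSub b) = 0 :=
        (T.exact_total Q (n + 1) _).2 ⟨b, rfl⟩
      rw [map_add, this, add_zero, totalMap_inclTotal]

theorem exists_connecting_eq_iff (hF : ∀ n, Function.Bijective (T.ap n F))
    {a : (T.H n).obj P.subcomplex.toPair} : (∃ x, T.connecting n (hF (n + 1)) x = a) ↔
      T.ap n P.inclSub a = 0 ∧ T.ap n (GCWPair.subMap F) a = 0 := by
  constructor
  · rintro ⟨x, rfl⟩
    obtain ⟨y, hy⟩ := (hF (n + 1)).2 (T.ap (n + 1) Q.inclTotal x)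
    rw [connecting_eq _ hy]
    refine ⟨(T.exact_sub P n _).2 ⟨y, rfl⟩, ?_⟩
    rw [← bd_ap, hy]
    exact (T.exact_pair Q n _).2 ⟨x, rfl⟩
  · rintro ⟨h1, h2⟩
    obtain ⟨y, rfl⟩ := (T.exact_sub P n _).1 h1
    obtain ⟨x, hx⟩ := (T.exact_pair Q n (T.ap (n + 1) F y)).1 (by
      rw [← h2]; exact bd_ap F y)
    exact ⟨x, connecting_eq _ hx.symm⟩

end GHomologyTheory

/-! ### Homology theories on `G`-posets -/

open GPoset

/-- A homology theory on `G`-posets: a functor which identifies comparable maps, has Mayer–Vietoris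
sequences for pushout squares, and is additive. -/
structure PosetTheory (Λ : Type v) [Ring Λ] (G : Type u) [Group G] where
  H : ℤ → (GPoset G ⥤ ModuleCat.{w} Λ)
  δ : ∀ (s : PushoutSquare G) (n : ℤ), (H (n + 1)).obj s.X →ₗ[Λ] (H n).obj s.A
  map_eq_of_le : ∀ {X Y : GPoset G} (f g : X ⟶ Y), (∀ a, fn f a ≤ fn g a) →
    ∀ n, (H n).map f = (H n).map g
  exists_of_eq : ∀ (s : PushoutSquare G) n c b,
    ((H n).map s.F).hom c = ((H n).map s.j).hom b →
      ∃ a, ((H n).map s.i).hom a = c ∧ ((H n).map s.f).hom a = b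
  δ_eq_zero_iff : ∀ (s : PushoutSquare G) n x,
    δ s n x = 0 ↔ ∃ c b, x = ((H (n + 1)).map s.F).hom c + ((H (n + 1)).map s.j).hom b
  exists_δ_eq_iff : ∀ (s : PushoutSquare G) n a,
    (∃ x, δ s n x = a) ↔ ((H n).map s.i).hom a = 0 ∧ ((H n).map s.f).hom a = 0
  exists_sum : ∀ {I : Type u} {X : I → GPoset G} {U : GPoset G} (j : ∀ i, X i ⟶ U),
    IsDisjointUnion j → ∀ n (x : (H n).obj U),
      ∃ (t : Finset I) (d : ∀ i, (H n).obj (X i)), x = ∑ i ∈ t, ((H n).map (j i)).hom (d i)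
  eq_zero_of_sum : ∀ {I : Type u} {X : I → GPoset G} {U : GPoset G} (j : ∀ i, X i ⟶ U),
    IsDisjointUnion j → ∀ n (t : Finset I) (d : ∀ i, (H n).obj (X i)),
      ∑ i ∈ t, ((H n).map (j i)).hom (d i) = 0 → ∀ i ∈ t, d i = 0

namespace PosetTheory

variable {Λ : Type v} [Ring Λ] {G : Type u} [Group G]

/-- The induced map in homology. -/
abbrev ap (T : PosetTheory.{u, v, w} Λ G) (n : ℤ) {X Y : GPoset G} (f : X ⟶ Y) :
    (T.H n).obj X →ₗ[Λ] (T.H n).obj Y := ((T.H n).map f).hom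

theorem ap_comp {T : PosetTheory.{u, v, w} Λ G} {n : ℤ} {X Y Z : GPoset G} (f : X ⟶ Y) (g : Y ⟶ Z)
    (a : (T.H n).obj X) : T.ap n (f ≫ g) a = T.ap n g (T.ap n f a) := by
  simp [ap]

theorem ap_id {T : PosetTheory.{u, v, w} Λ G} {n : ℤ} {X : GPoset G} (a : (T.H n).obj X) :
    T.ap n (𝟙 X) a = a := by
  simp [ap]

theorem bijective_ap_toPairMap (T : GHomologyTheory.{u, v, w} Λ G) (s : PushoutSquare G) (n : ℤ) :
    Function.Bijective (T.ap n s.toPairMap) :=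
  T.excision _ s.isPushout s.isCellularOnSub n

/-- The identification of the homology of `|A|` with that of the subcomplex of `(|X|, |A|)`. -/
noncomputable def subEquiv (T : GHomologyTheory.{u, v, w} Λ G) {A X : GPoset G} (i : A ⟶ X)
    (hi : IsEmbedding i) (n : ℤ) :
    (T.H n).obj ((real G).obj A) ≃ₗ[Λ] (T.H n).obj (pair i hi).subcomplex.toPair :=
  ((T.H n).mapIso (asIso (toSub i hi))).toLinearEquiv

theorem subEquiv_apply (T : GHomologyTheory.{u, v, w} Λ G) {A X : GPoset G} (i : A ⟶ X)
    (hi : IsEmbedding i) (n : ℤ) (a) : subEquiv T i hi n a = T.ap n (toSub i hi) a := rfl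

theorem inclSub_subEquiv (T : GHomologyTheory.{u, v, w} Λ G) {A X : GPoset G} (i : A ⟶ X)
    (hi : IsEmbedding i) (n : ℤ) (a) :
    T.ap n (pair i hi).inclSub (subEquiv T i hi n a) = T.ap n ((real G).map i) a := by
  rw [subEquiv_apply, ← GHomologyTheory.ap_comp]
  rfl

theorem subMap_subEquiv (T : GHomologyTheory.{u, v, w} Λ G) (s : PushoutSquare G) (n : ℤ) (a) :
    T.ap n (GCWPair.subMap s.toPairMap) (subEquiv T s.i s.isEmbedding_i n a) =
      subEquiv T s.j s.isEmbedding_j n (T.ap n ((real G).map s.f) a) := by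
  rw [subEquiv_apply, subEquiv_apply, ← GHomologyTheory.ap_comp, ← GHomologyTheory.ap_comp]
  congr 2
  refine GCWPair.hom_ext fun p => Subtype.ext ?_
  have := congrArg (fun h => (real G).map h) s.comm
  simp only [Functor.map_comp] at this
  exact congrFun (congrArg GCWPair.Hom.toFun this) p

theorem sum_eq_zero (T : GHomologyTheory.{u, v, w} Λ G) {I : Type u} {X : I → GPoset G}
    {U : GPoset G} {j : ∀ i, X i ⟶ U} (hj : IsDisjointUnion j) {n : ℤ} (t : Finset I)
    (d : ∀ i, (T.H n).obj (X i).complex.toPair)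
    (h : ∑ i ∈ t, T.ap n (P := (X i).complex.toPair) (Q := U.complex.toPair)
      ((real G).map (j i)) (d i) = 0) : ∀ i ∈ t, d i = 0 := by
  classical
  intro i hi
  have hiso : Function.Bijective (T.ap n (fromSigma j)) := by
    have := hj.isIso_fromSigma
    exact ConcreteCategory.bijective_of_isIso ((T.H n).map (fromSigma j))
  have h0 : ∑ i ∈ t, DirectSum.lof Λ I (fun i => (T.H n).obj (X i).complex.toPair) i (d i) = 0 := by
    refine (T.disjoint_union (fun i => (X i).complex) n).1 (hiso.1 ?_)
    rw [map_zero, map_zero, map_sum, map_sum]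
    refine Eq.trans (Finset.sum_congr rfl fun i _ => ?_) h
    rw [DirectSum.toModule_lof]
    exact (GHomologyTheory.ap_comp _ _ _).symm
  have h1 := congrArg (DirectSum.component Λ I
    (fun i => (T.H n).obj (X i).complex.toPair) i) h0
  rw [map_sum, map_zero, Finset.sum_eq_single i] at h1
  · rwa [DirectSum.component.lof_self] at h1
  · intro k _ hk
    rw [DirectSum.component.of, dif_neg hk]
  · exact fun h => absurd hi h

/-- The homology of order complexes. -/
noncomputable def ofTheory (T : GHomologyTheory.{u, v, w} Λ G) : PosetTheory.{u, v, w} Λ G where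
  H n := real G ⋙ T.H n
  δ s n := (subEquiv T s.i s.isEmbedding_i n).symm.toLinearMap ∘ₗ
    T.connecting n (bijective_ap_toPairMap T s (n + 1))
  map_eq_of_le f g h n := T.map_eq_of_homotopic _ _ (homotopic_of_le f g h) n
  exists_of_eq s n c b h := by
    obtain ⟨a, ha, hb⟩ := GHomologyTheory.exists_of_totalMap_eq (bijective_ap_toPairMap T s)
      (c := c) (b := subEquiv T s.j s.isEmbedding_j n b) (by
        rw [inclSub_subEquiv]
        exact h)
    obtain ⟨a, rfl⟩ := (subEquiv T s.i s.isEmbedding_i n).surjective a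
    rw [inclSub_subEquiv] at ha
    rw [subMap_subEquiv] at hb
    exact ⟨a, ha, (subEquiv T s.j s.isEmbedding_j n).injective hb⟩
  δ_eq_zero_iff s n x := by
    change (subEquiv T s.i s.isEmbedding_i n).symm
      (T.connecting n (bijective_ap_toPairMap T s (n + 1)) x) = 0 ↔ _
    rw [LinearEquiv.map_eq_zero_iff]
    refine (GHomologyTheory.connecting_eq_zero_iff (bijective_ap_toPairMap T s)).trans ?_
    refine exists_congr fun c => ?_
    rw [(subEquiv T s.j s.isEmbedding_j (n + 1)).surjective.exists]
    refine exists_congr fun b => ?_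
    rw [inclSub_subEquiv]
    rfl
  exists_δ_eq_iff s n a := by
    have := GHomologyTheory.exists_connecting_eq_iff (bijective_ap_toPairMap T s)
      (a := subEquiv T s.i s.isEmbedding_i n a)
    rw [inclSub_subEquiv, subMap_subEquiv, LinearEquiv.map_eq_zero_iff] at this
    refine Iff.trans (exists_congr fun x => ?_) this
    exact (subEquiv T s.i s.isEmbedding_i n).symm_apply_eq
  exists_sum := by
    classical
    intro I X U j hj n x
    have hiso : Function.Bijective (T.ap n (fromSigma j)) := by
      have := hj.isIso_fromSigma
      exact ConcreteCategory.bijective_of_isIso ((T.H n).map (fromSigma j))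
    obtain ⟨y, rfl⟩ := hiso.2 x
    obtain ⟨d, rfl⟩ := (T.disjoint_union (fun i => (X i).complex) n).2 y
    refine ⟨d.support, d, ?_⟩
    conv_lhs => rw [← DirectSum.sum_support_of d]
    rw [map_sum, map_sum]
    refine Finset.sum_congr rfl fun i _ => ?_
    rw [← DirectSum.lof_eq_of Λ, DirectSum.toModule_lof]
    exact (GHomologyTheory.ap_comp _ _ _).symm
  eq_zero_of_sum j hj n t d h := sum_eq_zero T hj t d h

end PosetTheory

/-- A functor between `G`-posets which preserves the relevant structure. -/
structure IsExactFunctor {G K : Type u} [Group G] [Group K] (Φ : GPoset G ⥤ GPoset K) : Prop where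
  map_le : ∀ {X Y : GPoset G} (f g : X ⟶ Y), (∀ a, fn f a ≤ fn g a) →
    ∀ a, fn (Φ.map f) a ≤ fn (Φ.map g) a
  isEmbedding : ∀ {X Y : GPoset G} (f : X ⟶ Y), IsEmbedding f → IsEmbedding (Φ.map f)
  mem_range : ∀ (s : PushoutSquare G) c, fn (Φ.map s.F) c ∈ Set.range (fn (Φ.map s.j)) →
    c ∈ Set.range (fn (Φ.map s.i))
  inj : ∀ (s : PushoutSquare G) z z', fn (Φ.map s.F) z ∉ Set.range (fn (Φ.map s.j)) →
    fn (Φ.map s.F) z = fn (Φ.map s.F) z' → z = z'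
  lift : ∀ (s : PushoutSquare G) x, x ∉ Set.range (fn (Φ.map s.j)) → ∀ y, y ≤ x ∨ x ≤ y →
    ∃ z c, fn (Φ.map s.F) z = x ∧ fn (Φ.map s.F) c = y ∧ (c ≤ z ∨ z ≤ c)
  reflect : ∀ (s : PushoutSquare G) z, fn (Φ.map s.F) z ∉ Set.range (fn (Φ.map s.j)) →
    ∀ c c', (c ≤ z ∨ z ≤ c) → (c' ≤ z ∨ z ≤ c') →
      fn (Φ.map s.F) c ≤ fn (Φ.map s.F) c' → c ≤ c'
  isDisjointUnion : ∀ {I : Type u} {X : I → GPoset G} {U : GPoset G} (j : ∀ i, X i ⟶ U),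
    IsDisjointUnion j → IsDisjointUnion fun i => Φ.map (j i)

namespace IsExactFunctor

variable {Λ : Type v} [Ring Λ] {G K : Type u} [Group G] [Group K] {Φ : GPoset G ⥤ GPoset K}

/-- The image of a pushout square. -/
abbrev square (hΦ : IsExactFunctor Φ) (s : PushoutSquare G) : PushoutSquare K where
  A := Φ.obj s.A
  B := Φ.obj s.B
  C := Φ.obj s.C
  X := Φ.obj s.X
  i := Φ.map s.i
  f := Φ.map s.f
  F := Φ.map s.F
  j := Φ.map s.j
  comm := by rw [← Φ.map_comp, s.comm, Φ.map_comp]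
  isEmbedding_i := hΦ.isEmbedding _ s.isEmbedding_i
  isEmbedding_j := hΦ.isEmbedding _ s.isEmbedding_j
  mem_range := hΦ.mem_range s
  inj := hΦ.inj s
  lift := hΦ.lift s
  reflect := hΦ.reflect s

/-- The pullback of a theory along an exact functor. -/
def theory (hΦ : IsExactFunctor Φ) (T : PosetTheory.{u, v, w} Λ K) : PosetTheory.{u, v, w} Λ G where
  H n := Φ ⋙ T.H n
  δ s n := T.δ (hΦ.square s) n
  map_eq_of_le f g h n := T.map_eq_of_le _ _ (hΦ.map_le f g h) n
  exists_of_eq s n := T.exists_of_eq (hΦ.square s) n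
  δ_eq_zero_iff s n := T.δ_eq_zero_iff (hΦ.square s) n
  exists_δ_eq_iff s n := T.exists_δ_eq_iff (hΦ.square s) n
  exists_sum j hj n := T.exists_sum _ (hΦ.isDisjointUnion j hj) n
  eq_zero_of_sum j hj n := T.eq_zero_of_sum _ (hΦ.isDisjointUnion j hj) n

end IsExactFunctor


open GPoset

/-! ### Directed systems of theories -/

section System

variable {Λ : Type v} [Ring Λ] {G : Type u} [Group G]

/-- A transformation of homology theories on `G`-posets. -/
structure PosetTheory.Trans (T T' : PosetTheory.{u, v, w} Λ G) where
  app : ∀ (n : ℤ) (X : GPoset G), (T.H n).obj X →ₗ[Λ] (T'.H n).obj X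
  app_ap : ∀ {n : ℤ} {X Y : GPoset G} (f : X ⟶ Y) a, app n Y (T.ap n f a) = T'.ap n f (app n X a)
  app_δ : ∀ (s : PushoutSquare G) (n : ℤ) x, app n s.A (T.δ s n x) = T'.δ s n (app (n + 1) s.X x)

/-- A directed system of homology theories with compatible transformations to a fixed one. -/
structure TheorySystem (T : PosetTheory.{u, v, w} Λ G) where
  I : Type u
  [preorder : Preorder I]
  [directed : IsDirectedOrder I]
  [nonempty : Nonempty I]
  obj : I → PosetTheory.{u, v, w} Λ G
  map : ∀ i j, i ≤ j → (obj i).Trans (obj j)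
  map_map : ∀ i j k (hij : i ≤ j) (hjk : j ≤ k) n X x,
    (map j k hjk).app n X ((map i j hij).app n X x) = (map i k (hij.trans hjk)).app n X x
  toT : ∀ i, (obj i).Trans T
  toT_map : ∀ i j (hij : i ≤ j) n X x, (toT j).app n X ((map i j hij).app n X x) = (toT i).app n X x

attribute [instance] TheorySystem.preorder TheorySystem.directed TheorySystem.nonempty

namespace TheorySystem

variable {T : PosetTheory.{u, v, w} Λ G} (S : TheorySystem T)

/-- The value of `T` on `X` is the colimit of the values of the system, in terms of elements. -/
def IsColim (n : ℤ) (X : GPoset G) : Prop :=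
  (∀ y, ∃ i x, (S.toT i).app n X x = y) ∧
    ∀ i x, (S.toT i).app n X x = 0 → ∃ j, ∃ hij : i ≤ j, (S.map i j hij).app n X x = 0

variable {S}

/-- An element which vanishes at some stage vanishes from then on. -/
theorem map_eq_zero_of_le {n : ℤ} {X : GPoset G} {i j k : S.I} {hij : i ≤ j} (hjk : j ≤ k)
    {x : ((S.obj i).H n).obj X} (h : (S.map i j hij).app n X x = 0) :
    (S.map i k (hij.trans hjk)).app n X x = 0 := by
  rw [← S.map_map i j k hij hjk, h, map_zero]

/-- The five lemma for a Mayer–Vietoris sequence. -/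
theorem isColim_of_square (s : PushoutSquare G) (hA : ∀ n, S.IsColim n s.A)
    (hB : ∀ n, S.IsColim n s.B) (hC : ∀ n, S.IsColim n s.C) (n : ℤ) : S.IsColim n s.X := by
  obtain ⟨m, rfl⟩ : ∃ m : ℤ, n = m + 1 := ⟨n - 1, by ring⟩
  constructor
  · intro y
    obtain ⟨i, a, ha⟩ := (hA m).1 (T.δ s m y)
    obtain ⟨h1, h2⟩ := (T.exists_δ_eq_iff s m _).1 ⟨y, rfl⟩
    rw [← ha] at h1 h2
    obtain ⟨j₁, hj₁, e₁⟩ := (hC m).2 i ((S.obj i).ap m s.i a) (((S.toT i).app_ap s.i a).trans h1)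
    obtain ⟨j₂, hj₂, e₂⟩ := (hB m).2 i ((S.obj i).ap m s.f a) (((S.toT i).app_ap s.f a).trans h2)
    obtain ⟨j, h₁, h₂⟩ := exists_ge_ge j₁ j₂
    have e₁' := map_eq_zero_of_le h₁ e₁
    have e₂' := map_eq_zero_of_le h₂ e₂
    rw [(S.map i j _).app_ap] at e₁' e₂'
    obtain ⟨x, hx⟩ := ((S.obj j).exists_δ_eq_iff s m _).2 ⟨e₁', e₂'⟩
    have h3 : T.δ s m (y - (S.toT j).app _ _ x) = 0 := by
      rw [map_sub, ← (S.toT j).app_δ, hx, S.toT_map, ha, sub_self]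
    obtain ⟨c, b, hcb⟩ := (T.δ_eq_zero_iff s m _).1 h3
    obtain ⟨k₁, c', rfl⟩ := (hC (m + 1)).1 c
    obtain ⟨k₂, b', rfl⟩ := (hB (m + 1)).1 b
    obtain ⟨l, l₁, l₂⟩ := exists_ge_ge k₁ k₂
    obtain ⟨k, hk, hjk⟩ := exists_ge_ge l j
    refine ⟨k, (S.map j k hjk).app _ _ x +
      ((S.obj k).ap _ s.F ((S.map k₁ k (l₁.trans hk)).app _ _ c') +
        (S.obj k).ap _ s.j ((S.map k₂ k (l₂.trans hk)).app _ _ b')), ?_⟩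
    rw [map_add, map_add, S.toT_map, (S.toT k).app_ap, (S.toT k).app_ap, S.toT_map, S.toT_map,
      ← hcb, add_sub_cancel]
  · intro i x hx
    have h1 : (S.toT i).app _ _ ((S.obj i).δ s m x) = 0 := by
      rw [(S.toT i).app_δ, hx, map_zero]
    obtain ⟨j, hij, e⟩ := (hA m).2 _ _ h1
    rw [(S.map i j _).app_δ] at e
    obtain ⟨c, b, hcb⟩ := ((S.obj j).δ_eq_zero_iff s m _).1 e
    have h2 := congrArg ((S.toT j).app (m + 1) s.X) hcb
    rw [S.toT_map, hx, map_add, (S.toT j).app_ap, (S.toT j).app_ap] at h2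
    obtain ⟨a, hac, hab⟩ := T.exists_of_eq s (m + 1) ((S.toT j).app _ _ c)
      (-(S.toT j).app _ _ b) (by rw [map_neg]; exact eq_neg_of_add_eq_zero_left h2.symm)
    obtain ⟨k₀, a', rfl⟩ := (hA (m + 1)).1 a
    obtain ⟨k, hk₀, hjk⟩ := exists_ge_ge k₀ j
    let a'' := (S.map k₀ k hk₀).app _ _ a'
    have hc : (S.toT k).app _ _ ((S.obj k).ap _ s.i a'' - (S.map j k hjk).app _ _ c) = 0 := by
      rw [map_sub, (S.toT k).app_ap, S.toT_map, S.toT_map, sub_eq_zero]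
      exact hac
    have hb : (S.toT k).app _ _ ((S.obj k).ap _ s.f a'' + (S.map j k hjk).app _ _ b) = 0 := by
      rw [map_add, (S.toT k).app_ap, S.toT_map, S.toT_map]
      exact (congrArg (· + _) hab).trans (neg_add_cancel _)
    obtain ⟨l₁, hl₁, ec⟩ := (hC (m + 1)).2 _ _ hc
    obtain ⟨l₂, hl₂, eb⟩ := (hB (m + 1)).2 _ _ hb
    obtain ⟨l, h₁, h₂⟩ := exists_ge_ge l₁ l₂
    have ec' := map_eq_zero_of_le h₁ ec
    have eb' := map_eq_zero_of_le h₂ eb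
    have hkl := hl₁.trans h₁
    rw [map_sub, (S.map k l hkl).app_ap, sub_eq_zero] at ec'
    rw [map_add, (S.map k l hkl).app_ap] at eb'
    refine ⟨l, hij.trans (hjk.trans hkl), ?_⟩
    rw [← S.map_map i j l hij (hjk.trans hkl), ← S.map_map j k l hjk hkl, hcb, map_add, map_add,
      (S.map j k hjk).app_ap, (S.map j k hjk).app_ap, (S.map k l hkl).app_ap,
      (S.map k l hkl).app_ap, ← ec', ← PosetTheory.ap_comp, s.comm, PosetTheory.ap_comp, ← map_add,
      eb', map_zero]

theorem isColim_of_isDisjointUnion {I : Type u} {X : I → GPoset G} {U : GPoset G} {j : ∀ i, X i ⟶ U}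
    (hj : IsDisjointUnion j) {n : ℤ} (h : ∀ i, S.IsColim n (X i)) : S.IsColim n U := by
  classical
  constructor
  · intro y
    obtain ⟨t, d, rfl⟩ := T.exists_sum j hj n y
    choose k x hx using fun i => (h i).1 (d i)
    obtain ⟨l, hl⟩ := (t.image k).exists_le
    refine ⟨l, ∑ i ∈ t.attach, (S.obj l).ap n (j i)
      ((S.map (k i) l (hl _ (Finset.mem_image_of_mem k i.2))).app _ _ (x i)), ?_⟩
    rw [map_sum, ← Finset.sum_attach t]
    refine Finset.sum_congr rfl fun i _ => ?_
    rw [(S.toT l).app_ap, S.toT_map, hx]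
  · intro i x hx
    obtain ⟨t, d, rfl⟩ := (S.obj i).exists_sum j hj n x
    rw [map_sum] at hx
    have h0 := T.eq_zero_of_sum j hj n t (fun k => (S.toT i).app _ _ (d k)) (by
      rw [← hx]
      exact Finset.sum_congr rfl fun k _ => ((S.toT i).app_ap (j k) (d k)).symm)
    have h1 : ∀ k, ∃ l, ∃ hl : i ≤ l, k ∈ t → (S.map i l hl).app _ _ (d k) = 0 := by
      intro k
      by_cases hk : k ∈ t
      · obtain ⟨l, hl, e⟩ := (h k).2 _ _ (h0 k hk)
        exact ⟨l, hl, fun _ => e⟩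
      · exact ⟨i, le_rfl, fun h => absurd h hk⟩
    choose l hl e using h1
    obtain ⟨m, hm⟩ := (insert i (t.image l)).exists_le
    refine ⟨m, hm i (Finset.mem_insert_self _ _), ?_⟩
    rw [map_sum]
    refine Finset.sum_eq_zero fun k hk => ?_
    have := map_eq_zero_of_le (hm _ (Finset.mem_insert_of_mem (Finset.mem_image_of_mem l hk)))
      (e k hk)
    rw [(S.map i m _).app_ap]
    exact (congrArg _ this).trans (map_zero _)

/-- The colimit property passes to homotopy retracts. -/
theorem isColim_of_retract {X Y : GPoset G} (s : X ⟶ Y) (r : Y ⟶ X)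
    (h : ∀ a, a ≤ fn r (fn s a)) {n : ℤ} (hY : S.IsColim n Y) : S.IsColim n X := by
  have hid : ∀ (T : PosetTheory.{u, v, w} Λ G) x, T.ap n r (T.ap n s x) = x := fun T x => by
    rw [← PosetTheory.ap_comp, PosetTheory.ap, ← T.map_eq_of_le (𝟙 X) (s ≫ r) h]
    exact PosetTheory.ap_id x
  constructor
  · intro y
    obtain ⟨i, x, hx⟩ := hY.1 (T.ap n s y)
    exact ⟨i, (S.obj i).ap n r x, by rw [(S.toT i).app_ap, hx, hid]⟩
  · intro i x hx
    obtain ⟨j, hij, e⟩ := hY.2 i ((S.obj i).ap n s x) (by rw [(S.toT i).app_ap, hx, map_zero])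
    refine ⟨j, hij, ?_⟩
    rw [(S.map i j hij).app_ap] at e
    rw [← hid (S.obj j) ((S.map i j hij).app n X x), e, map_zero]

end TheorySystem

end System

/-! ### Constructions of `G`-posets -/

namespace GPoset

variable {G : Type u} [Group G]

/-- An invariant subset of a `G`-poset. -/
def sub (X : GPoset G) (p : X.carrier → Prop) (hp : ∀ (g : G) a, p a → p (g • a)) :
    GPoset G where
  carrier := {a // p a}
  action :=
    { smul := fun g a => ⟨g • a.1, hp g _ a.2⟩
      one_smul := fun a => Subtype.ext (one_smul G a.1)
      mul_smul := fun g h a => Subtype.ext (mul_smul g h a.1) }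
  smul_le g _ _ h := X.smul_le g h
  rank a := X.rank a.1
  rank_strictMono _ _ h := X.rank_strictMono h
  rank_smul g a := X.rank_smul g a.1

/-- The inclusion of an invariant subset. -/
def incl (X : GPoset G) (p : X.carrier → Prop) (hp : ∀ (g : G) a, p a → p (g • a)) :
    X.sub p hp ⟶ X where
  toFun := Subtype.val
  monotone' _ _ h := h
  map_smul _ _ := rfl

/-- The inclusion between invariant subsets. -/
def inclOfLE (X : GPoset G) {p q : X.carrier → Prop} (hp : ∀ (g : G) a, p a → p (g • a))
    (hq : ∀ (g : G) a, q a → q (g • a)) (h : ∀ a, p a → q a) : X.sub p hp ⟶ X.sub q hq where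
  toFun a := ⟨a.1, h _ a.2⟩
  monotone' _ _ h := h
  map_smul _ _ := rfl

/-- Two invariant subsets `p`, `q` which cover `X` in such a way that every simplex of `X` lies in
one of them. -/
def coverSquare (X : GPoset G) (p q : X.carrier → Prop) (hp : ∀ (g : G) a, p a → p (g • a))
    (hq : ∀ (g : G) a, q a → q (g • a)) (h : ∀ z, ¬ q z → ∀ y, y ≤ z ∨ z ≤ y → p y) :
    PushoutSquare G where
  A := X.sub (fun a => p a ∧ q a) fun g a h => ⟨hp g a h.1, hq g a h.2⟩
  B := X.sub q hq
  C := X.sub p hp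
  X := X
  i := X.inclOfLE _ _ fun _ h => h.1
  f := X.inclOfLE _ _ fun _ h => h.2
  F := X.incl _ _
  j := X.incl _ _
  comm := rfl
  isEmbedding_i _ _ h := h
  isEmbedding_j _ _ h := h
  mem_range := by
    rintro c ⟨b, hb⟩
    exact ⟨⟨c.1, c.2, by rw [show c.1 = b.1 from hb.symm]; exact b.2⟩, rfl⟩
  inj z z' _ e := Subtype.ext e
  lift x hx y hxy := by
    have hx' : ¬ q x := fun h => hx ⟨⟨x, h⟩, rfl⟩
    exact ⟨⟨x, h x hx' x (Or.inl le_rfl)⟩, ⟨y, h x hx' y hxy⟩, rfl, rfl, hxy⟩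
  reflect _ _ _ _ _ _ h := h

/-- The equality relation as a partial order. -/
abbrev eqOrder (α : Type u) : PartialOrder α where
  le := Eq
  le_refl _ := rfl
  le_trans _ _ _ h h' := h.trans h'
  le_antisymm _ _ h _ := h

/-- The discrete `G`-poset `G/L`. -/
def orbit (L : Subgroup G) : GPoset G where
  carrier := G ⧸ L
  order := eqOrder _
  smul_le g _ _ h := congrArg (g • ·) h
  rank _ := 0
  rank_strictMono := letI := eqOrder (G ⧸ L); fun _ _ h => absurd h.le h.ne
  rank_smul _ _ := rfl

/-- The orbit map `G/G_a → X`. -/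
def orbitMap {X : GPoset G} (a : X.carrier) : orbit (MulAction.stabilizer G a) ⟶ X where
  toFun := MulAction.ofQuotientStabilizer G a
  monotone' _ _ h := le_of_eq (congrArg _ h)
  map_smul g b := MulAction.ofQuotientStabilizer_smul G a g b

/-- All isotropy groups of `X` belong to `P`. -/
def HasIsotropy (X : GPoset G) (P : Subgroup G → Prop) : Prop :=
  ∀ a : X.carrier, P (MulAction.stabilizer G a)

theorem HasIsotropy.of_hom {X Y : GPoset G} {P : Subgroup G → Prop}
    (hP : ∀ L M, L ≤ M → P M → P L) (hX : X.HasIsotropy P) (f : Y ⟶ X) : Y.HasIsotropy P :=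
  fun a => hP _ _ (fun g hg => by
    rw [MulAction.mem_stabilizer_iff] at hg ⊢
    rw [← fn_smul, hg]) (hX (fn f a))

/-- The pairs `y ≤ x` with `x` of rank `n`. -/
@[ext] structure ConeElement (X : GPoset G) (n : ℕ) where
  top : X.carrier
  pt : X.carrier
  le : pt ≤ top
  rank_top : X.rank top = n

/-- Every `x` of rank `n` contributes a copy of the elements below it. -/
instance (X : GPoset G) (n : ℕ) : PartialOrder (X.ConeElement n) where
  le p q := p.top = q.top ∧ p.pt ≤ q.pt
  le_refl p := ⟨rfl, le_rfl⟩
  le_trans p q r h h' := ⟨h.1.trans h'.1, h.2.trans h'.2⟩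
  le_antisymm p q h h' := ConeElement.ext h.1 (le_antisymm h.2 h'.2)

/-- The disjoint union of the closed lower sets of all elements of rank `n`. -/
abbrev cone (X : GPoset G) (n : ℕ) : GPoset G where
  carrier := X.ConeElement n
  action :=
    { smul := fun g p => ⟨g • p.top, g • p.pt, X.smul_le g p.le, (X.rank_smul g _).trans p.rank_top⟩
      one_smul := fun _ => ConeElement.ext (one_smul G _) (one_smul G _)
      mul_smul := fun g h _ => ConeElement.ext (mul_smul g h _) (mul_smul g h _) }
  smul_le g _ _ h := And.intro (congrArg (g • ·) h.1) (X.smul_le g h.2)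
  rank p := X.rank p.pt
  rank_strictMono _ _ h :=
    X.rank_strictMono (lt_of_le_of_ne h.le.2 fun e => h.ne (ConeElement.ext h.le.1 e))
  rank_smul g p := X.rank_smul g p.pt

/-- The base of the cone. -/
abbrev link (X : GPoset G) (n : ℕ) : GPoset G :=
  (X.cone n).sub (fun p => p.pt < p.top) fun g _ h => X.smul_lt_smul g h

/-- The map `(x, y) ↦ y`. -/
def coneMap (X : GPoset G) (n : ℕ) : X.cone n ⟶ X where
  toFun p := p.pt
  monotone' _ _ h := h.2
  map_smul _ _ := rfl

/-- The elements of rank `n` are attached to those of smaller rank by coning off their links. -/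
def rankSquare (X : GPoset G) (n : ℕ) (hX : ∀ a, X.rank a < n + 1) : PushoutSquare G where
  A := X.link n
  B := X.sub (fun a => X.rank a < n) fun g a h => by rwa [X.rank_smul]
  C := X.cone n
  X := X
  i := (X.cone n).incl _ _
  f :=
    { toFun := fun p => ⟨p.1.pt, lt_of_lt_of_eq (X.rank_strictMono p.2) p.1.rank_top⟩
      monotone' := fun _ _ h => h.2
      map_smul := fun _ _ => rfl }
  F := X.coneMap n
  j := X.incl _ fun g a h => by rwa [X.rank_smul]
  comm := rfl
  isEmbedding_i _ _ h := h
  isEmbedding_j _ _ h := h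
  mem_range := by
    rintro c ⟨b, hb⟩
    refine ⟨⟨c, lt_of_le_of_ne c.le fun e => ?_⟩, rfl⟩
    have h1 : X.rank b.1 < n := b.2
    have h2 : b.1 = c.pt := hb
    rw [h2, e, c.rank_top] at h1
    exact lt_irrefl _ h1
  inj := by
    have key : ∀ z : X.ConeElement n, ¬ X.rank z.pt < n → z.top = z.pt := by
      intro z hz
      by_contra hne
      exact hz (lt_of_lt_of_eq (X.rank_strictMono (lt_of_le_of_ne z.le (Ne.symm hne))) z.rank_top)
    intro z z' hz e
    have hz' : ¬ X.rank z.pt < n := fun h => hz ⟨⟨_, h⟩, rfl⟩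
    have e' : z.pt = z'.pt := e
    refine ConeElement.ext ?_ e'
    rw [key z hz', key z' (e' ▸ hz'), e']
  lift x hx y hxy := by
    have hx' : ¬ X.rank x < n := fun h => hx ⟨⟨_, h⟩, rfl⟩
    have hxn : X.rank x = n := by have := hX x; omega
    have hyx : y ≤ x := by
      rcases hxy with h | h
      · exact h
      · rcases h.eq_or_lt with rfl | h
        · exact le_rfl
        · have := X.rank_strictMono h
          have := hX y
          omega
    exact ⟨⟨x, x, le_rfl, hxn⟩, ⟨x, y, hyx, hxn⟩, rfl, rfl, Or.inl ⟨rfl, hyx⟩⟩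
  reflect z _ c c' hc hc' h :=
    ⟨(hc.elim (·.1) (·.1.symm)).trans (hc'.elim (·.1) (·.1.symm)).symm, h⟩

/-- The order of the fence `0 < 1 > 2 < 3 > ⋯`. -/
def FenceLE (k l : ℕ) : Prop := k = l ∨ (k % 2 = 0 ∧ (l = k + 1 ∨ k = l + 1))

theorem FenceLE.trans {k l m : ℕ} (h : FenceLE k l) (h' : FenceLE l m) : FenceLE k m := by
  unfold FenceLE at *
  omega

theorem FenceLE.antisymm {k l : ℕ} (h : FenceLE k l) (h' : FenceLE l k) : k = l := by
  unfold FenceLE at *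
  omega

theorem FenceLE.mod_two_lt {k l : ℕ} (h : FenceLE k l) (hne : k ≠ l) : k % 2 < l % 2 := by
  unfold FenceLE at *
  omega

/-- The elements of the telescope. -/
@[ext] structure TelescopeElement (X : GPoset G) where
  pt : X.carrier
  level : ℕ
  rank_le : X.rank pt ≤ level

instance (X : GPoset G) : PartialOrder X.TelescopeElement where
  le p q := p.pt ≤ q.pt ∧ FenceLE p.level q.level
  le_refl p := ⟨le_rfl, Or.inl rfl⟩
  le_trans p q r h h' := ⟨h.1.trans h'.1, h.2.trans h'.2⟩
  le_antisymm p q h h' := TelescopeElement.ext (le_antisymm h.1 h'.1) (h.2.antisymm h'.2)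

/-- The telescope of a `G`-poset: the part of the product of `X` with the fence where the rank of
the first component is bounded by the second.  It is a weak substitute for `X`, and is
the union of two subsets whose components are of finite rank. -/
abbrev telescope (X : GPoset G) : GPoset G where
  carrier := X.TelescopeElement
  action :=
    { smul := fun g p => ⟨g • p.pt, p.level, (X.rank_smul g _).trans_le p.rank_le⟩
      one_smul := fun _ => TelescopeElement.ext (one_smul G _) rfl
      mul_smul := fun g h _ => TelescopeElement.ext (mul_smul g h _) rfl }
  smul_le g _ _ h := And.intro (X.smul_le g h.1) h.2
  rank p := X.rank p.pt + p.level % 2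
  rank_strictMono p q h := by
    obtain ⟨h1, h2⟩ := h.le
    rcases eq_or_ne p.level q.level with e | hne
    · have hlt : p.pt < q.pt := lt_of_le_of_ne h1 fun e' => h.ne (TelescopeElement.ext e' e)
      exact add_lt_add_of_lt_of_le (X.rank_strictMono hlt) (by rw [e])
    · exact add_lt_add_of_le_of_lt (X.rank_strictMono.monotone h1) (h2.mod_two_lt hne)
  rank_smul g p := congrArg (· + p.level % 2) (X.rank_smul g p.pt)

/-- The projection of the telescope. -/
def telescopeMap (X : GPoset G) : X.telescope ⟶ X where
  toFun p := p.pt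
  monotone' _ _ h := h.1
  map_smul _ _ := rfl

theorem isDisjointUnion_incl (X : GPoset G) {I : Type u} (e : X.carrier → I)
    (he : ∀ a b, a ≤ b → e a = e b) (hs : ∀ (g : G) a, e (g • a) = e a) :
    IsDisjointUnion fun i => X.incl (fun a => e a = i) fun g a h => (hs g a).trans h where
  isEmbedding _ _ _ h := h
  exists_eq a := ⟨e a, ⟨a, rfl⟩, rfl⟩
  index_eq _ _ a b h := a.2.symm.trans ((he _ _ h).trans b.2)

theorem isDisjointUnion_orbitMap (X : GPoset G) (hX : ∀ a b : X.carrier, a ≤ b → a = b) :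
    IsDisjointUnion fun o : MulAction.orbitRel.Quotient G X.carrier =>
      orbitMap (X := X) (Quotient.out o) where
  isEmbedding _ _ _ h := MulAction.injective_ofQuotientStabilizer G _ (hX _ _ h)
  exists_eq a := by
    obtain ⟨g, hg⟩ := (MulAction.orbitRel G X.carrier).symm
      (Quotient.mk_out (s := MulAction.orbitRel G X.carrier) a)
    exact ⟨Quotient.mk _ a, QuotientGroup.mk g, hg⟩
  index_eq o o' a b h := by
    induction a using QuotientGroup.induction_on with
    | H g =>
    induction b using QuotientGroup.induction_on with
    | H g' =>
    have h : g • Quotient.out o = g' • Quotient.out o' := hX _ _ h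
    rw [← Quotient.out_eq o, ← Quotient.out_eq o']
    refine Quotient.sound ⟨g⁻¹ * g', ?_⟩
    change (g⁻¹ * g') • Quotient.out o' = Quotient.out o
    rw [mul_smul, ← h, inv_smul_smul]

end GPoset

/-! ### Induction over orbits -/

namespace TheorySystem

variable {Λ : Type v} [Ring Λ] {G : Type u} [Group G] {T : PosetTheory.{u, v, w} Λ G}
  {S : TheorySystem T} {P : Subgroup G → Prop}

theorem isColim_of_discrete (hO : ∀ L, P L → ∀ n, S.IsColim n (orbit L)) {X : GPoset G}
    (hX : X.HasIsotropy P) (hd : ∀ a b : X.carrier, a ≤ b → a = b) (n : ℤ) : S.IsColim n X :=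
  isColim_of_isDisjointUnion (X.isDisjointUnion_orbitMap hd) fun _ => hO _ (hX _) n

/-- A directed system which has the colimit property for orbits has it for posets of finite rank, by
induction on the rank: the elements of top rank are attached by `rankSquare`. -/
theorem isColim_of_rank_lt (hP : ∀ L M, L ≤ M → P M → P L)
    (hO : ∀ L, P L → ∀ n, S.IsColim n (orbit L)) (N : ℕ) : ∀ X : GPoset G, X.HasIsotropy P →
      (∀ a, X.rank a < N) → ∀ n, S.IsColim n X := by
  induction N with
  | zero =>
    exact fun X hX hN n => isColim_of_discrete hO hX (fun a => absurd (hN a) (Nat.not_lt_zero _)) n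
  | succ N ih =>
    intro X hX hN
    refine isColim_of_square (X.rankSquare N hN) ?_ ?_ ?_
    · exact ih _ (hX.of_hom hP ((X.rankSquare N hN).i ≫ X.coneMap N)) fun p =>
        lt_of_lt_of_eq (X.rank_strictMono p.2) p.1.rank_top
    · exact ih _ (hX.of_hom hP (X.rankSquare N hN).j) fun a => a.2
    · intro n
      -- The cone retracts onto its apices, which form the discrete poset of elements of rank `N`.
      let D : GPoset G := X.sub (fun a => X.rank a = N) fun g a h => (X.rank_smul g a).trans h
      let s : X.cone N ⟶ D :=
        { toFun := fun p => ⟨p.top, p.rank_top⟩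
          monotone' := fun _ _ h => h.1.le
          map_smul := fun _ _ => rfl }
      let r : D ⟶ X.cone N :=
        { toFun := fun a => ⟨a.1, a.1, le_rfl, a.2⟩
          monotone' := fun a b h => by
            have h' : a.1 ≤ b.1 := h
            have e : a.1 = b.1 := X.eq_of_rank_eq h' (a.2.trans b.2.symm)
            exact ⟨e, h'⟩
          map_smul := fun _ _ => rfl }
      refine isColim_of_retract s r (fun p => ⟨rfl, p.le⟩) (isColim_of_discrete hO
        (hX.of_hom hP (X.incl (fun a => X.rank a = N) _)) (fun a b h => ?_) n)
      exact Subtype.ext (X.eq_of_rank_eq h (a.2.trans b.2.symm))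

/-- The colimit property for a poset which is the disjoint union over `k : ℕ` of parts whose rank is
bounded in terms of `k`. -/
theorem isColim_of_index (hP : ∀ L M, L ≤ M → P M → P L)
    (hO : ∀ L, P L → ∀ n, S.IsColim n (orbit L)) {X : GPoset G} (hX : X.HasIsotropy P)
    (e : X.carrier → ℕ) (he : ∀ a b, a ≤ b → e a = e b) (hs : ∀ (g : G) a, e (g • a) = e a)
    (hN : ∀ a, X.rank a < 4 * e a + 8) (n : ℤ) : S.IsColim n X := by
  refine isColim_of_isDisjointUnion (X.isDisjointUnion_incl (fun a => ULift.up.{u} (e a))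
    (fun a b h => congrArg _ (he a b h)) fun g a => congrArg _ (hs g a)) fun i => ?_
  refine isColim_of_rank_lt hP hO (4 * i.down + 8) _
    (hX.of_hom hP (X.incl (fun a => ULift.up.{u} (e a) = i) _)) (fun a => ?_) n
  have h := hN a.1
  rwa [show e a.1 = i.down from congrArg ULift.down a.2] at h

/-- A directed system which has the colimit property for orbits has it for telescopes. -/
theorem isColim_telescope (hP : ∀ L M, L ≤ M → P M → P L)
    (hO : ∀ L, P L → ∀ n, S.IsColim n (orbit L)) {X : GPoset G} (hX : X.HasIsotropy P) (n : ℤ) :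
    S.IsColim n X.telescope := by
  have hT := hX.of_hom hP X.telescopeMap
  have hrank : ∀ a : X.TelescopeElement, X.telescope.rank a ≤ a.level + 1 := fun a =>
    add_le_add a.rank_le (Nat.lt_succ_iff.1 (Nat.mod_lt _ two_pos))
  -- Removing the levels `1 mod 4` from the fence leaves the segments `4j + 2 < 4j + 3 > 4j + 4`, and
  -- removing the levels `3 mod 4` leaves the segments `4j < 4j + 1 > 4j + 2`.  Removing both leaves
  -- the even levels, which are pairwise incomparable.
  let s := X.telescope.coverSquare (fun a => a.level % 4 ≠ 1) (fun a => a.level % 4 ≠ 3)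
    (fun _ _ h => h) (fun _ _ h => h) fun z hz y hzy => by
      have : FenceLE y.level z.level ∨ FenceLE z.level y.level := hzy.imp (·.2) (·.2)
      unfold FenceLE at this
      omega
  have key : ∀ (p : X.TelescopeElement → Prop) hp (e : ℕ → ℕ),
      (∀ a b, p a → p b → FenceLE a.level b.level → e a.level = e b.level) →
      (∀ k, k < 4 * e k + 7) → ∀ n, S.IsColim n (X.telescope.sub p hp) := by
    intro p hp e he hk
    refine isColim_of_index hP hO (hT.of_hom hP (X.telescope.incl p hp)) (fun a => e a.1.level)
      (fun a b h => he _ _ a.2 b.2 h.2) (fun _ _ => rfl) fun a => ?_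
    exact lt_of_le_of_lt (hrank a.1) (Nat.succ_lt_succ (hk _))
  refine isColim_of_square s ?_ ?_ ?_ n
  · refine key _ (fun _ _ h => h) id (fun a b ha hb h => ?_) fun k => by simp only [id]; omega
    unfold FenceLE at h
    simp only [id]
    omega
  · refine key _ (fun _ _ h => h) (· / 4) (fun a b ha hb h => ?_) fun k => by omega
    unfold FenceLE at h
    omega
  · refine key _ (fun _ _ h => h) (fun k => (k + 2) / 4) (fun a b ha hb h => ?_) fun k => by omega
    unfold FenceLE at h
    omega

end TheorySystem


/-! ### Restriction and products of `G`-posets -/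

namespace GPoset

variable {K G : Type u} [Group K] [Group G]

/-- Restriction of the action along a homomorphism. -/
def res (α : K →* G) : GPoset G ⥤ GPoset K where
  obj X :=
    { carrier := X.carrier
      action := MulAction.compHom X.carrier α
      smul_le := fun k _ _ h => X.smul_le (α k) h
      rank := X.rank
      rank_strictMono := X.rank_strictMono
      rank_smul := fun k a => X.rank_smul (α k) a }
  map f := ⟨f.toOrderHom, fun k a => f.map_smul (α k) a⟩

/-- The product `Y × X` as a functor of `X`. -/
def prod (Y : GPoset G) : GPoset G ⥤ GPoset G where
  obj X :=
    { carrier := Y.carrier × X.carrier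
      smul_le := fun g _ _ h => And.intro (Y.smul_le g h.1) (X.smul_le g h.2)
      rank := fun p => Y.rank p.1 + X.rank p.2
      rank_strictMono := fun p q h => by
        rcases Prod.lt_iff.1 h with ⟨h1, h2⟩ | ⟨h1, h2⟩
        · exact add_lt_add_of_lt_of_le (Y.rank_strictMono h1) (X.rank_strictMono.monotone h2)
        · exact add_lt_add_of_le_of_lt (Y.rank_strictMono.monotone h1) (X.rank_strictMono h2)
      rank_smul := fun g p => congrArg₂ (· + ·) (Y.rank_smul g p.1) (X.rank_smul g p.2) }
  map f :=
    { toFun := fun p => (p.1, fn f p.2)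
      monotone' := fun _ _ h => ⟨h.1, fn_mono f h.2⟩
      map_smul := fun g p => Prod.ext rfl (fn_smul f g p.2) }

theorem isExactFunctor_id : IsExactFunctor (𝟭 (GPoset G)) where
  map_le _ _ h := h
  isEmbedding _ h := h
  mem_range s := s.mem_range
  inj s := s.inj
  lift s := s.lift
  reflect s := s.reflect
  isDisjointUnion _ h := h

theorem isExactFunctor_res (α : K →* G) : IsExactFunctor (res α) where
  map_le _ _ h := h
  isEmbedding _ h := h
  mem_range s := s.mem_range
  inj s := s.inj
  lift s := s.lift
  reflect s := s.reflect
  isDisjointUnion _ h := ⟨h.isEmbedding, h.exists_eq, h.index_eq⟩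

theorem isExactFunctor_prod (Y : GPoset G) : IsExactFunctor (prod Y) where
  map_le _ _ h a := ⟨le_rfl, h a.2⟩
  isEmbedding _ h _ _ hab := ⟨hab.1, h _ _ hab.2⟩
  mem_range s c := by
    rintro ⟨b, hb⟩
    obtain ⟨a, ha⟩ := s.mem_range c.2 ⟨b.2, congrArg Prod.snd hb⟩
    exact ⟨(c.1, a), Prod.ext rfl ha⟩
  inj s z z' hz e := by
    refine Prod.ext (Prod.mk.inj e).1 (s.inj z.2 z'.2 ?_ (Prod.mk.inj e).2)
    rintro ⟨b, hb⟩
    exact hz ⟨(z.1, b), Prod.ext rfl hb⟩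
  lift s x hx y hxy := by
    have hx' : x.2 ∉ Set.range (fn s.j) := by
      rintro ⟨b, hb⟩
      exact hx ⟨(x.1, b), Prod.ext rfl hb⟩
    obtain ⟨z, c, rfl', hc, hzc⟩ := s.lift x.2 hx' y.2 (hxy.imp (·.2) (·.2))
    refine ⟨(x.1, z), (y.1, c), Prod.ext rfl rfl', Prod.ext rfl hc, ?_⟩
    rw [← rfl'] at hx'
    refine hxy.imp (fun h => ⟨h.1, ?_⟩) fun h => ⟨h.1, ?_⟩
    · exact s.reflect z hx' c z hzc (Or.inl le_rfl) (by rw [hc, rfl']; exact h.2)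
    · exact s.reflect z hx' z c (Or.inl le_rfl) hzc (by rw [hc, rfl']; exact h.2)
  reflect s z hz c c' hc hc' h := by
    refine ⟨h.1, s.reflect z.2 ?_ c.2 c'.2 (hc.imp (·.2) (·.2)) (hc'.imp (·.2) (·.2)) h.2⟩
    rintro ⟨b, hb⟩
    exact hz ⟨(z.1, b), Prod.ext rfl hb⟩
  isDisjointUnion j hj :=
    { isEmbedding := fun i _ _ h => ⟨h.1, hj.isEmbedding i _ _ h.2⟩
      exists_eq := fun a => by
        obtain ⟨i, b, hb⟩ := hj.exists_eq a.2
        exact ⟨i, (a.1, b), Prod.ext rfl hb⟩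
      index_eq := fun i k a b h => hj.index_eq i k a.2 b.2 h.2 }

end GPoset

/-! ### Homology of semi-equivariant maps -/

/-- A map of pairs which is equivariant along a group homomorphism. -/
structure SemiMap {K G : Type u} [Group K] [Group G] (α : K →* G) (P : GCWPair K) (Q : GCWPair G)
    where
  toFun : P.carrier → Q.carrier
  continuous_toFun : Continuous toFun
  map_smul : ∀ k p, toFun (k • p) = α k • toFun p
  mapsTo : Set.MapsTo toFun P.sub Q.sub

namespace SemiMap

variable {K G : Type u} [Group K] [Group G] {α : K →* G} {P : GCWPair K} {Q : GCWPair G}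

/-- The equivariant map `α_* P → Q` corresponding to a semi-equivariant map `P → Q`. -/
def adj (e : SemiMap α P Q) : P.induced α ⟶ Q where
  toFun := Induced.lift (fun g p => g • e.toFun p) fun g k p => by rw [e.map_smul, mul_smul]
  continuous_toFun := Induced.continuous_lift _ _ fun g =>
    (continuous_const_smul g).comp e.continuous_toFun
  map_smul g := Induced.ind fun g' p => mul_smul g g' (e.toFun p)
  mapsTo := by
    rintro _ ⟨g, p, hp, rfl⟩
    exact Q.smul_mem_sub g (e.mapsTo hp)

/-- The restriction to the subcomplexes. -/
def sub (e : SemiMap α P Q) : SemiMap α P.subcomplex.toPair Q.subcomplex.toPair where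
  toFun p := ⟨e.toFun p.1, e.mapsTo p.2⟩
  continuous_toFun := (e.continuous_toFun.comp continuous_subtype_val).subtype_mk _
  map_smul k p := Subtype.ext (e.map_smul k p.1)
  mapsTo _ h := h.elim

/-- The semi-equivariant map of order complexes. -/
noncomputable def ofHom {X : GPoset K} {Y : GPoset G} (m : X ⟶ (GPoset.res α).obj Y) :
    SemiMap α ((GPoset.real K).obj X) ((GPoset.real G).obj Y) where
  toFun := GPoset.realFun m
  continuous_toFun := OrderComplex.continuous_map m.toOrderHom
  map_smul k p := GPoset.realFun_smul m k p
  mapsTo _ h := h.elim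

theorem ofHom_comm {A X : GPoset K} {A' X' : GPoset G} {i : A ⟶ X} {i' : A' ⟶ X'}
    {mA : A ⟶ (GPoset.res α).obj A'} {mX : X ⟶ (GPoset.res α).obj X'}
    (h : i ≫ mX = mA ≫ (GPoset.res α).map i') (p : OrderComplex A.carrier) :
    (ofHom mX).toFun (GPoset.realFun i p) = GPoset.realFun i' ((ofHom mA).toFun p) := by
  have := congrArg (fun f => (GPoset.real K).map f) h
  simp only [Functor.map_comp] at this
  exact congrFun (congrArg GCWPair.Hom.toFun this) p

/-- The semi-equivariant map of pairs given by a commutative square. -/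
noncomputable def ofSquare {A X : GPoset K} {A' X' : GPoset G} {i : A ⟶ X} {i' : A' ⟶ X'}
    (hi : GPoset.IsEmbedding i) (hi' : GPoset.IsEmbedding i') {mA : A ⟶ (GPoset.res α).obj A'}
    {mX : X ⟶ (GPoset.res α).obj X'} (h : i ≫ mX = mA ≫ (GPoset.res α).map i') :
    SemiMap α (GPoset.pair i hi) (GPoset.pair i' hi') where
  toFun := (ofHom mX).toFun
  continuous_toFun := (ofHom mX).continuous_toFun
  map_smul := (ofHom mX).map_smul
  mapsTo := by
    rintro _ ⟨p, rfl⟩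
    exact ⟨(ofHom mA).toFun p, (ofHom_comm h p).symm⟩

/-- The map on total spaces. -/
def total (e : SemiMap α P Q) : SemiMap α P.total.toPair Q.total.toPair where
  toFun := e.toFun
  continuous_toFun := e.continuous_toFun
  map_smul := e.map_smul
  mapsTo _ h := h.elim

/-- Composition with an equivariant map. -/
def comp {P' : GCWPair K} (e : SemiMap α P Q) (f : P' ⟶ P) : SemiMap α P' Q where
  toFun p := e.toFun (f.toFun p)
  continuous_toFun := e.continuous_toFun.comp f.continuous_toFun
  map_smul k p := by rw [f.map_smul, e.map_smul]
  mapsTo _ h := e.mapsTo (f.mapsTo h)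

/-- The inclusion of a fixed point. -/
def ofPoint (q : Q.carrier) (hq : ∀ k, α k • q = q) :
    SemiMap α (GCWComplex.point K).toPair Q where
  toFun _ := q
  continuous_toFun := continuous_const
  map_smul k _ := (hq k).symm
  mapsTo _ h := h.elim

end SemiMap

namespace EquivariantHomologyTheory

variable {Λ : Type v} [Ring Λ] {Γ : Type x} [Group Γ]
  (E : EquivariantHomologyTheory.{u, v, w, x} Λ Γ) {K G L : GroupOver.{u} Γ}

/-- The map in homology induced by a semi-equivariant map. -/
def semi (α : K.Hom G) {P : GCWPair K.carrier} {Q : GCWPair G.carrier}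
    (e : SemiMap α.toMonoidHom P Q) (n : ℤ) :
    ((E.theory K).H n).obj P →ₗ[Λ] ((E.theory G).H n).obj Q :=
  (E.theory G).ap n e.adj ∘ₗ ((E.ind α n).app P).hom

variable {E}

theorem ind_ap (α : K.Hom G) {P P' : GCWPair K.carrier} (f : P' ⟶ P) (n : ℤ)
    (a : ((E.theory K).H n).obj P') :
    ((E.ind α n).app P).hom ((E.theory K).ap n f a) =
      (E.theory G).ap n (GCWPair.inducedMap α.toMonoidHom f) (((E.ind α n).app P').hom a) :=
  congrArg (fun k => k.hom a) ((E.ind α n).naturality f)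

theorem semi_ap (α : K.Hom G) {P P' : GCWPair K.carrier} {Q : GCWPair G.carrier}
    (e : SemiMap α.toMonoidHom P Q) (f : P' ⟶ P) (e' : SemiMap α.toMonoidHom P' Q)
    (h : ∀ p, e'.toFun p = e.toFun (f.toFun p)) (n : ℤ) (a : ((E.theory K).H n).obj P') :
    E.semi α e n ((E.theory K).ap n f a) = E.semi α e' n a := by
  refine (congrArg ((E.theory G).ap n e.adj) (ind_ap α f n a)).trans ?_
  rw [← GHomologyTheory.ap_comp]
  refine congrArg (fun k => (E.theory G).ap n k (((E.ind α n).app P').hom a)) ?_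
  exact GCWPair.hom_ext (Induced.ind fun g p => congrArg (g • ·) (h p).symm)

theorem ap_semi (α : K.Hom G) {P : GCWPair K.carrier} {Q Q' : GCWPair G.carrier}
    (e : SemiMap α.toMonoidHom P Q) (f : Q ⟶ Q') (e' : SemiMap α.toMonoidHom P Q')
    (h : ∀ p, e'.toFun p = f.toFun (e.toFun p)) (n : ℤ) (a : ((E.theory K).H n).obj P) :
    (E.theory G).ap n f (E.semi α e n a) = E.semi α e' n a := by
  refine (GHomologyTheory.ap_comp _ _ _).symm.trans ?_
  refine congrArg (fun k => (E.theory G).ap n k (((E.ind α n).app P).hom a)) ?_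
  refine GCWPair.hom_ext (Induced.ind fun g p => ?_)
  exact (f.map_smul g _).trans (congrArg (g • ·) (h p).symm)

theorem semi_semi (α : K.Hom G) (β : G.Hom L) (γ : K.Hom L)
    (hγ : ∀ k, γ.toMonoidHom k = β.toMonoidHom (α.toMonoidHom k))
    {P : GCWPair K.carrier} {Q : GCWPair G.carrier} {R : GCWPair L.carrier}
    (e : SemiMap α.toMonoidHom P Q) (e' : SemiMap β.toMonoidHom Q R)
    (e'' : SemiMap γ.toMonoidHom P R) (h : ∀ p, e''.toFun p = e'.toFun (e.toFun p)) (n : ℤ)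
    (a : ((E.theory K).H n).obj P) : E.semi β e' n (E.semi α e n a) = E.semi γ e'' n a := by
  obtain rfl : γ = β.comp α := GroupOver.Hom.ext (MonoidHom.ext hγ)
  have h1 : ((E.ind (β.comp α) n).app P).hom a =
      (E.theory L).ap n (P.inducedComp α.toMonoidHom β.toMonoidHom)
        (((E.ind β n).app (P.induced α.toMonoidHom)).hom (((E.ind α n).app P).hom a)) :=
    congrArg (fun k => k.hom a) (E.ind_comp α β n P)
  refine (congrArg ((E.theory L).ap n e'.adj) (ind_ap β e.adj n _)).trans
    (Eq.trans ?_ (congrArg ((E.theory L).ap n e''.adj) h1).symm)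
  rw [← GHomologyTheory.ap_comp, ← GHomologyTheory.ap_comp]
  refine congrArg (fun k => (E.theory L).ap n k (((E.ind β n).app (P.induced α.toMonoidHom)).hom
    (((E.ind α n).app P).hom a))) ?_
  refine GCWPair.hom_ext (Induced.ind fun l => Induced.ind fun g p => ?_)
  change l • e'.toFun (g • e.toFun p) = (l * β.toMonoidHom g) • e''.toFun p
  rw [e'.map_smul, mul_smul, h]

/-- Conjugation with the unit element is the identity, so that the axiom on conjugations shows that
semi-equivariant maps along the identity induce the same map as in the `G`-homology theory. -/
theorem semi_of_eq_id (α : G.Hom G) (hα : ∀ g, α.toMonoidHom g = g) {P Q : GCWPair G.carrier}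
    (e : SemiMap α.toMonoidHom P Q) (f : P ⟶ Q) (h : ∀ p, e.toFun p = f.toFun p) (n : ℤ)
    (a : ((E.theory G).H n).obj P) : E.semi α e n a = (E.theory G).ap n f a := by
  obtain rfl : α = GroupOver.Hom.conj G 1 (map_one _) :=
    GroupOver.Hom.ext (MonoidHom.ext fun g => by simp [hα])
  have h1 : ((E.ind (GroupOver.Hom.conj G 1 (map_one _)) n).app P).hom a =
      (E.theory G).ap n (P.toInducedConj 1) a :=
    congrArg (fun k => k.hom a) (E.ind_conj G 1 (map_one _) n P)
  refine (congrArg ((E.theory G).ap n e.adj) h1).trans ?_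
  rw [← GHomologyTheory.ap_comp]
  refine congrArg (fun k => (E.theory G).ap n k a) (GCWPair.hom_ext fun p => ?_)
  change (1 : G.carrier) • e.toFun ((1 : G.carrier)⁻¹ • p) = _
  rw [inv_one, one_smul, one_smul, h]

theorem bd_semi (α : K.Hom G) {P : GCWPair K.carrier} {Q : GCWPair G.carrier}
    (e : SemiMap α.toMonoidHom P Q) (n : ℤ) (a : ((E.theory K).H (n + 1)).obj P) :
    (E.theory G).bd n Q (E.semi α e (n + 1) a) = E.semi α e.sub n ((E.theory K).bd n P a) := by
  refine (GHomologyTheory.bd_ap e.adj _).trans ?_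
  have h1 : (E.theory G).bd n (P.induced α.toMonoidHom) (((E.ind α (n + 1)).app P).hom a) =
      (E.theory G).ap n (P.inducedSub α.toMonoidHom)
        (((E.ind α n).app P.subcomplex.toPair).hom ((E.theory K).bd n P a)) :=
    congrArg (fun k => k.hom a) (E.ind_bdry α n P)
  rw [h1, ← GHomologyTheory.ap_comp]
  refine congrArg (fun k => (E.theory G).ap n k
    (((E.ind α n).app P.subcomplex.toPair).hom ((E.theory K).bd n P a))) ?_
  exact GCWPair.hom_ext (Induced.ind fun g p => rfl)

theorem pointMap_eq_semi (α : K.Hom G) (n : ℤ) (a : E.atPoint K n) :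
    (E.pointMap α n).hom a =
      E.semi α (SemiMap.ofPoint (Q := (GCWComplex.point G.carrier).toPair) PUnit.unit
        fun _ => rfl) n a := rfl

/-- Semi-equivariant maps are compatible with the connecting maps of Mayer–Vietoris sequences. -/
theorem semi_connecting (α : K.Hom G) {P Q : GCWPair K.carrier} {P' Q' : GCWPair G.carrier}
    (F : P ⟶ Q) (F' : P' ⟶ Q') (eP : SemiMap α.toMonoidHom P P') (eQ : SemiMap α.toMonoidHom Q Q')
    (h : ∀ p, F'.toFun (eP.toFun p) = eQ.toFun (F.toFun p)) (n : ℤ)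
    (hF : Function.Bijective ((E.theory K).ap (n + 1) F))
    (hF' : Function.Bijective ((E.theory G).ap (n + 1) F'))
    (a : ((E.theory K).H (n + 1)).obj Q.total.toPair) :
    E.semi α eP.sub n ((E.theory K).connecting n hF a) =
      (E.theory G).connecting n hF' (E.semi α eQ.total (n + 1) a) := by
  obtain ⟨y, hy⟩ := hF.2 ((E.theory K).ap (n + 1) Q.inclTotal a)
  rw [GHomologyTheory.connecting_eq hF hy, ← bd_semi]
  refine (GHomologyTheory.connecting_eq hF' ?_).symm
  rw [ap_semi α eP F' (eQ.comp F) (fun p => (h p).symm), ← semi_ap α eQ F (eQ.comp F) (fun p => rfl),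
    hy, semi_ap α eQ Q.inclTotal (eQ.comp Q.inclTotal) (fun p => rfl),
    ap_semi α eQ.total Q'.inclTotal (eQ.comp Q.inclTotal) (fun p => rfl)]

theorem semi_subEquiv (α : K.Hom G) {A X : GPoset K.carrier} {A' X' : GPoset G.carrier} {i : A ⟶ X}
    (hi : GPoset.IsEmbedding i) {i' : A' ⟶ X'} (hi' : GPoset.IsEmbedding i')
    {mA : A ⟶ (GPoset.res α.toMonoidHom).obj A'} {mX : X ⟶ (GPoset.res α.toMonoidHom).obj X'}
    (h : i ≫ mX = mA ≫ (GPoset.res α.toMonoidHom).map i') (n : ℤ)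
    (a : ((E.theory K).H n).obj ((GPoset.real K.carrier).obj A)) :
    E.semi α (SemiMap.ofSquare hi hi' h).sub n (PosetTheory.subEquiv (E.theory K) i hi n a) =
      PosetTheory.subEquiv (E.theory G) i' hi' n (E.semi α (SemiMap.ofHom mA) n a) := by
  rw [PosetTheory.subEquiv_apply, PosetTheory.subEquiv_apply]
  refine (semi_ap α (SemiMap.ofSquare hi hi' h).sub (GPoset.toSub i hi)
    ((SemiMap.ofSquare hi hi' h).sub.comp (GPoset.toSub i hi)) (fun p => rfl) n a).trans ?_
  refine (ap_semi α (SemiMap.ofHom mA) (GPoset.toSub i' hi') _ (fun p => ?_) n a).symm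
  exact Subtype.ext (SemiMap.ofHom_comm h p)

/-- Semi-equivariant maps are compatible with the connecting maps of pushout squares. -/
theorem semi_δ (α : K.Hom G) (s : GPoset.PushoutSquare K.carrier) (s' : GPoset.PushoutSquare G.carrier)
    (mA : s.A ⟶ (GPoset.res α.toMonoidHom).obj s'.A) (mB : s.B ⟶ (GPoset.res α.toMonoidHom).obj s'.B)
    (mC : s.C ⟶ (GPoset.res α.toMonoidHom).obj s'.C) (mX : s.X ⟶ (GPoset.res α.toMonoidHom).obj s'.X)
    (hi : s.i ≫ mC = mA ≫ (GPoset.res α.toMonoidHom).map s'.i)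
    (hF : s.F ≫ mX = mC ≫ (GPoset.res α.toMonoidHom).map s'.F)
    (hj : s.j ≫ mX = mB ≫ (GPoset.res α.toMonoidHom).map s'.j) (n : ℤ)
    (a : ((PosetTheory.ofTheory (E.theory K)).H (n + 1)).obj s.X) :
    E.semi α (SemiMap.ofHom mA) n ((PosetTheory.ofTheory (E.theory K)).δ s n a) =
      (PosetTheory.ofTheory (E.theory G)).δ s' n (E.semi α (SemiMap.ofHom mX) (n + 1) a) := by
  refine (LinearEquiv.eq_symm_apply _).2 ?_
  refine (semi_subEquiv α s.isEmbedding_i s'.isEmbedding_i hi n _).symm.trans ?_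
  have h1 := (PosetTheory.subEquiv (E.theory K) s.i s.isEmbedding_i n).apply_symm_apply
    ((E.theory K).connecting n (PosetTheory.bijective_ap_toPairMap (E.theory K) s (n + 1)) a)
  refine (congrArg (E.semi α (SemiMap.ofSquare s.isEmbedding_i s'.isEmbedding_i hi).sub n) h1).trans ?_
  exact semi_connecting α s.toPairMap s'.toPairMap
    (SemiMap.ofSquare s.isEmbedding_i s'.isEmbedding_i hi)
    (SemiMap.ofSquare s.isEmbedding_j s'.isEmbedding_j hj)
    (fun p => (SemiMap.ofHom_comm hF p).symm) n _ _ a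

end EquivariantHomologyTheory


open GPoset

/-! ### Transformations and orbits -/

/-- A transformation as a directed system over a single index. -/
def TheorySystem.single {Λ : Type v} [Ring Λ] {G : Type u} [Group G]
    {T' T : PosetTheory.{u, v, w} Λ G} (τ : T'.Trans T) : TheorySystem T where
  I := PUnit
  obj _ := T'
  map _ _ _ := ⟨fun _ _ => LinearMap.id, fun _ _ => rfl, fun _ _ _ => rfl⟩
  map_map _ _ _ _ _ _ _ _ := rfl
  toT _ := τ
  toT_map _ _ _ _ _ _ := rfl

theorem TheorySystem.isColim_single {Λ : Type v} [Ring Λ] {G : Type u} [Group G]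
    {T' T : PosetTheory.{u, v, w} Λ G} (τ : T'.Trans T) {n : ℤ} {X : GPoset G} :
    (TheorySystem.single τ).IsColim n X ↔ Function.Bijective (τ.app n X) := by
  constructor
  · intro h
    refine ⟨(injective_iff_map_eq_zero _).2 fun x hx => ?_, fun y => ?_⟩
    · obtain ⟨_, _, e⟩ := h.2 PUnit.unit x hx
      exact e
    · obtain ⟨_, x, e⟩ := h.1 y
      exact ⟨x, e⟩
  · exact fun h => ⟨fun y => ⟨PUnit.unit, h.2 y⟩, fun _ x hx =>
      ⟨PUnit.unit, le_rfl, (injective_iff_map_eq_zero _).1 h.1 x hx⟩⟩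

/-- The order complex of a discrete poset is discrete. -/
theorem GPoset.isClosed_of_discrete {G : Type u} [Group G] {O : GPoset G}
    (hO : ∀ a b : O.carrier, a ≤ b → a = b) (T : Set (OrderComplex O.carrier)) : IsClosed T := by
  refine isClosed_iff_simplex.2 fun n c => ?_
  have hn : Subsingleton (Fin n) := ⟨fun i j => by
    rcases lt_trichotomy i j with h | h | h
    · exact absurd (hO _ _ (c.2 h).le) (c.2 h).ne
    · exact h
    · exact absurd (hO _ _ (c.2 h).le) (c.2 h).ne⟩
  have : Subsingleton (stdSimplex ℝ (Fin n)) := ⟨fun p q => Subtype.ext (funext fun i => by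
    have hp := p.2.2
    have hq := q.2.2
    rw [Fintype.sum_subsingleton _ i] at hp hq
    exact hp.trans hq.symm)⟩
  exact (Set.toFinite _).isClosed

theorem GPoset.exists_eq_vertex {G : Type u} [Group G] {O : GPoset G}
    (hO : ∀ a b : O.carrier, a ≤ b → a = b) (x : OrderComplex O.carrier) :
    ∃ a, x = OrderComplex.vertex a := by
  obtain ⟨a, ha⟩ := x.support_nonempty
  refine ⟨a, OrderComplex.eq_vertex fun b hb => ?_⟩
  rcases x.2.2.2.total hb ha with h | h
  · exact hO _ _ h
  · exact (hO _ _ h).symm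

theorem GPoset.smul_vertex {G : Type u} [Group G] {O : GPoset G} (g : G) (a : O.carrier) :
    g • OrderComplex.vertex a = OrderComplex.vertex (g • a) := by
  refine OrderComplex.eq_vertex fun b hb => ?_
  rw [← smul_inv_smul g b, mem_support_smul, OrderComplex.vertex_val] at hb
  have := Finsupp.support_single_subset hb
  rw [Finset.mem_singleton] at this
  rw [← this, smul_inv_smul]

theorem OrderComplex.vertex_injective {X : Type u} [PartialOrder X] :
    Function.Injective (OrderComplex.vertex (X := X)) := by
  intro a b h
  have := congrArg Subtype.val h
  rw [OrderComplex.vertex_val, OrderComplex.vertex_val] at this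
  exact Finsupp.single_left_injective one_ne_zero this

theorem GPoset.realFun_vertex {G : Type u} [Group G] {X Y : GPoset G} (f : X ⟶ Y) (a : X.carrier) :
    realFun f (OrderComplex.vertex a) = OrderComplex.vertex (fn f a) := by
  refine OrderComplex.eq_vertex fun b hb => ?_
  obtain ⟨c, hc, rfl⟩ := (PushoutSquare.mem_support_realFun f _).1 hb
  rw [OrderComplex.vertex_val] at hc
  rw [Finset.mem_singleton.1 (Finsupp.support_single_subset hc)]

namespace EquivariantHomologyTheory

variable {Λ : Type v} [Ring Λ] {Γ : Type x} [Group Γ]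
  {E : EquivariantHomologyTheory.{u, v, w, x} Λ Γ} {K G : GroupOver.{u} Γ}

variable (E) in
/-- The transformation induced by a natural family of semi-equivariant maps. -/
noncomputable def trans (α : K.Hom G) {L : Type u} [Group L] {Φ : GPoset L ⥤ GPoset K.carrier}
    {Ψ : GPoset L ⥤ GPoset G.carrier} (hΦ : IsExactFunctor Φ) (hΨ : IsExactFunctor Ψ)
    (m : Φ ⟶ Ψ ⋙ res α.toMonoidHom) :
    (hΦ.theory (PosetTheory.ofTheory (E.theory K))).Trans
      (hΨ.theory (PosetTheory.ofTheory (E.theory G))) where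
  app n X := E.semi α (SemiMap.ofHom (Y := Ψ.obj X) (m.app X)) n
  app_ap {n X Y} f a := by
    refine (semi_ap α (SemiMap.ofHom (Y := Ψ.obj Y) (m.app Y)) ((real K.carrier).map (Φ.map f))
      ((SemiMap.ofHom (Y := Ψ.obj Y) (m.app Y)).comp ((real K.carrier).map (Φ.map f)))
      (fun _ => rfl) n a).trans ?_
    refine (ap_semi α (SemiMap.ofHom (Y := Ψ.obj X) (m.app X)) ((real G.carrier).map (Ψ.map f)) _
      (fun p => ?_) n a).symm
    exact SemiMap.ofHom_comm (m.naturality f) p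
  app_δ s n a := semi_δ α (hΦ.square s) (hΨ.square s) (m.app s.A) (m.app s.B) (m.app s.C)
    (m.app s.X) (m.naturality s.i) (m.naturality s.F) (m.naturality s.j) n a

/-- The homology of an orbit is the homology of a point for the isotropy group. -/
theorem bijective_semi_vertex (α : K.Hom G) (hα : Function.Injective α.toMonoidHom)
    {O : GPoset G.carrier} (hO : ∀ a b : O.carrier, a ≤ b → a = b) (e : O.carrier)
    (he : ∀ a : O.carrier, ∃ g : G.carrier, g • e = a)
    (hs : ∀ g : G.carrier, g • e = e → ∃ k, α.toMonoidHom k = g)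
    (hq : ∀ k, α.toMonoidHom k • (OrderComplex.vertex e) = OrderComplex.vertex e) (n : ℤ) :
    Function.Bijective (E.semi α (SemiMap.ofPoint (Q := (real G.carrier).obj O)
      (OrderComplex.vertex e) hq) n) := by
  set q : SemiMap α.toMonoidHom (GCWComplex.point K.carrier).toPair ((real G.carrier).obj O) :=
    SemiMap.ofPoint (OrderComplex.vertex e) hq
  have hval : ∀ g p, q.adj.toFun (Induced.mk α.toMonoidHom g p) = OrderComplex.vertex (g • e) :=
    fun g p => smul_vertex g e
  have hiso : IsIso q.adj := by
    refine GCWPair.isIso_of_isClosedMap _ ⟨?_, fun x => ?_⟩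
      (fun T _ => isClosed_of_discrete hO _) fun _ h => h.elim
    · refine Induced.ind fun g p => Induced.ind fun g' p' h => ?_
      rw [hval, hval] at h
      have h := OrderComplex.vertex_injective h
      obtain ⟨k, hk⟩ := hs (g⁻¹ * g') (by rw [mul_smul, ← h, inv_smul_smul])
      exact Induced.mk_eq_mk.2 ⟨k, by rw [hk, mul_inv_cancel_left], rfl⟩
    · obtain ⟨a, rfl⟩ := exists_eq_vertex hO x
      obtain ⟨g, rfl⟩ := he a
      exact ⟨Induced.mk α.toMonoidHom g PUnit.unit, hval g _⟩
  have h1 : Function.Bijective ((E.theory G).ap n q.adj) :=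
    ConcreteCategory.bijective_of_isIso (((E.theory G).H n).map q.adj)
  exact h1.comp (E.ind_bijective α hα n)

/-! ### Colimits of the homology of a point -/

/-- The colimit property for the homology of a point, in terms of elements. -/
def PointColim (E : EquivariantHomologyTheory.{u, v, w, x} Λ Γ)
    (D : DirectedCocone G.carrier) : Prop :=
  ∀ n, (∀ y : E.atPoint G n, ∃ i, ∃ x : E.atPoint (stage D i) n,
      (E.pointMap (stageToG D i) n).hom x = y) ∧
    ∀ i, ∀ x : E.atPoint (stage D i) n, (E.pointMap (stageToG D i) n).hom x = 0 →
      ∃ j, ∃ hij : i ≤ j, (E.pointMap (stageMap D i j hij) n).hom x = 0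

theorem pointMap_of_eq_id (α : G.Hom G) (hα : ∀ g, α.toMonoidHom g = g) (n : ℤ)
    (a : E.atPoint G n) : (E.pointMap α n).hom a = a := by
  rw [pointMap_eq_semi, semi_of_eq_id α hα _ (𝟙 _) fun _ => rfl]
  exact GHomologyTheory.ap_id a

theorem pointMap_pointMap {L : GroupOver.{u} Γ} (α : K.Hom G) (β : G.Hom L) (γ : K.Hom L)
    (hγ : ∀ k, γ.toMonoidHom k = β.toMonoidHom (α.toMonoidHom k)) (n : ℤ) (a : E.atPoint K n) :
    (E.pointMap β n).hom ((E.pointMap α n).hom a) = (E.pointMap γ n).hom a := by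
  obtain rfl : γ = β.comp α := GroupOver.Hom.ext (MonoidHom.ext hγ)
  exact congrArg (fun k => k.hom a) (E.pointMap_comp α β n)

open Classical in
theorem colimMap_of (D : DirectedCocone G.carrier) (n : ℤ) (i : D.I) (x : E.atPoint (stage D i) n) :
    E.colimMap D n (Module.DirectLimit.of Λ D.I (fun i => E.atPoint (stage D i) n)
      (fun i j hij => (E.pointMap (stageMap D i j hij) n).hom) i x) =
      (E.pointMap (stageToG D i) n).hom x := by
  rw [colimMap]
  exact Module.DirectLimit.lift_of _ _ _

theorem pointColim_of_bijective (D : DirectedCocone G.carrier)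
    (h : ∀ n, Function.Bijective (E.colimMap D n)) : E.PointColim D := by
  classical
  intro n
  have : DirectedSystem (fun i => E.atPoint (stage D i) n)
      (fun i j hij => (E.pointMap (stageMap D i j hij) n).hom) :=
    { map_self := fun i x => pointMap_of_eq_id (stageMap D i i le_rfl)
        (fun g => DFunLike.congr_fun (D.map_self i) g) n x
      map_map := fun k j i hij hjk x => pointMap_pointMap (stageMap D i j hij) (stageMap D j k hjk)
        (stageMap D i k (hij.trans hjk))
        (fun g => (DFunLike.congr_fun (D.map_map i j k hij hjk) g).symm) n x }
  constructor
  · intro y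
    obtain ⟨z, rfl⟩ := (h n).2 y
    obtain ⟨i, x, rfl⟩ := Module.DirectLimit.exists_of z
    exact ⟨i, x, (colimMap_of D n i x).symm⟩
  · intro i x hx
    refine Module.DirectLimit.of.zero_exact (R := Λ) (G := fun i => E.atPoint (stage D i) n)
      (f := fun i j hij => (E.pointMap (stageMap D i j hij) n).hom) ((h n).1 ?_)
    rw [map_zero]
    exact (colimMap_of D n i x).trans hx

end EquivariantHomologyTheory

/-- The restriction of a directed system to a subgroup of its target. -/
abbrev DirectedCocone.restrict {G : Type u} [Group G] (D : DirectedCocone G) (L : Subgroup G) :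
    DirectedCocone L where
  I := D.I
  obj i := L.comap (D.toG i)
  map i j hij := ((D.map i j hij).comp (L.comap (D.toG i)).subtype).codRestrict _ fun k => by
    change D.toG j (D.map i j hij k.1) ∈ L
    rw [← MonoidHom.comp_apply, D.toG_map]
    exact k.2
  map_self i := by
    ext k
    exact DFunLike.congr_fun (D.map_self i) k.1
  map_map i j k hij hjk := by
    ext l
    exact DFunLike.congr_fun (D.map_map i j k hij hjk) l.1
  toG i := ((D.toG i).comp (L.comap (D.toG i)).subtype).codRestrict _ fun k => k.2
  toG_map i j hij := by
    ext k
    exact DFunLike.congr_fun (D.toG_map i j hij) k.1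

namespace EquivariantHomologyTheory

variable {Λ : Type v} [Ring Λ] {Γ : Type x} [Group Γ]
  {E : EquivariantHomologyTheory.{u, v, w, x} Λ Γ} {K G : GroupOver.{u} Γ}

/-- A subgroup as a group over `Γ`. -/
abbrev subgroupOver (G : GroupOver.{u} Γ) (L : Subgroup G.carrier) : GroupOver.{u} Γ :=
  G.pull L.subtype

/-- The inclusion of a subgroup as a morphism over `Γ`. -/
abbrev subgroupHom (G : GroupOver.{u} Γ) (L : Subgroup G.carrier) : (subgroupOver G L).Hom G :=
  ⟨L.subtype, rfl⟩

theorem trans_app_trans {L : GroupOver.{u} Γ} (α : K.Hom G) (β : G.Hom L) (γ : K.Hom L)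
    (hγ : ∀ k, γ.toMonoidHom k = β.toMonoidHom (α.toMonoidHom k)) {M : Type u} [Group M]
    {Φ : GPoset M ⥤ GPoset K.carrier} {Ψ : GPoset M ⥤ GPoset G.carrier}
    {Ω : GPoset M ⥤ GPoset L.carrier} (hΦ : IsExactFunctor Φ) (hΨ : IsExactFunctor Ψ)
    (hΩ : IsExactFunctor Ω) (m : Φ ⟶ Ψ ⋙ res α.toMonoidHom) (m' : Ψ ⟶ Ω ⋙ res β.toMonoidHom)
    (m'' : Φ ⟶ Ω ⋙ res γ.toMonoidHom)
    (h : ∀ X (a : (Φ.obj X).carrier), fn (m''.app X) a = fn (X := Ψ.obj X) (m'.app X)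
      (fn (X := Φ.obj X) (Y := (Ψ ⋙ res α.toMonoidHom).obj X) (m.app X) a)) (n : ℤ) (X : GPoset M)
    (x : ((PosetTheory.ofTheory (E.theory K)).H n).obj (Φ.obj X)) :
    (E.trans β hΨ hΩ m').app n X ((E.trans α hΦ hΨ m).app n X x) =
      (E.trans γ hΦ hΩ m'').app n X x := by
  refine semi_semi α β γ hγ (SemiMap.ofHom (Y := Ψ.obj X) (m.app X))
    (SemiMap.ofHom (Y := Ω.obj X) (m'.app X)) (SemiMap.ofHom (Y := Ω.obj X) (m''.app X))
    (fun p => ?_) n x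
  refine Eq.trans ?_ (OrderComplex.map_map (m.app X).toOrderHom (m'.app X).toOrderHom p).symm
  exact congrArg (fun f => OrderComplex.map f p) (OrderHom.ext _ _ (funext (h X)))

/-- The identification of the restriction along a composite. -/
def resComp {K L M : Type u} [Group K] [Group L] [Group M] (α : K →* L) (β : L →* M) (γ : K →* M)
    (h : ∀ k, γ k = β (α k)) : res γ ⟶ res β ⋙ res α where
  app X := ⟨OrderHom.id, fun k a => congrArg (· • (show X.carrier from a)) (h k)⟩

/-- The restriction along a homomorphism, as a natural transformation. -/
def resId {K G : Type u} [Group K] [Group G] (α : K →* G) : res α ⟶ 𝟭 (GPoset G) ⋙ res α where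
  app X := ⟨OrderHom.id, fun _ _ => rfl⟩

variable (E) in
/-- The directed system of theories `X ↦ H^{G_i}(res X)` over `X ↦ H^G(X)`. -/
noncomputable abbrev resSystem (D : DirectedCocone G.carrier) :
    TheorySystem (isExactFunctor_id.theory (PosetTheory.ofTheory (E.theory G))) where
  I := D.I
  obj i := (isExactFunctor_res (D.toG i)).theory (PosetTheory.ofTheory (E.theory (stage D i)))
  map i j hij := E.trans (stageMap D i j hij) (isExactFunctor_res (D.toG i))
    (isExactFunctor_res (D.toG j))
    (resComp _ _ _ fun g => (DFunLike.congr_fun (D.toG_map i j hij) g).symm)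
  map_map i j k hij hjk n X x := trans_app_trans (stageMap D i j hij) (stageMap D j k hjk)
    (stageMap D i k (hij.trans hjk))
    (fun g => (DFunLike.congr_fun (D.map_map i j k hij hjk) g).symm) _ _ _ _ _ _
    (fun _ _ => rfl) n X x
  toT i := E.trans (stageToG D i) (isExactFunctor_res (D.toG i)) isExactFunctor_id (resId _)
  toT_map i j hij n X x := trans_app_trans (stageMap D i j hij) (stageToG D j) (stageToG D i)
    (fun g => (DFunLike.congr_fun (D.toG_map i j hij) g).symm) _ _ _ _ _ _
    (fun _ _ => rfl) n X x

end EquivariantHomologyTheory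


open GPoset

namespace EquivariantHomologyTheory

variable {Λ : Type v} [Ring Λ] {Γ : Type x} [Group Γ]
  {E : EquivariantHomologyTheory.{u, v, w, x} Λ Γ} {K G : GroupOver.{u} Γ}

theorem semi_pointMap {H : GroupOver.{u} Γ} (α : H.Hom K) (β : K.Hom G) (γ : H.Hom G)
    (hγ : ∀ k, γ.toMonoidHom k = β.toMonoidHom (α.toMonoidHom k)) {Q : GCWPair G.carrier}
    (q : Q.carrier) (hβ : ∀ k, β.toMonoidHom k • q = q) (hγq : ∀ k, γ.toMonoidHom k • q = q) (n : ℤ)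
    (z : E.atPoint H n) :
    E.semi β (SemiMap.ofPoint q hβ) n ((E.pointMap α n).hom z) =
      E.semi γ (SemiMap.ofPoint q hγq) n z :=
  semi_semi α β γ hγ (SemiMap.ofPoint PUnit.unit fun _ => rfl) (SemiMap.ofPoint q hβ)
    (SemiMap.ofPoint q hγq) (fun _ => rfl) n z

/-! ### The colimit property for orbits -/

section Orbit

variable (D : DirectedCocone G.carrier) (L : Subgroup G.carrier)

/-- The base point of an orbit. -/
abbrev base {G : Type u} [Group G] (L : Subgroup G) : (orbit L).carrier :=
  ((1 : G) : G ⧸ L)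

theorem smul_base {G : Type u} [Group G] (L : Subgroup G) (g : G) :
    g • base L = (g : G ⧸ L) := congrArg (fun t : G => (t : G ⧸ L)) (mul_one g)

theorem smul_base_eq_iff {G : Type u} [Group G] (L : Subgroup G) (g : G) :
    g • base L = base L ↔ g ∈ L := by
  rw [smul_base]
  refine QuotientGroup.eq.trans ?_
  simp

/-- The inclusion of the stage of a restricted system. -/
abbrev restrictHom (i : D.I) :
    (stage (G := subgroupOver G L) (D.restrict L) i).Hom (stage D i) :=
  ⟨(L.comap (D.toG i)).subtype, rfl⟩

theorem smul_vertex_base (i : D.I) (k : L.comap (D.toG i)) :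
    D.toG i k • OrderComplex.vertex (base L) = OrderComplex.vertex (base L) := by
  rw [smul_vertex, (smul_base_eq_iff L _).2 k.2]

variable (E)

/-- The map `H^{L_i}(pt) → H^{G_i}(res G/L)` given by the base point. -/
noncomputable def fromStage (i : D.I) (n : ℤ) :
    E.atPoint (stage (G := subgroupOver G L) (D.restrict L) i) n →ₗ[Λ]
      ((E.resSystem D).obj i |>.H n).obj (orbit L) :=
  E.semi (restrictHom D L i) (SemiMap.ofPoint
    (Q := (real (stage D i).carrier).obj ((res (D.toG i)).obj (orbit L)))
    (OrderComplex.vertex (base L)) (smul_vertex_base D L i)) n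

/-- The map `H^L(pt) → H^G(G/L)` given by the base point. -/
noncomputable def fromSubgroup (n : ℤ) :
    E.atPoint (subgroupOver G L) n →ₗ[Λ] ((E.theory G).H n).obj ((real G.carrier).obj (orbit L)) :=
  E.semi (subgroupHom G L) (SemiMap.ofPoint (Q := (real G.carrier).obj (orbit L))
    (OrderComplex.vertex (base L)) fun k =>
      (smul_vertex _ _).trans (congrArg _ ((smul_base_eq_iff L _).2 k.2))) n

theorem bijective_fromSubgroup (n : ℤ) : Function.Bijective (E.fromSubgroup L n) := by
  refine bijective_semi_vertex (subgroupHom G L) Subtype.val_injective (fun _ _ h => h) (base L)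
    (fun a => ?_) (fun g hg => ⟨⟨g, (smul_base_eq_iff L g).1 hg⟩, rfl⟩) _ n
  induction a using QuotientGroup.induction_on with
  | H g => exact ⟨g, smul_base L g⟩

theorem toT_fromStage (i : D.I) (n : ℤ) (z) :
    ((E.resSystem D).toT i).app n (orbit L) (E.fromStage D L i n z) =
      E.fromSubgroup L n ((E.pointMap (stageToG (G := subgroupOver G L) (D.restrict L) i) n).hom z) := by
  let γ : (stage (G := subgroupOver G L) (D.restrict L) i).Hom G :=
    ⟨(D.toG i).comp (L.comap (D.toG i)).subtype, rfl⟩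
  let e : SemiMap γ.toMonoidHom (GCWComplex.point (L.comap (D.toG i))).toPair
      ((real G.carrier).obj (orbit L)) :=
    SemiMap.ofPoint (OrderComplex.vertex (base L)) (smul_vertex_base D L i)
  refine (semi_semi (restrictHom D L i) (stageToG D i) γ (fun _ => rfl) _ _ e (fun _ => ?_) n z).trans
    (semi_pointMap (stageToG (G := subgroupOver G L) (D.restrict L) i) (subgroupHom G L) γ
      (fun _ => rfl) _ _ _ n z).symm
  exact (realFun_vertex ((resId (D.toG i)).app (orbit L)) (base L)).symm

theorem map_fromStage (i j : D.I) (hij : i ≤ j) (n : ℤ) (z) :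
    ((E.resSystem D).map i j hij).app n (orbit L) (E.fromStage D L i n z) =
      E.fromStage D L j n
        ((E.pointMap (stageMap (G := subgroupOver G L) (D.restrict L) i j hij) n).hom z) := by
  let γ : (stage (G := subgroupOver G L) (D.restrict L) i).Hom (stage D j) :=
    (restrictHom D L j).comp (stageMap (G := subgroupOver G L) (D.restrict L) i j hij)
  let e : SemiMap γ.toMonoidHom (GCWComplex.point (L.comap (D.toG i))).toPair
      ((real (stage D j).carrier).obj ((res (D.toG j)).obj (orbit L))) :=
    SemiMap.ofPoint (OrderComplex.vertex (base L)) fun k =>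
      smul_vertex_base D L j ((D.restrict L).map i j hij k)
  refine (semi_semi (restrictHom D L i) (stageMap D i j hij) γ (fun _ => rfl) _ _ e
    (fun _ => ?_) n z).trans
    (semi_pointMap (stageMap (G := subgroupOver G L) (D.restrict L) i j hij) (restrictHom D L j) γ
      (fun _ => rfl) _ _ _ n z).symm
  exact (realFun_vertex ((resComp (D.map i j hij) (D.toG j) (D.toG i) fun g =>
    (DFunLike.congr_fun (D.toG_map i j hij) g).symm).app (orbit L)) (base L)).symm

variable {D}

/-- Every element of `H^{G_i}(res G/L)` comes from the orbit of the base point at a later stage: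
the finitely many orbits which matter are merged with it as soon as the elements relating their
representatives to the base point are in the image of `G_j`. -/
theorem exists_fromStage_eq (hD : ∀ g, ∃ i k, D.toG i k = g) (i : D.I) (n : ℤ)
    (a : ((E.resSystem D).obj i |>.H n).obj (orbit L)) :
    ∃ j, ∃ hij : i ≤ j, ∃ z,
      ((E.resSystem D).map i j hij).app n (orbit L) a = E.fromStage D L j n z := by
  classical
  let Y := (res (D.toG i)).obj (orbit L)
  have hY : ∀ a b : Y.carrier, a ≤ b → a = b := fun _ _ h => h
  obtain ⟨t, d, rfl⟩ := (PosetTheory.ofTheory (E.theory (stage D i))).exists_sum _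
    (Y.isDisjointUnion_orbitMap hY) n a
  induction t using Finset.induction_on with
  | empty => exact ⟨i, le_rfl, 0, by
    rw [Finset.sum_empty]
    exact (map_zero _).trans (map_zero _).symm⟩
  | insert o t ho ih =>
    obtain ⟨j₁, h₁, z₁, e₁⟩ := ih
    obtain ⟨g, hg⟩ : ∃ g : G.carrier, g • base L = Quotient.out o := by
      obtain ⟨g, hg⟩ := QuotientGroup.mk_surjective (s := L) (Quotient.out o)
      exact ⟨g, (smul_base L g).trans hg⟩
    obtain ⟨j₂, k, rfl⟩ := hD g
    obtain ⟨j₃, h₃, h₃'⟩ := exists_ge_ge j₂ i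
    obtain ⟨j, hj₁, hj₃⟩ := exists_ge_ge j₁ j₃
    have hij : i ≤ j := h₁.trans hj₁
    let O : GPoset (D.obj j) := ((res (D.toG j)).obj (orbit L)).sub
      (fun b => ∃ h : D.obj j, D.toG j h • base L = b) fun h b => by
        rintro ⟨h', rfl⟩
        exact ⟨h * h', by rw [map_mul, mul_smul]; rfl⟩
    let ι : O ⟶ (res (D.toG j)).obj (orbit L) := ((res (D.toG j)).obj (orbit L)).incl _ _
    let b : O.carrier := ⟨base L, 1, by rw [map_one, one_smul]⟩
    have hfix : ∀ l : L.comap (D.toG j), (restrictHom D L j).toMonoidHom l •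
        OrderComplex.vertex b = OrderComplex.vertex b := fun l => by
      rw [smul_vertex]
      exact congrArg _ (Subtype.ext ((smul_base_eq_iff L _).2 l.2))
    have hbij := bijective_semi_vertex (E := E) (restrictHom D L j) Subtype.val_injective (O := O)
      (fun a b h => Subtype.ext h) b (fun a => by
        obtain ⟨h, hh⟩ := a.2
        exact ⟨h, Subtype.ext hh⟩)
      (fun h hh => ⟨⟨h, (smul_base_eq_iff L _).1 (congrArg Subtype.val hh)⟩, rfl⟩) hfix n
    let f : orbit (MulAction.stabilizer (D.obj i) (Quotient.out o : Y.carrier)) ⟶ Y :=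
      orbitMap (X := Y) (Quotient.out o)
    let f' : (orbit (MulAction.stabilizer (D.obj i) (Quotient.out o : Y.carrier))).carrier →
        (orbit L).carrier := fn f
    have hf : ∀ c, ∃ h : D.obj j, D.toG j h • base L = f' c := fun c => by
      induction c using QuotientGroup.induction_on with
      | H h =>
        refine ⟨D.map i j hij h * D.map j₂ j (h₃.trans hj₃) k, ?_⟩
        rw [map_mul, mul_smul, ← MonoidHom.comp_apply, ← MonoidHom.comp_apply, D.toG_map,
          D.toG_map, hg]
        rfl
    let m : orbit (MulAction.stabilizer (D.obj i) (Quotient.out o : Y.carrier)) ⟶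
        (res (D.map i j hij)).obj O :=
      { toFun := fun c => (⟨f' c, hf c⟩ : O.carrier)
        monotone' := fun c c' h => fn_mono f h
        map_smul := fun h c => Subtype.ext (by
          refine (fn_smul f h c).trans ?_
          change D.toG i h • f' c = D.toG j (D.map i j hij h) • f' c
          rw [← MonoidHom.comp_apply, D.toG_map]) }
    obtain ⟨z, hz⟩ := hbij.2 (E.semi (stageMap D i j hij) (SemiMap.ofHom (Y := O) m) n (d o))
    have key : ((E.resSystem D).map i j hij).app n (orbit L)
        (((PosetTheory.ofTheory (E.theory (stage D i))).H n).map
          (orbitMap (X := Y) (Quotient.out o)) |>.hom (d o)) = E.fromStage D L j n z := by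
      refine (semi_ap (stageMap D i j hij) _ ((real (D.obj i)).map _)
        (SemiMap.comp _ _) (fun _ => rfl) n (d o)).trans ?_
      refine Eq.trans ?_ (ap_semi (restrictHom D L j) (SemiMap.ofPoint (OrderComplex.vertex b) hfix)
        ((real (D.obj j)).map ι) _ (fun _ => (realFun_vertex ι b).symm) n z)
      rw [hz]
      refine (ap_semi (stageMap D i j hij) _ _ _ (fun p => ?_) n (d o)).symm
      refine Eq.trans ?_ (OrderComplex.map_map m.toOrderHom _ p).symm
      refine (OrderComplex.map_map f.toOrderHom _ p).trans ?_
      exact congrArg (fun f => OrderComplex.map f p) (OrderHom.ext _ _ rfl)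
    refine ⟨j, hij, z + (E.pointMap (stageMap (G := subgroupOver G L) (D.restrict L) j₁ j hj₁) n).hom
      z₁, ?_⟩
    rw [Finset.sum_insert ho, map_add (E.fromStage D L j n), ← map_fromStage, ← e₁]
    refine (LinearMap.map_add _ _ _).trans ?_
    exact congrArg₂ (· + ·) key ((E.resSystem D).map_map i j₁ j h₁ hj₁ n _ _).symm

/-- The colimit property for a point and the subgroups `L_i → L` gives it for the orbit `G/L`. -/
theorem isColim_orbit (hD : ∀ g, ∃ i k, D.toG i k = g)
    (hL : PointColim (G := subgroupOver G L) E (D.restrict L)) (n : ℤ) :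
    (E.resSystem D).IsColim n (orbit L) := by
  constructor
  · intro y
    obtain ⟨z, rfl⟩ := (E.bijective_fromSubgroup L n).2 y
    obtain ⟨i, z, rfl⟩ := (hL n).1 z
    exact ⟨i, E.fromStage D L i n z, E.toT_fromStage D L i n z⟩
  · intro i x hx
    obtain ⟨j, hij, z, hz⟩ := E.exists_fromStage_eq L hD i n x
    have h0 : (E.pointMap (stageToG (G := subgroupOver G L) (D.restrict L) j) n).hom z = 0 := by
      refine (E.bijective_fromSubgroup L n).1 ?_
      rw [map_zero, ← toT_fromStage, ← hz, (E.resSystem D).toT_map]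
      exact hx
    obtain ⟨k, hjk, e⟩ := (hL n).2 j z h0
    refine ⟨k, hij.trans hjk, ?_⟩
    rw [← (E.resSystem D).map_map i j k hij hjk, hz, map_fromStage, e, map_zero]

end Orbit

end EquivariantHomologyTheory


open GPoset

/-! ### Induction from a subgroup -/

namespace EquivariantHomologyTheory

variable {Λ : Type v} [Ring Λ] {Γ : Type x} [Group Γ]
  {E : EquivariantHomologyTheory.{u, v, w, x} Λ Γ} {K G : GroupOver.{u} Γ}

theorem semi_ofHom_ap (α : K.Hom G) {A X : GPoset K.carrier} {A' X' : GPoset G.carrier}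
    {i : A ⟶ X} {i' : A' ⟶ X'} {mA : A ⟶ (res α.toMonoidHom).obj A'}
    {mX : X ⟶ (res α.toMonoidHom).obj X'} (h : i ≫ mX = mA ≫ (res α.toMonoidHom).map i') (n : ℤ)
    (a : ((E.theory K).H n).obj ((real K.carrier).obj A)) :
    E.semi α (SemiMap.ofHom mX) n ((PosetTheory.ofTheory (E.theory K)).ap n i a) =
      (PosetTheory.ofTheory (E.theory G)).ap n i' (E.semi α (SemiMap.ofHom mA) n a) := by
  refine (semi_ap α (SemiMap.ofHom mX) ((real K.carrier).map i)
    ((SemiMap.ofHom mX).comp ((real K.carrier).map i)) (fun _ => rfl) n a).trans ?_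
  exact (ap_semi α (SemiMap.ofHom mA) ((real G.carrier).map i') _
    (fun p => SemiMap.ofHom_comm h p) n a).symm

theorem bijective_semi_of_isDisjointUnion (α : K.Hom G) {I : Type u} {X : I → GPoset K.carrier}
    {X' : I → GPoset G.carrier} {U : GPoset K.carrier} {U' : GPoset G.carrier} {j : ∀ i, X i ⟶ U}
    {j' : ∀ i, X' i ⟶ U'} (hj : IsDisjointUnion j) (hj' : IsDisjointUnion j')
    (m : U ⟶ (res α.toMonoidHom).obj U') (mi : ∀ i, X i ⟶ (res α.toMonoidHom).obj (X' i))
    (hm : ∀ i, j i ≫ m = mi i ≫ (res α.toMonoidHom).map (j' i)) (n : ℤ)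
    (h : ∀ i, Function.Bijective (E.semi α (SemiMap.ofHom (mi i)) n)) :
    Function.Bijective (E.semi α (SemiMap.ofHom m) n) := by
  constructor
  · refine (injective_iff_map_eq_zero _).2 fun x hx => ?_
    obtain ⟨t, d, rfl⟩ := (PosetTheory.ofTheory (E.theory K)).exists_sum j hj n x
    have h0 := (PosetTheory.ofTheory (E.theory G)).eq_zero_of_sum j' hj' n t
      (fun i => E.semi α (SemiMap.ofHom (mi i)) n (d i)) (by
        refine Eq.trans ?_ hx
        refine Eq.trans ?_ (map_sum (E.semi α (SemiMap.ofHom m) n) _ _).symm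
        exact Finset.sum_congr rfl fun i _ => (semi_ofHom_ap α (hm i) n (d i)).symm)
    refine Finset.sum_eq_zero fun i hi => ?_
    rw [(injective_iff_map_eq_zero _).1 (h i).1 _ (h0 i hi)]
    exact map_zero _
  · intro y
    obtain ⟨t, d, rfl⟩ := (PosetTheory.ofTheory (E.theory G)).exists_sum j' hj' n y
    choose x hx using fun i => (h i).2 (d i)
    refine ⟨∑ i ∈ t, (PosetTheory.ofTheory (E.theory K)).ap n (j i) (x i), ?_⟩
    refine (map_sum (E.semi α (SemiMap.ofHom m) n) _ _).trans ?_
    refine Finset.sum_congr rfl fun i _ => ?_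
    exact (semi_ofHom_ap α (hm i) n (x i)).trans (congrArg _ (hx i))

section Subgroup

variable (L : Subgroup G.carrier)

/-- The map `y ↦ (L, y)` from `Y`, with the action of `L`, to `G/L × Y`. -/
def toOrbitProd : res L.subtype ⟶ prod (orbit L) ⋙ res L.subtype where
  app Y :=
    { toFun := fun y => ((base L, y) : (G.carrier ⧸ L) × Y.carrier)
      monotone' := fun _ _ h => And.intro rfl h
      map_smul := fun l y => Prod.ext ((smul_base_eq_iff L _).2 l.2).symm rfl }

theorem exists_out_eq (c : G.carrier ⧸ L) (g : G.carrier) :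
    ∃ l : L, (g • c).out = g * c.out * l := by
  have h : ((g * c.out : G.carrier) : G.carrier ⧸ L) = ((g • c).out : G.carrier) := by
    rw [QuotientGroup.out_eq']
    exact congrArg (g • ·) (QuotientGroup.out_eq' c)
  exact ⟨⟨_, QuotientGroup.eq.1 h⟩, (mul_inv_cancel_left _ _).symm⟩

/-- For a discrete `Y`, the map `y ↦ (L, y)` induces an isomorphism in homology: it is a bijection
on orbits and on isotropy groups. -/
theorem bijective_toOrbitProd_of_discrete {Y : GPoset G.carrier}
    (hY : ∀ a b : Y.carrier, a ≤ b → a = b) (n : ℤ) :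
    Function.Bijective (E.semi (subgroupHom G L)
      (SemiMap.ofHom (Y := (prod (orbit L)).obj Y) ((toOrbitProd L).app Y)) n) := by
  let Y' : GPoset (subgroupOver G L).carrier := (res L.subtype).obj Y
  let Z : GPoset G.carrier := (prod (orbit L)).obj Y
  have hZ : ∀ a b : Z.carrier, a ≤ b → a = b := fun a b h => Prod.ext h.1 (hY _ _ h.2)
  let mk : Y.carrier → MulAction.orbitRel.Quotient (subgroupOver G L).carrier Y'.carrier :=
    fun y => Quotient.mk _ y
  have hmk : ∀ y y' : Y.carrier, mk y = mk y' ↔ ∃ l : L, (l : G.carrier) • y' = y := fun y y' =>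
    Quotient.eq.trans Iff.rfl
  let e : Z.carrier → MulAction.orbitRel.Quotient (subgroupOver G L).carrier Y'.carrier :=
    fun z => mk ((show G.carrier ⧸ L from z.1).out⁻¹ • z.2)
  have hes : ∀ (g : G.carrier) (z : Z.carrier), e (g • z) = e z := fun g z => by
    obtain ⟨l, hl⟩ := exists_out_eq L z.1 g
    refine (hmk _ _).2 ⟨l⁻¹, ?_⟩
    change _ = (g • (show G.carrier ⧸ L from z.1)).out⁻¹ • g • z.2
    rw [hl, smul_smul, smul_smul]
    congr 1
    simp [mul_assoc]
  have hbase : ∀ y : Y.carrier, e (base L, y) = mk y := fun y => by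
    refine (hmk _ _).2 ⟨⟨(base L : G.carrier ⧸ L).out⁻¹, ?_⟩, rfl⟩
    refine inv_mem ?_
    have := QuotientGroup.eq.1 (QuotientGroup.out_eq' (base L : G.carrier ⧸ L))
    simpa using this
  have hj := Y'.isDisjointUnion_incl mk (fun a b h => congrArg mk (hY a b h))
    fun l y => (hmk _ _).2 ⟨l, rfl⟩
  have hj' := Z.isDisjointUnion_incl e (fun a b h => congrArg e (hZ a b h)) hes
  let m : ∀ i, Y'.sub (fun y => mk y = i) (fun l y h => ((hmk _ _).2 ⟨l, rfl⟩).trans h) ⟶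
      (res L.subtype).obj (Z.sub (fun z => e z = i) fun g z h => (hes g z).trans h) := fun i =>
    { toFun := fun y => (⟨(base L, y.1), (hbase y.1).trans y.2⟩ : {z : Z.carrier // e z = i})
      monotone' := fun _ _ h => And.intro rfl h
      map_smul := fun l y => Subtype.ext (Prod.ext ((smul_base_eq_iff L _).2 l.2).symm rfl) }
  refine bijective_semi_of_isDisjointUnion (subgroupHom G L) hj hj' ((toOrbitProd L).app Y) m
    (fun i => rfl) n fun i => ?_
  obtain ⟨y, rfl⟩ : ∃ y, mk y = i := Quotient.exists_rep i
  let M : Subgroup (subgroupOver G L).carrier := MulAction.stabilizer _ (show Y'.carrier from y)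
  let α := subgroupHom (subgroupOver G L) M
  let γ : (subgroupOver (subgroupOver G L) M).Hom G := (subgroupHom G L).comp α
  let y' : (Y'.sub (fun y' => mk y' = mk y) fun l y h => ((hmk _ _).2 ⟨l, rfl⟩).trans h).carrier :=
    ⟨y, rfl⟩
  let z : (Z.sub (fun z => e z = mk y) fun g z h => (hes g z).trans h).carrier :=
    ⟨(base L, y), hbase y⟩
  have hz : ∀ k, γ.toMonoidHom k • z = z := fun k =>
    Subtype.ext (Prod.ext ((smul_base_eq_iff L _).2 k.1.2) k.2)
  have hy' : ∀ k, α.toMonoidHom k • OrderComplex.vertex y' = OrderComplex.vertex y' := fun k => by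
    rw [smul_vertex]
    exact congrArg _ (Subtype.ext k.2)
  have hz' : ∀ k, γ.toMonoidHom k • OrderComplex.vertex z = OrderComplex.vertex z := fun k => by
    rw [smul_vertex, hz]
  have h1 := bijective_semi_vertex (E := E) α Subtype.val_injective
    (fun a b h => Subtype.ext (hY _ _ h)) y' (fun a => by
      obtain ⟨l, hl⟩ := (hmk _ _).1 a.2
      exact ⟨l, Subtype.ext hl⟩) (fun g hg => ⟨⟨g, congrArg Subtype.val hg⟩, rfl⟩) hy' n
  have h2 := bijective_semi_vertex (E := E) γ (Subtype.val_injective.comp Subtype.val_injective)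
    (fun a b h => Subtype.ext (hZ _ _ h)) z (fun a => by
      obtain ⟨l, hl⟩ := (hmk _ _).1 a.2
      refine ⟨(show G.carrier ⧸ L from a.1.1).out * l, Subtype.ext (Prod.ext ?_ ?_)⟩
      · refine (smul_base L _).trans ((QuotientGroup.eq.2 ?_).trans (QuotientGroup.out_eq' _))
        simp
      · change ((show G.carrier ⧸ L from a.1.1).out * (l : G.carrier)) • y = a.1.2
        rw [mul_smul, hl, smul_inv_smul])
    (fun g hg => by
      have hg' := congrArg Subtype.val hg
      exact ⟨⟨⟨g, (smul_base_eq_iff L _).1 (congrArg Prod.fst hg')⟩, congrArg Prod.snd hg'⟩, rfl⟩)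
    hz' n
  refine (Function.Bijective.of_comp_iff _ h1).1 ?_
  convert h2 using 1
  funext a
  exact semi_semi α (subgroupHom G L) γ (fun _ => rfl) _ _ _
    (fun _ => (realFun_vertex (m (mk y)) y').symm) n a

/-- The map `y ↦ (L, y)` induces an isomorphism in homology for telescopes: this passes from orbits to
telescopes since both sides are homology theories in `Y`. -/
theorem bijective_toOrbitProd (X : GPoset G.carrier) (n : ℤ) :
    Function.Bijective (E.semi (subgroupHom G L)
      (SemiMap.ofHom (Y := (prod (orbit L)).obj X.telescope) ((toOrbitProd L).app X.telescope)) n) := by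
  have h := TheorySystem.isColim_telescope (S := TheorySystem.single (E.trans (subgroupHom G L)
      (isExactFunctor_res L.subtype) (isExactFunctor_prod (orbit L)) (toOrbitProd L)))
    (P := fun _ => True) (fun _ _ _ _ => trivial)
    (fun M _ n => (TheorySystem.isColim_single _).2
      (E.bijective_toOrbitProd_of_discrete L (fun _ _ h => h) n)) (X := X) (fun _ => trivial) n
  exact (TheorySystem.isColim_single _).1 h

end Subgroup

/-! ### Comparison of two families -/

/-- The identity as a morphism over `Γ`. -/
abbrev idHom (G : GroupOver.{u} Γ) : G.Hom G := ⟨MonoidHom.id _, rfl⟩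

/-- The projection `Y × X → X`. -/
def sndHom {G : Type u} [Group G] (Y : GPoset G) : prod Y ⟶ 𝟭 (GPoset G) ⋙ res (MonoidHom.id G) where
  app X :=
    { toFun := fun p => (show Y.carrier × X.carrier from p).2
      monotone' := fun _ _ h => And.right h
      map_smul := fun _ _ => rfl }

/-- The symmetry `G/L × Y ≅ Y × G/L`. -/
def swapHom {G : Type u} [Group G] (X Y : GPoset G) : (prod X).obj Y ⟶ (prod Y).obj X where
  toFun p := (show X.carrier × Y.carrier from p).swap
  monotone' _ _ h := And.intro h.2 h.1
  map_smul _ _ := rfl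

theorem swapHom_swapHom {G : Type u} [Group G] (X Y : GPoset G) : swapHom X Y ≫ swapHom Y X = 𝟙 _ :=
  rfl

/-- The projection `Y × G/L → G/L` corresponds to the projection of `Y`, as an `L`-space, to a
point. -/
theorem bijective_sndHom_orbit (L : Subgroup G.carrier) (Y : GPoset G.carrier) (n : ℤ)
    (h : Function.Bijective (((E.theory (subgroupOver G L)).H n).map
      ((res L.subtype).obj Y.telescope).complex.toPoint).hom) :
    Function.Bijective (E.semi (idHom G) (SemiMap.ofHom (Y := orbit L)
      ((sndHom Y.telescope).app (orbit L))) n) := by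
  have hswap : Function.Bijective ((PosetTheory.ofTheory (E.theory G)).ap n
      (swapHom (orbit L) Y.telescope)) := by
    refine Function.bijective_iff_has_inverse.2 ⟨(PosetTheory.ofTheory (E.theory G)).ap n
      (swapHom Y.telescope (orbit L)), fun a => ?_, fun a => ?_⟩
    · rw [← PosetTheory.ap_comp, swapHom_swapHom, PosetTheory.ap_id]
    · rw [← PosetTheory.ap_comp, swapHom_swapHom, PosetTheory.ap_id]
  refine (Function.Bijective.of_comp_iff _ (hswap.comp (E.bijective_toOrbitProd L Y n))).1 ?_
  have key : ∀ a, E.fromSubgroup L n ((((E.theory (subgroupOver G L)).H n).map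
      ((res L.subtype).obj Y.telescope).complex.toPoint).hom a) =
      E.semi (idHom G) (SemiMap.ofHom (Y := orbit L) ((sndHom Y.telescope).app (orbit L))) n
        ((PosetTheory.ofTheory (E.theory G)).ap n (swapHom (orbit L) Y.telescope)
          (E.semi (subgroupHom G L) (SemiMap.ofHom (Y := (prod (orbit L)).obj Y.telescope)
            ((toOrbitProd L).app Y.telescope)) n a)) := fun a => by
    let c : Y.telescope.carrier →o (orbit L).carrier := OrderHom.const _ (base L)
    let m : (prod (orbit L)).obj Y.telescope ⟶ (res (idHom G).toMonoidHom).obj (orbit L) :=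
      swapHom (orbit L) Y.telescope ≫ (sndHom Y.telescope).app (orbit L)
    refine (semi_ap (subgroupHom G L) _ _ (SemiMap.comp _ _) (fun _ => rfl) n a).trans ?_
    refine Eq.trans ?_ (semi_ap (idHom G) _ _ (SemiMap.ofHom (Y := orbit L) m) (fun p => ?_) n
      _).symm
    · refine (semi_semi (subgroupHom G L) (idHom G) (subgroupHom G L) (fun _ => rfl) _ _ _
        (fun p => ?_) n a).symm
      refine Eq.trans ?_ (OrderComplex.map_map ((toOrbitProd L).app Y.telescope).toOrderHom
        m.toOrderHom p).symm
      refine (OrderComplex.map_const (X := Y.telescope.carrier) (Y := (orbit L).carrier) (base L)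
        p).symm.trans ?_
      exact congrArg (fun f => OrderComplex.map f p) (OrderHom.ext _ _ rfl)
    · exact (OrderComplex.map_map (swapHom (orbit L) Y.telescope).toOrderHom
        ((sndHom Y.telescope).app (orbit L)).toOrderHom p).symm
  exact Eq.mp (congrArg Function.Bijective (funext key)) ((E.bijective_fromSubgroup L n).comp h)

/-- If `Y` has the homology of a point for all subgroups in a family which contains the isotropy
groups of `X`, then the projection `Y × X → X` induces an isomorphism. -/
theorem bijective_sndHom {P : Subgroup G.carrier → Prop} (hP : ∀ L M, L ≤ M → P M → P L)
    {X : GPoset G.carrier} (hX : X.HasIsotropy P) (Y : GPoset G.carrier)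
    (h : ∀ L, P L → ∀ n, Function.Bijective (((E.theory (subgroupOver G L)).H n).map
      ((res L.subtype).obj Y.telescope).complex.toPoint).hom) (n : ℤ) :
    Function.Bijective (E.semi (idHom G) (SemiMap.ofHom (Y := X.telescope)
      ((sndHom Y.telescope).app X.telescope)) n) := by
  have h := TheorySystem.isColim_telescope (S := TheorySystem.single (E.trans (idHom G)
      (isExactFunctor_prod Y.telescope) isExactFunctor_id (sndHom Y.telescope))) hP
    (fun L hL n => (TheorySystem.isColim_single _).2
      (E.bijective_sndHom_orbit L Y n (h L hL n))) hX n
  exact (TheorySystem.isColim_single _).1 h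

/-- If `Y` has the homology of a point for all isotropy groups of `X` and `Y × X` has the homology of a
point, then so does `X`, for telescopes `X` and `Y`. -/
theorem bijective_toPoint_of_prod {P : Subgroup G.carrier → Prop} (hP : ∀ L M, L ≤ M → P M → P L)
    {X : GPoset G.carrier} (hX : X.HasIsotropy P) (Y : GPoset G.carrier)
    (h : ∀ L, P L → ∀ n, Function.Bijective (((E.theory (subgroupOver G L)).H n).map
      ((res L.subtype).obj Y.telescope).complex.toPoint).hom) (n : ℤ)
    (hprod : Function.Bijective (((E.theory G).H n).map
      ((prod Y.telescope).obj X.telescope).complex.toPoint).hom) :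
    Function.Bijective (((E.theory G).H n).map X.telescope.complex.toPoint).hom := by
  refine (Function.Bijective.of_comp_iff _ (bijective_sndHom hP hX Y h n)).1 ?_
  have key : ∀ a, (((E.theory G).H n).map
      ((prod Y.telescope).obj X.telescope).complex.toPoint).hom a =
      (((E.theory G).H n).map X.telescope.complex.toPoint).hom (E.semi (idHom G)
        (SemiMap.ofHom (Y := X.telescope) ((sndHom Y.telescope).app X.telescope)) n a) := fun a => by
    let e : SemiMap (idHom G).toMonoidHom ((prod Y.telescope).obj X.telescope).complex.toPair
        (GCWComplex.point G.carrier).toPair :=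
      ⟨fun _ => PUnit.unit, continuous_const, fun _ _ => rfl, fun _ h => h.elim⟩
    refine (semi_of_eq_id (idHom G) (fun _ => rfl) e _ (fun _ => rfl) n a).symm.trans ?_
    exact (ap_semi (idHom G) _ X.telescope.complex.toPoint _ (fun _ => rfl) n a).symm
  exact Eq.mp (congrArg Function.Bijective (funext key)) hprod

end EquivariantHomologyTheory


/-! ### Acyclic posets -/

/-- Two monotone maps are related by a zigzag of comparable monotone maps. -/
abbrev Zigzag {P Q : Type u} [PartialOrder P] [PartialOrder Q] : (P →o Q) → (P →o Q) → Prop :=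
  Relation.EqvGen (· ≤ ·)

/-- A criterion for weak contractibility of the order complex: the poset has an exhausting sequence
of subsets whose inclusions are related by a zigzag to a constant map. -/
def IsAcyclic (P : Type u) [PartialOrder P] : Prop :=
  ∃ N : ℕ → Set P, Monotone N ∧ (∀ p, ∃ n, p ∈ N n) ∧
    ∀ n, ∃ c, Zigzag (OrderHom.Subtype.val (· ∈ N n)) (OrderHom.const _ c)

theorem eqvGen_map {A B : Type*} [Preorder A] [Preorder B] {F : A → B} (hF : Monotone F) {a b : A}
    (h : Relation.EqvGen (· ≤ ·) a b) : Relation.EqvGen (· ≤ ·) (F a) (F b) := by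
  induction h with
  | rel _ _ h => exact .rel _ _ (hF h)
  | refl => exact .refl _
  | symm _ _ _ ih => exact .symm _ _ ih
  | trans _ _ _ _ _ ih ih' => exact .trans _ _ _ ih ih'

theorem IsAcyclic.of_orderIso {P Q : Type u} [PartialOrder P] [PartialOrder Q] (e : P ≃o Q)
    (h : IsAcyclic P) : IsAcyclic Q := by
  obtain ⟨N, hN, hc, hz⟩ := h
  refine ⟨fun n => e.symm ⁻¹' N n, fun m n hmn => Set.preimage_mono (hN hmn), fun q => hc _,
    fun n => ?_⟩
  obtain ⟨c, hc⟩ := hz n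
  let r : {q // q ∈ e.symm ⁻¹' N n} →o {p // p ∈ N n} :=
    ⟨fun q => ⟨e.symm q.1, q.2⟩, fun _ _ h => e.symm.monotone h⟩
  refine ⟨e c, ?_⟩
  convert eqvGen_map (F := fun f : {p // p ∈ N n} →o P => (e : P →o Q).comp (f.comp r))
    (fun f g h q => e.monotone ((show ∀ p, f p ≤ g p from h) (r q))) hc using 1
  · ext q
    exact (e.apply_symm_apply q.1).symm
  · rfl

theorem IsAcyclic.prod {P Q : Type u} [PartialOrder P] [PartialOrder Q] (hP : IsAcyclic P)
    (hQ : IsAcyclic Q) : IsAcyclic (P × Q) := by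
  obtain ⟨N, hN, hc, hz⟩ := hP
  obtain ⟨M, hM, hc', hz'⟩ := hQ
  refine ⟨fun n => N n ×ˢ M n, fun m n h => Set.prod_mono (hN h) (hM h), fun p => ?_, fun n => ?_⟩
  · obtain ⟨n, hn⟩ := hc p.1
    obtain ⟨m, hm⟩ := hc' p.2
    exact ⟨max n m, hN (le_max_left _ _) hn, hM (le_max_right _ _) hm⟩
  · obtain ⟨c, hc⟩ := hz n
    obtain ⟨c', hc'⟩ := hz' n
    let r : {p // p ∈ N n ×ˢ M n} →o {p // p ∈ N n} := ⟨fun q => ⟨q.1.1, q.2.1⟩, fun _ _ h => h.1⟩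
    let r' : {p // p ∈ N n ×ˢ M n} →o {p // p ∈ M n} := ⟨fun q => ⟨q.1.2, q.2.2⟩, fun _ _ h => h.2⟩
    refine ⟨(c, c'), ?_⟩
    have h1 := eqvGen_map (F := fun f : {p // p ∈ N n} →o P =>
      (f.comp r).prod ((OrderHom.Subtype.val (· ∈ M n)).comp r'))
      (fun f g h q => ⟨h (r q), le_rfl⟩) hc
    have h2 := eqvGen_map (F := fun f : {p // p ∈ M n} →o Q =>
      ((OrderHom.const {p // p ∈ N n} c).comp r).prod (f.comp r'))
      (fun f g h q => ⟨le_rfl, h (r' q)⟩) hc'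
    exact .trans _ _ _ h1 h2

theorem homotopic_map_of_le {P Q : Type u} [PartialOrder P] [PartialOrder Q] (f g : P →o Q)
    (h : ∀ p, f p ≤ g p) : ContinuousMap.Homotopic
      (⟨OrderComplex.map f, OrderComplex.continuous_map f⟩ : C(OrderComplex P, OrderComplex Q))
      ⟨OrderComplex.map g, OrderComplex.continuous_map g⟩ := by
  have hc : Continuous fun q : unitInterval × OrderComplex P =>
      OrderComplex.homotopyFun f g h q.2 (q.1 : ℝ) := by
    have h1 : Continuous (Prod.swap : unitInterval × OrderComplex P → OrderComplex P × unitInterval) :=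
      continuous_swap
    have h2 := (OrderComplex.continuous_homotopyFun f g h).comp h1
    exact h2
  have h0 : ∀ x, OrderComplex.homotopyFun f g h x ((0 : unitInterval) : ℝ) = OrderComplex.map f x :=
    fun x => by
      rw [Set.Icc.coe_zero]
      exact OrderComplex.homotopyFun_zero f g h x
  have h1 : ∀ x, OrderComplex.homotopyFun f g h x ((1 : unitInterval) : ℝ) = OrderComplex.map g x :=
    fun x => by
      rw [Set.Icc.coe_one]
      exact OrderComplex.homotopyFun_one f g h x
  exact ⟨⟨⟨_, hc⟩, h0, h1⟩⟩

theorem homotopic_of_zigzag {P Q : Type u} [PartialOrder P] [PartialOrder Q] {f g : P →o Q}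
    (h : Zigzag f g) : ContinuousMap.Homotopic
      (⟨OrderComplex.map f, OrderComplex.continuous_map f⟩ : C(OrderComplex P, OrderComplex Q))
      ⟨OrderComplex.map g, OrderComplex.continuous_map g⟩ := by
  induction h with
  | rel f g h => exact homotopic_map_of_le f g h
  | refl => exact .refl _
  | symm _ _ _ ih => exact ih.symm
  | trans _ _ _ _ _ ih ih' => exact ih.trans ih'

theorem IsAcyclic.discExtension {P : Type u} [PartialOrder P] (hP : IsAcyclic P) :
    DiscExtension (OrderComplex P) := by
  obtain ⟨N, hN, hc, hz⟩ := hP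
  refine .of_nullhomotopy fun n f hf => ?_
  obtain ⟨k, hk⟩ := OrderComplex.exists_stage_of_isCompact hN hc (isCompact_range hf)
  obtain ⟨c, hc⟩ := hz k
  obtain ⟨H⟩ := homotopic_of_zigzag hc
  let i : {p // p ∈ N k} →o P := OrderHom.Subtype.val (· ∈ N k)
  have hi := OrderComplex.isClosedEmbedding_map i fun _ _ h => h
  have hr : ∀ s, f s ∈ Set.range (OrderComplex.map i) := fun s => by
    rw [OrderComplex.range_map i fun _ _ h => h]
    exact fun p hp => ⟨⟨p, hk _ ⟨s, rfl⟩ hp⟩, rfl⟩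
  choose g hg using hr
  have hgc : Continuous g := by
    rw [hi.isInducing.continuous_iff]
    exact hf.congr fun s => (hg s).symm
  refine ⟨fun q => H (q.2, g q.1), OrderComplex.vertex c, by fun_prop, fun s => ?_, fun s => ?_⟩
  · exact (H.apply_zero _).trans (hg s)
  · exact (H.apply_one _).trans (OrderComplex.map_const c _)

theorem contractibleSpace_of_zigzag {P : Type u} [PartialOrder P] {c : P}
    (h : Zigzag OrderHom.id (OrderHom.const P c)) : ContractibleSpace (OrderComplex P) := by
  refine (contractible_iff_id_nullhomotopic _).2 ⟨OrderComplex.vertex c, ?_⟩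
  convert homotopic_of_zigzag h using 1
  · ext1 x
    exact (congrFun OrderComplex.map_id x).symm
  · ext1 x
    exact (OrderComplex.map_const c x).symm

/-! ### Posets which model classifying spaces -/

namespace GPoset

variable {G : Type u} [Group G]

/-- The fixed points of a subgroup. -/
abbrev Fixed (X : GPoset G) (L : Subgroup G) : Type u := {a : X.carrier // ∀ g ∈ L, g • a = a}

/-- The order complex of the fixed points, as a map to the order complex. -/
abbrev fixedVal (X : GPoset G) (L : Subgroup G) : X.Fixed L →o X.carrier :=
  OrderHom.Subtype.val fun a => ∀ g ∈ L, g • a = a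

/-- A point of the order complex is fixed if and only if all vertices of its simplex are fixed,
since these are distinguished by their ranks. -/
theorem range_map_fixedVal (X : GPoset G) (L : Subgroup G) :
    Set.range (OrderComplex.map (X.fixedVal L)) =
      MulAction.fixedPoints L (OrderComplex X.carrier) := by
  rw [OrderComplex.range_map (X.fixedVal L) fun _ _ h => h]
  ext x
  constructor
  · intro hx g
    obtain ⟨y, rfl⟩ : x ∈ Set.range (OrderComplex.map (X.fixedVal L)) := by
      rw [OrderComplex.range_map (X.fixedVal L) fun _ _ h => h]
      exact hx
    refine (OrderComplex.map_map (X.fixedVal L) (X.smulHom (g : G)) y).trans ?_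
    exact congrArg (fun f => OrderComplex.map f y)
      (OrderHom.ext _ _ (funext fun a => a.2 g g.2))
  · intro hx a ha
    refine ⟨⟨a, fun g hg => ?_⟩, rfl⟩
    have h1 : g • a ∈ x.1.support := by
      have := (X.mem_support_smul g x (a := a)).2 ha
      rwa [show g • x = x from hx ⟨g, hg⟩] at this
    rcases x.2.2.2.total h1 ha with h | h
    · exact X.eq_of_rank_eq h (X.rank_smul g a)
    · exact (X.eq_of_rank_eq h (X.rank_smul g a).symm).symm

/-- The fixed points of the order complex are the order complex of the fixed points. -/
noncomputable def fixedHomeomorph (X : GPoset G) (L : Subgroup G) :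
    OrderComplex (X.Fixed L) ≃ₜ MulAction.fixedPoints L X.complex.carrier :=
  (OrderComplex.isClosedEmbedding_map (X.fixedVal L)
    fun _ _ h => h).isEmbedding.toHomeomorph.trans (.setCongr (X.range_map_fixedVal L))

/-- The fixed points of `X` are acyclic for subgroups in `F`, and empty otherwise. -/
structure IsModel (F : SubgroupFamily G) (X : GPoset G) : Prop where
  hasIsotropy : X.HasIsotropy F.mem
  isAcyclic : ∀ L, F.mem L → IsAcyclic (X.Fixed L)

theorem HasIsotropy.mem_of_nonempty {F : SubgroupFamily G} {X : GPoset G}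
    (h : X.HasIsotropy F.mem) {L : Subgroup G}
    (hL : (MulAction.fixedPoints L X.complex.carrier).Nonempty) : F.mem L := by
  obtain ⟨x⟩ := hL.to_subtype
  obtain ⟨a, -⟩ := ((X.fixedHomeomorph L).symm x).support_nonempty
  exact F.mono _ _ (fun g hg => MulAction.mem_stabilizer_iff.2 (a.2 g hg)) (h a.1)

theorem IsModel.models {F : SubgroupFamily G} {X : GPoset G} (h : X.IsModel F) :
    Models F X.complex where
  mem L := h.hasIsotropy.mem_of_nonempty
  nonempty L hL := by
    obtain ⟨N, -, -, hz⟩ := h.isAcyclic L hL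
    obtain ⟨c, -⟩ := hz 0
    exact ⟨_, (X.fixedHomeomorph L (OrderComplex.vertex c)).2⟩
  discExtension L hL n f hf := by
    obtain ⟨g, hg, e⟩ := (h.isAcyclic L hL).discExtension n (fun d => (X.fixedHomeomorph L).symm (f d))
      ((X.fixedHomeomorph L).symm.continuous.comp_continuousOn hf)
    refine ⟨fun d => X.fixedHomeomorph L (g d), (X.fixedHomeomorph L).continuous.comp hg,
      fun d hd => (congrArg _ (e d hd)).trans (Homeomorph.apply_symm_apply _ _)⟩

theorem IsModel.res {K : Type u} [Group K] {F : SubgroupFamily G} {X : GPoset G} (h : X.IsModel F)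
    (α : K →* G) : ((GPoset.res α).obj X).IsModel (F.pullback α) where
  hasIsotropy a := F.mono _ _ (by
    rintro _ ⟨k, hk, rfl⟩
    exact hk) (h.hasIsotropy a)
  isAcyclic L hL := by
    refine (h.isAcyclic (L.map α) hL).of_orderIso
      { toFun := fun a => ⟨a.1, fun k hk => a.2 _ ⟨k, hk, rfl⟩⟩
        invFun := fun a => ⟨a.1, fun g hg => by
          obtain ⟨k, hk, rfl⟩ := hg
          exact a.2 k hk⟩
        left_inv := fun _ => rfl
        right_inv := fun _ => rfl
        map_rel_iff' := Iff.rfl }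

theorem IsModel.prod {F F' : SubgroupFamily G} (hF : ∀ L, F.mem L → F'.mem L) {Y X : GPoset G}
    (hY : Y.IsModel F) (hX : X.IsModel F') : ((GPoset.prod Y).obj X).IsModel F where
  hasIsotropy a := F.mono _ _ (fun g hg => by
    have : g • a = a := hg
    exact congrArg Prod.fst this) (hY.hasIsotropy (show Y.carrier × X.carrier from a).1)
  isAcyclic L hL := by
    refine ((hY.isAcyclic L hL).prod (hX.isAcyclic L (hF L hL))).of_orderIso
      { toFun := fun a => ⟨(a.1.1, a.2.1), fun g hg => Prod.ext (a.1.2 g hg) (a.2.2 g hg)⟩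
        invFun := fun a => (⟨a.1.1, fun g hg => congrArg Prod.fst (a.2 g hg)⟩,
          ⟨a.1.2, fun g hg => congrArg Prod.snd (a.2 g hg)⟩)
        left_inv := fun _ => rfl
        right_inv := fun _ => rfl
        map_rel_iff' := Iff.rfl }

/-! ### Words -/

/-- The nonempty words in an alphabet. -/
def Words (S : Type u) : Type u := {w : List S // w ≠ []}

instance (S : Type u) : PartialOrder (Words S) where
  le v w := v.1.Sublist w.1
  le_refl v := .refl v.1
  le_trans _ _ _ h h' := h.trans h'
  le_antisymm _ _ h h' := Subtype.ext (h.antisymm h')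

/-- The nonempty words in a `G`-set, ordered by being a subword. -/
def words (S : Type u) [MulAction G S] : GPoset G where
  carrier := Words S
  action :=
    { smul := fun g w => ⟨w.1.map (g • ·), by simpa using w.2⟩
      one_smul := fun w => Subtype.ext (by
        change w.1.map ((1 : G) • ·) = w.1
        simp)
      mul_smul := fun g h w => Subtype.ext (by
        change w.1.map ((g * h) • ·) = (w.1.map (h • ·)).map (g • ·)
        simp [Function.comp_def, mul_smul]) }
  smul_le g _ _ h := List.Sublist.map _ h
  rank w := w.1.length
  rank_strictMono v w h := by
    have h' : v.1.Sublist w.1 := h.le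
    exact lt_of_le_of_ne h'.length_le fun e => h.ne (Subtype.ext (h'.eq_of_length e))
  rank_smul g w := List.length_map _

variable {S : Type u} [MulAction G S]

/-- The words with a given letter in front. -/
def consHom {L : Subgroup G} (s : S) (hs : ∀ g ∈ L, g • s = s) :
    (words (G := G) S).Fixed L →o (words (G := G) S).Fixed L where
  toFun w := ⟨(⟨s :: w.1.1, List.cons_ne_nil _ _⟩ : Words S), fun g hg => Subtype.ext
    (congrArg₂ List.cons (hs g hg) (congrArg Subtype.val (w.2 g hg)))⟩
  monotone' _ _ h := List.Sublist.cons_cons s h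

/-- The word with a single letter. -/
def letter {L : Subgroup G} (s : S) (hs : ∀ g ∈ L, g • s = s) : (words (G := G) S).Fixed L :=
  ⟨(⟨[s], List.cons_ne_nil _ _⟩ : Words S), fun g hg => Subtype.ext (congrArg (fun s => [s]) (hs g hg))⟩

theorem le_consHom {L : Subgroup G} (s : S) (hs : ∀ g ∈ L, g • s = s)
    (w : (words (G := G) S).Fixed L) : w ≤ consHom s hs w :=
  List.sublist_cons_self s w.1.1

theorem letter_le_consHom {L : Subgroup G} (s : S) (hs : ∀ g ∈ L, g • s = s)
    (w : (words (G := G) S).Fixed L) : letter s hs ≤ consHom s hs w :=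
  List.Sublist.cons_cons s (List.nil_sublist w.1.1)

theorem hasIsotropy_words {P : Subgroup G → Prop} (hP : ∀ L M, L ≤ M → P M → P L)
    (hS : ∀ s : S, P (MulAction.stabilizer G s)) : (words (G := G) S).HasIsotropy P := by
  intro w
  obtain ⟨s, t, e⟩ := List.exists_cons_of_ne_nil w.2
  refine hP _ _ (fun g hg => ?_) (hS s)
  have hw : g • w = w := hg
  have h : w.1.map (g • ·) = w.1 := congrArg Subtype.val hw
  rw [e] at h
  exact (List.cons.inj h).1

theorem zigzag_words {L : Subgroup G} (s : S) (hs : ∀ g ∈ L, g • s = s) :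
    Zigzag OrderHom.id (OrderHom.const ((words (G := G) S).Fixed L) (letter s hs)) :=
  .trans _ (consHom s hs) _ (.rel _ _ (le_consHom s hs)) (.symm _ _ (.rel _ _ (letter_le_consHom s hs)))

/-- The map of the telescope which raises the level to at least `j`. -/
def raise (X : GPoset G) (L : Subgroup G) (j : ℕ) : X.telescope.Fixed L →o X.telescope.Fixed L where
  toFun a := ⟨(⟨a.1.pt, max a.1.level j, a.1.rank_le.trans (le_max_left _ _)⟩ : X.TelescopeElement),
    fun g hg => TelescopeElement.ext (show g • a.1.pt = a.1.pt from
      congrArg TelescopeElement.pt (a.2 g hg)) rfl⟩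
  monotone' a b h := by
    refine And.intro h.1 ?_
    have := h.2
    unfold FenceLE at *
    dsimp only
    omega

theorem zigzag_raise (X : GPoset G) (L : Subgroup G) (j : ℕ) :
    Zigzag OrderHom.id (raise X L j) := by
  induction j with
  | zero =>
    refine .rel _ _ fun a => And.intro le_rfl (Or.inl ?_)
    exact (Nat.max_zero _).symm
  | succ j ih =>
    refine .trans _ _ _ ih ?_
    rcases Nat.even_or_odd' j with ⟨k, rfl | rfl⟩
    · refine .rel _ _ fun a => And.intro le_rfl ?_
      change FenceLE (max a.1.level _) (max a.1.level _)
      unfold FenceLE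
      omega
    · refine .symm _ _ (.rel _ _ fun a => And.intro le_rfl ?_)
      change FenceLE (max a.1.level _) (max a.1.level _)
      unfold FenceLE
      omega

/-- The part of the telescope of level at most `n` is contracted by first raising the level to
`n + 1`, which leaves room for one more letter. -/
theorem isAcyclic_telescope_words {L : Subgroup G} (s : S) (hs : ∀ g ∈ L, g • s = s) :
    IsAcyclic ((words (G := G) S).telescope.Fixed L) := by
  let T := (words (G := G) S).telescope.Fixed L
  let pt : T →o (words (G := G) S).Fixed L :=
    ⟨fun a => ⟨a.1.pt, fun g hg => congrArg TelescopeElement.pt (a.2 g hg)⟩, fun _ _ h => h.1⟩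
  have hpt : ∀ a : T, (pt a).1.1.length ≤ a.1.level := fun a => a.1.rank_le
  refine ⟨fun n => {a | a.1.level ≤ n}, fun m n h a ha => le_trans ha h,
    fun a => ⟨a.1.level, le_refl a.1.level⟩,
    fun n => ?_⟩
  let atLevel : ∀ w : (words (G := G) S).Fixed L, w.1.1.length ≤ n + 1 → T := fun w hw =>
    ⟨(⟨w.1, n + 1, hw⟩ : (words (G := G) S).TelescopeElement), fun g hg =>
      TelescopeElement.ext (w.2 g hg) rfl⟩
  have hlen : ∀ a : T, a.1.level ≤ n → (consHom s hs (pt a)).1.1.length ≤ n + 1 := fun a ha =>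
    Nat.succ_le_succ ((hpt a).trans ha)
  let c : {a : T // a.1.level ≤ n} →o T :=
    ⟨fun a => atLevel (consHom s hs (pt a.1)) (hlen a.1 a.2), fun a b h =>
      And.intro ((consHom s hs).monotone (pt.monotone h)) (Or.inl rfl)⟩
  refine ⟨atLevel (letter s hs) (Nat.le_add_left _ _), ?_⟩
  let i : {a : T // a.1.level ≤ n} →o T := OrderHom.Subtype.val fun a : T => a.1.level ≤ n
  have h1 := eqvGen_map (F := fun f : T →o T => f.comp i)
    (fun f g h a => (show ∀ a, f a ≤ g a from h) (i a)) (zigzag_raise (words (G := G) S) L (n + 1))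
  refine .trans _ _ _ h1 (.trans _ c _ (.rel _ _ fun a => ?_) (.symm _ _ (.rel _ _ fun a => ?_)))
  · refine And.intro (le_consHom s hs (pt a.1)) (Or.inl ?_)
    exact max_eq_right (a.2.trans n.le_succ)
  · exact And.intro (letter_le_consHom s hs (pt a.1)) (Or.inl rfl)

/-- The disjoint union of the orbits `G/L` for `L` in the family `F`. -/
abbrev Letters (F : SubgroupFamily G) : Type u := Σ L : {L : Subgroup G // F.mem L}, G ⧸ L.1

theorem mem_stabilizer_letters (F : SubgroupFamily G) (s : Letters F) :
    F.mem (MulAction.stabilizer G s) := by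
  obtain ⟨L, c⟩ := s
  induction c using QuotientGroup.induction_on with
  | H g =>
    refine F.mono _ _ (fun k hk => ?_) (F.conj L.1 g L.2)
    have h : (QuotientGroup.mk (k * g) : G ⧸ L.1) = QuotientGroup.mk g :=
      eq_of_heq (Sigma.mk.inj (MulAction.mem_stabilizer_iff.1 hk)).2
    refine ⟨g⁻¹ * k * g, ?_, ?_⟩
    · have := L.1.inv_mem (QuotientGroup.eq.1 h)
      simpa [mul_assoc] using this
    · simp [mul_assoc]

theorem exists_fixed_letter (F : SubgroupFamily G) {L : Subgroup G} (hL : F.mem L) :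
    ∃ s : Letters F, ∀ g ∈ L, g • s = s := by
  refine ⟨⟨⟨L, hL⟩, ((1 : G) : G ⧸ L)⟩, fun g hg => Sigma.ext rfl (heq_of_eq ?_)⟩
  exact QuotientGroup.eq.2 (by simpa using hg)

/-- The words in the letters of `F`: a `G`-poset whose realization is a classifying space for `F`. -/
def wordsOf (F : SubgroupFamily G) : GPoset G := words (Letters F)

theorem hasIsotropy_wordsOf (F : SubgroupFamily G) : (wordsOf F).HasIsotropy F.mem :=
  hasIsotropy_words F.mono (mem_stabilizer_letters F)

theorem isClassifyingSpace_wordsOf (F : SubgroupFamily G) :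
    IsClassifyingSpace F (wordsOf F).complex := by
  refine fun L => ⟨fun hL => ?_, fun hL => ?_⟩
  · obtain ⟨s, hs⟩ := exists_fixed_letter F hL
    have : ContractibleSpace (OrderComplex ((wordsOf F).Fixed L)) :=
      contractibleSpace_of_zigzag (zigzag_words s hs)
    exact ((wordsOf F).fixedHomeomorph L).symm.contractibleSpace
  · by_contra h
    exact hL ((hasIsotropy_wordsOf F).mem_of_nonempty (Set.nonempty_iff_ne_empty.2 h))

theorem isModel_telescope_wordsOf (F : SubgroupFamily G) : (wordsOf F).telescope.IsModel F where
  hasIsotropy := (hasIsotropy_wordsOf F).of_hom F.mono (wordsOf F).telescopeMap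
  isAcyclic L hL := by
    obtain ⟨s, hs⟩ := exists_fixed_letter F hL
    exact isAcyclic_telescope_words s hs

end GPoset


open GPoset

/-! ### Colimits of directed systems of groups -/

namespace DirectedCocone

variable {G : Type u} [Group G]

/-- The elementwise description of a colimit: every element comes from some stage, and every element
which becomes trivial is trivial at a later stage. -/
structure IsExhausting (D : DirectedCocone G) : Prop where
  exists_eq : ∀ g, ∃ i k, D.toG i k = g
  exists_map_eq_one : ∀ i k, D.toG i k = 1 → ∃ j, ∃ hij : i ≤ j, D.map i j hij k = 1

theorem map_map_apply (D : DirectedCocone G) {i j k : D.I} (hij : i ≤ j) (hjk : j ≤ k)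
    (a : D.obj i) : D.map j k hjk (D.map i j hij a) = D.map i k (hij.trans hjk) a :=
  DFunLike.congr_fun (D.map_map i j k hij hjk) a

theorem toG_map_apply (D : DirectedCocone G) {i j : D.I} (hij : i ≤ j) (a : D.obj i) :
    D.toG j (D.map i j hij a) = D.toG i a :=
  DFunLike.congr_fun (D.toG_map i j hij) a

theorem IsExhausting.isColimit {D : DirectedCocone G} (hD : D.IsExhausting) : D.IsColimit := by
  intro L _ η hη
  have hη' : ∀ i j (hij : i ≤ j) a, η j (D.map i j hij a) = η i a := fun i j hij a =>
    DFunLike.congr_fun (hη i j hij) a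
  choose i s hs using hD.exists_eq
  have key : ∀ j k (a : D.obj j) (b : D.obj k), D.toG j a = D.toG k b → η j a = η k b := by
    intro j k a b h
    obtain ⟨l, hj, hk⟩ := exists_ge_ge j k
    obtain ⟨m, hlm, e⟩ := hD.exists_map_eq_one l (D.map j l hj a * (D.map k l hk b)⁻¹) (by
      rw [map_mul, map_inv, D.toG_map_apply, D.toG_map_apply, h, mul_inv_cancel])
    have e' := congrArg (η m) e
    rw [hη', map_mul, map_inv, hη', hη', map_one] at e'
    exact mul_inv_eq_one.1 e'
  refine ⟨⟨⟨fun g => η (i g) (s g), ?_⟩, fun g h => ?_⟩, fun j => ?_, fun f hf => ?_⟩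
  · rw [← map_one (η (i 1))]
    exact key _ _ _ _ ((hs 1).trans (map_one _).symm)
  · obtain ⟨l, hg, hh⟩ := exists_ge_ge (i g) (i h)
    change η _ (s (g * h)) = η _ (s g) * η _ (s h)
    rw [← hη' _ _ hg, ← hη' _ _ hh, ← map_mul]
    refine key _ _ _ _ ?_
    rw [hs, map_mul, D.toG_map_apply, D.toG_map_apply, hs, hs]
  · ext a
    exact key _ _ _ _ (hs _)
  · ext g
    rw [← hs g]
    refine (DFunLike.congr_fun (hf (i g)) (s g)).trans ?_
    exact key _ _ _ _ (hs _).symm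

theorem IsExhausting.restrict {D : DirectedCocone G} (hD : D.IsExhausting) (L : Subgroup G) :
    (D.restrict L).IsExhausting where
  exists_eq l := by
    obtain ⟨i, k, hk⟩ := hD.exists_eq l
    exact ⟨i, ⟨k, show D.toG i k ∈ L from hk.symm ▸ l.2⟩, Subtype.ext hk⟩
  exists_map_eq_one i k hk := by
    obtain ⟨j, hij, e⟩ := hD.exists_map_eq_one i k.1 (congrArg Subtype.val hk)
    exact ⟨j, hij, Subtype.ext e⟩

theorem isExhausting_of_injective {D : DirectedCocone G} (h : ∀ g, ∃ i k, D.toG i k = g)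
    (hD : ∀ i, Function.Injective (D.toG i)) : D.IsExhausting where
  exists_eq := h
  exists_map_eq_one i k hk := ⟨i, le_rfl, by
    obtain rfl := (injective_iff_map_eq_one _).1 (hD i) k hk
    exact map_one _⟩

/-- The pullback of a directed system along a homomorphism. -/
abbrev pullback (D : DirectedCocone G) {K : Type u} [Group K] (φ : K →* G) : DirectedCocone K where
  I := D.I
  obj i := ((D.toG i).comp (MonoidHom.fst (D.obj i) K)).eqLocus (φ.comp (MonoidHom.snd (D.obj i) K))
  map i j hij := (((D.map i j hij).comp (MonoidHom.fst _ K)).prod (MonoidHom.snd _ K)).comp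
    (Subgroup.subtype _) |>.codRestrict _ fun k => (D.toG_map_apply hij k.1.1).trans k.2
  map_self i := by
    ext k
    · exact DFunLike.congr_fun (D.map_self i) k.1.1
    · rfl
  map_map i j k hij hjk := by
    ext l
    · exact D.map_map_apply hij hjk l.1.1
    · rfl
  toG i := (MonoidHom.snd _ K).comp (Subgroup.subtype _)
  toG_map _ _ _ := rfl

/-- The projection of a stage of the pullback. -/
def pullbackFst (D : DirectedCocone G) {K : Type u} [Group K] (φ : K →* G) (i : D.I) :
    (D.pullback φ).obj i →* D.obj i := (MonoidHom.fst _ K).comp (Subgroup.subtype _)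

theorem toG_pullbackFst (D : DirectedCocone G) {K : Type u} [Group K] (φ : K →* G) (i : D.I) :
    (D.toG i).comp (D.pullbackFst φ i) = φ.comp ((D.pullback φ).toG i) :=
  MonoidHom.ext fun k => k.2

theorem IsExhausting.pullback {D : DirectedCocone G} (hD : D.IsExhausting) {K : Type u} [Group K]
    (φ : K →* G) : (D.pullback φ).IsExhausting where
  exists_eq k := by
    obtain ⟨i, a, ha⟩ := hD.exists_eq (φ k)
    exact ⟨i, ⟨(a, k), ha⟩, rfl⟩
  exists_map_eq_one i k hk := by
    have hk' : k.1.2 = 1 := hk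
    obtain ⟨j, hij, e⟩ := hD.exists_map_eq_one i k.1.1 (k.2.trans (by
      change φ k.1.2 = 1
      rw [hk', map_one]))
    exact ⟨j, hij, Subtype.ext (Prod.ext e hk')⟩

/-- The quotients of a group by a directed system of normal subgroups of the kernel of a
homomorphism. -/
def ofNormal {F : Type u} [Group F] (π : F →* G) {I : Type u} [Preorder I] [IsDirectedOrder I]
    [Nonempty I] (N : I → Subgroup F) [∀ i, (N i).Normal] (hN : Monotone N)
    (hπ : ∀ i, N i ≤ π.ker) : DirectedCocone G where
  I := I
  obj i := F ⧸ N i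
  map i j h := QuotientGroup.map (N i) (N j) (MonoidHom.id F) (hN h)
  map_self i := QuotientGroup.map_id (N i)
  map_map _ _ _ _ _ := QuotientGroup.monoidHom_ext _ rfl
  toG i := QuotientGroup.lift (N i) π (hπ i)
  toG_map _ _ _ := QuotientGroup.monoidHom_ext _ rfl

theorem isExhausting_ofNormal {F : Type u} [Group F] {π : F →* G} {I : Type u} [Preorder I]
    [IsDirectedOrder I] [Nonempty I] {N : I → Subgroup F} [∀ i, (N i).Normal] (hN : Monotone N)
    (hπ : ∀ i, N i ≤ π.ker) (hs : Function.Surjective π)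
    (hker : ∀ i, ∀ a ∈ π.ker, ∃ j, i ≤ j ∧ a ∈ N j) : (ofNormal π N hN hπ).IsExhausting where
  exists_eq g := by
    obtain ⟨a, rfl⟩ := hs g
    obtain ⟨i⟩ := ‹Nonempty I›
    exact ⟨i, (a : F ⧸ N i), rfl⟩
  exists_map_eq_one := by
    intro (i : I) (k : F ⧸ N i) hk
    obtain ⟨a, rfl⟩ := QuotientGroup.mk_surjective k
    obtain ⟨j, hij, hj⟩ := hker i a hk
    exact ⟨j, hij, (QuotientGroup.eq_one_iff (N := N j) a).2 hj⟩

theorem directed_finset (α : Type u) : IsDirectedOrder (Finset α) := by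
  classical exact inferInstance

/-- A finitely generated group is the colimit of a directed system of finitely presented groups:
only finitely many of the relations between the generators are imposed. -/
theorem exists_isFinitelyPresented (G : Type u) [Group G] [Group.FG G] :
    ∃ D : DirectedCocone G, D.IsExhausting ∧ ∀ i, Group.IsFinitelyPresented (D.obj i) := by
  classical
  obtain ⟨S, hS⟩ := Group.fg_def.1 ‹Group.FG G›
  let π : FreeGroup S →* G := FreeGroup.lift Subtype.val
  have hπ : Function.Surjective π := by
    rw [← MonoidHom.range_eq_top, FreeGroup.range_lift_eq_closure, Subtype.range_coe]
    exact hS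
  let N : Finset π.ker → Subgroup (FreeGroup S) := fun t =>
    Subgroup.normalClosure (Subtype.val '' (t : Set π.ker))
  have hN : Monotone N := fun t t' h =>
    Subgroup.normalClosure_mono (Set.image_mono (Finset.coe_subset.2 h))
  have hle : ∀ t, N t ≤ π.ker := fun t => Subgroup.normalClosure_le_normal (by
    rintro _ ⟨k, -, rfl⟩
    exact k.2)
  have := directed_finset π.ker
  have hnormal : ∀ t, (N t).Normal := fun t => Subgroup.normalClosure_normal
  refine ⟨ofNormal π N hN hle, isExhausting_ofNormal hN hle hπ fun t a ha => ?_, fun t => ?_⟩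
  · exact ⟨insert ⟨a, ha⟩ t, Finset.subset_insert _ _,
      Subgroup.subset_normalClosure ⟨⟨a, ha⟩, Finset.mem_insert_self _ _, rfl⟩⟩
  · exact Group.IsFinitelyPresented.quotient (N t)
      ⟨Subtype.val '' ((show Finset π.ker from t) : Set π.ker), (Finset.finite_toSet _).image _, rfl⟩

end DirectedCocone


open GPoset

namespace GroupClass

variable (C : GroupClass.{u})

/-- A class closed under quotients is closed under images. -/
theorem mem_map {G H : Type u} [Group G] [Group H] (f : G →* H) (L : Subgroup G) (h : C.mem L) :
    C.mem (L.map f) :=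
  C.of_iso _ _ ((QuotientGroup.quotientKerEquivRange (f.comp L.subtype)).trans
    (MulEquiv.subgroupCongr (by rw [MonoidHom.range_comp, Subgroup.range_subtype])))
    (C.quotient L (f.comp L.subtype).ker h)

theorem mem_map_iff {G H : Type u} [Group G] [Group H] (f : G →* H) (hf : Function.Injective f)
    (L : Subgroup G) : C.mem (L.map f) ↔ C.mem L :=
  ⟨C.of_iso _ _ (L.equivMapOfInjective f hf).symm, C.of_iso _ _ (L.equivMapOfInjective f hf)⟩

end GroupClass

namespace EquivariantHomologyTheory

variable {Λ : Type v} [Ring Λ] {Γ : Type x} [Group Γ]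
  {E : EquivariantHomologyTheory.{u, v, w, x} Λ Γ} {G : GroupOver.{u} Γ}

/-! ### Continuity and directed systems of subgroups -/

theorem IsStronglyContinuous.pointColim (hE : E.IsStronglyContinuous) {D : DirectedCocone G.carrier}
    (hD : D.IsExhausting) : E.PointColim D :=
  pointColim_of_bijective D (hE G D hD.isColimit)

theorem IsStronglyContinuous.isContinuous (hE : E.IsStronglyContinuous) : E.IsContinuous :=
  fun G _ _ _ _ S hS h => hE G (.ofSubgroups S hS) (DirectedCocone.IsExhausting.isColimit
    (DirectedCocone.isExhausting_of_injective (fun g => (h g).imp fun _ hi => ⟨⟨g, hi⟩, rfl⟩)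
      fun _ => Subtype.val_injective))

/-- A directed system of injections is isomorphic to the directed system of their images. -/
theorem IsContinuous.pointColim (hE : E.IsContinuous) {D : DirectedCocone G.carrier}
    (h : ∀ g, ∃ i k, D.toG i k = g) (hD : ∀ i, Function.Injective (D.toG i)) : E.PointColim D := by
  let S : D.I → Subgroup G.carrier := fun i => (D.toG i).range
  have hS : Monotone S := fun i j hij => by
    rintro _ ⟨k, rfl⟩
    exact ⟨D.map i j hij k, D.toG_map_apply hij k⟩
  let D' : DirectedCocone G.carrier := .ofSubgroups S hS
  have hD' : E.PointColim D' := pointColim_of_bijective D' (hE G D.I S hS h)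
  let e : ∀ i, D.obj i ≃* S i := fun i => MonoidHom.ofInjective (hD i)
  have he : ∀ i k, (e i k : G.carrier) = D.toG i k := fun i k => rfl
  have he' : ∀ i k, D.toG i ((e i).symm k) = k := fun i k => by
    rw [← he, MulEquiv.apply_symm_apply]
  let a : ∀ i : D.I, (stage D i).Hom (stage D' i) := fun i => ⟨(e i).toMonoidHom, rfl⟩
  have hb : ∀ i, (G.hom.comp (D.toG i)).comp (e i).symm.toMonoidHom = G.hom.comp (S i).subtype :=
    fun i => MonoidHom.ext fun k => congrArg G.hom (he' i k)
  let b : ∀ i : D.I, (stage D' i).Hom (stage D i) := fun i => ⟨(e i).symm.toMonoidHom, hb i⟩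
  intro n
  constructor
  · intro y
    obtain ⟨i, x, rfl⟩ := (hD' n).1 y
    exact ⟨i, (E.pointMap (b i) n).hom x, pointMap_pointMap (b i) (stageToG D i) (stageToG D' i)
      (fun k => (he' i k).symm) n x⟩
  · intro i x hx
    obtain ⟨j, hij, e0⟩ := (hD' n).2 i ((E.pointMap (a i) n).hom x) (by
      rw [← hx]
      exact pointMap_pointMap (a i) (stageToG D' i) (stageToG D i) (fun _ => rfl) n x)
    refine ⟨j, hij, ?_⟩
    have h1 := congrArg (E.pointMap (b j) n).hom e0
    rw [map_zero] at h1
    rw [← h1]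
    let c : (stage D i).Hom (stage D' j) := (stageMap D' i j hij).comp (a i)
    refine Eq.trans ?_ (congrArg _ (pointMap_pointMap (a i) (stageMap D' i j hij) c
      (fun _ => rfl) n x)).symm
    refine (pointMap_pointMap c (b j) (stageMap D i j hij) (fun k => hD j ?_) n x).symm
    refine Eq.trans ?_ (he' j (c.toMonoidHom k)).symm
    exact D.toG_map_apply hij k

/-! ### Inheritance properties of the Isomorphism Conjecture -/

theorem IsomorphismConjecture.congr {K : Type u} [Group K] {ξ ξ' : K →* Γ} (hξ : ∀ k, ξ k = ξ' k)
    {F F' : SubgroupFamily K} (hF : ∀ L, F.mem L ↔ F'.mem L)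
    (h : E.IsomorphismConjecture ⟨K, ξ⟩ F) : E.IsomorphismConjecture ⟨K, ξ'⟩ F' := by
  obtain rfl : ξ = ξ' := MonoidHom.ext hξ
  exact fun X hX => h X fun L => ⟨fun hL => (hX L).1 ((hF L).1 hL),
    fun hL => (hX L).2 fun hL' => hL ((hF L).2 hL')⟩

/-- The Isomorphism Conjecture can be tested on a single model. -/
theorem isomorphismConjecture_iff_models {F : SubgroupFamily G.carrier} {Z : GCWComplex G.carrier}
    (hZ : Models F Z) : E.IsomorphismConjecture G F ↔
      ∀ n, Function.Bijective (((E.theory G).H n).map Z.toPoint).hom :=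
  ⟨fun h n => ((isClassifyingSpace_wordsOf F).models.bijective_iff _ hZ n).1
      (h _ (isClassifyingSpace_wordsOf F) n),
    fun h _ hX n => (hX.models.bijective_iff _ hZ n).2 (h n)⟩

/-- Semi-equivariant maps are compatible with the projections to a point. -/
theorem toPoint_semi {K : GroupOver.{u} Γ} (α : K.Hom G) {X : GPoset K.carrier}
    {Y : GPoset G.carrier} (m : X ⟶ (res α.toMonoidHom).obj Y) (n : ℤ)
    (a : ((E.theory K).H n).obj X.complex.toPair) :
    (((E.theory G).H n).map Y.complex.toPoint).hom (E.semi α (SemiMap.ofHom m) n a) =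
      (E.pointMap α n).hom ((((E.theory K).H n).map X.complex.toPoint).hom a) := by
  refine (ap_semi α (SemiMap.ofHom m) Y.complex.toPoint
    ((SemiMap.ofPoint (Q := (GCWComplex.point G.carrier).toPair) PUnit.unit fun _ => rfl).comp
      X.complex.toPoint) (fun _ => rfl) n a).trans ?_
  exact (semi_ap α (SemiMap.ofPoint (Q := (GCWComplex.point G.carrier).toPair) PUnit.unit
    fun _ => rfl) X.complex.toPoint _ (fun _ => rfl) n a).symm

/-- The Isomorphism Conjecture passes to colimits of groups, for the families pulled back to the
stages. -/
theorem isomorphismConjecture_of_stages (D : DirectedCocone G.carrier)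
    (F : SubgroupFamily G.carrier) (hD : ∀ g, ∃ i k, D.toG i k = g) (hG : E.PointColim D)
    (hL : ∀ L, F.mem L → PointColim (G := subgroupOver G L) E (D.restrict L))
    (h : ∀ i, E.IsomorphismConjecture (stage D i) (F.pullback (D.toG i))) :
    E.IsomorphismConjecture G F := by
  let X := wordsOf F
  have hT := isModel_telescope_wordsOf F
  have hi : ∀ (i : D.I) n, Function.Bijective (((E.theory (stage D i)).H n).map
      ((res (D.toG i)).obj X.telescope).complex.toPoint).hom := fun i =>
    (isomorphismConjecture_iff_models (hT.res (D.toG i)).models).1 (h i)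
  refine (isomorphismConjecture_iff_models hT.models).2 fun n => ?_
  have hcolim := TheorySystem.isColim_telescope (S := E.resSystem D) F.mono
    (fun L hFL n => E.isColim_orbit L hD (hL L hFL) n) (hasIsotropy_wordsOf F) n
  constructor
  · refine (injective_iff_map_eq_zero _).2 fun a ha => ?_
    obtain ⟨i, x, rfl⟩ := hcolim.1 a
    have h0 := (toPoint_semi (stageToG D i) ((resId (D.toG i)).app X.telescope) n x).symm.trans ha
    obtain ⟨j, hij, e⟩ := (hG n).2 i _ h0
    have e' : ((E.resSystem D).map i j hij).app n X.telescope x = 0 := by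
      refine (hi j n).1 (Eq.trans ?_ (map_zero _).symm)
      exact (toPoint_semi (stageMap D i j hij) _ n x).trans e
    rw [← (E.resSystem D).toT_map i j hij, e']
    exact map_zero _
  · intro y
    obtain ⟨i, z, rfl⟩ := (hG n).1 y
    obtain ⟨x, rfl⟩ := (hi i n).2 z
    exact ⟨((E.resSystem D).toT i).app n X.telescope x,
      toPoint_semi (stageToG D i) ((resId (D.toG i)).app X.telescope) n x⟩

/-- The transitivity principle: the Isomorphism Conjecture passes to a larger family if it holds
for the members of the larger family. -/
theorem IsomorphismConjecture.of_le {F F' : SubgroupFamily G.carrier}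
    (hF : ∀ L, F.mem L → F'.mem L) (h : E.IsomorphismConjecture G F)
    (hL : ∀ L, F'.mem L → E.IsomorphismConjecture (subgroupOver G L) (F.pullback L.subtype)) :
    E.IsomorphismConjecture G F' := by
  have hT := isModel_telescope_wordsOf F
  have hT' := isModel_telescope_wordsOf F'
  refine (isomorphismConjecture_iff_models hT'.models).2 fun n => ?_
  refine bijective_toPoint_of_prod F'.mono (hasIsotropy_wordsOf F') (wordsOf F) (fun L hFL => ?_) n
    ((isomorphismConjecture_iff_models (hT.prod hF hT').models).1 h n)
  exact (isomorphismConjecture_iff_models (hT.res L.subtype).models).1 (hL L hFL)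

/-! ### Reduction to finitely generated and finitely presented groups -/

/-- For a continuous theory, the Isomorphism Conjecture passes to directed unions of subgroups. -/
theorem IsContinuous.isomorphismConjecture_of_subgroups (hE : E.IsContinuous)
    {F : SubgroupFamily G.carrier} {I : Type u} [Preorder I] [IsDirectedOrder I] [Nonempty I]
    (S : I → Subgroup G.carrier) (hS : Monotone S) (hc : ∀ g, ∃ i, g ∈ S i)
    (h : ∀ i, E.IsomorphismConjecture (subgroupOver G (S i)) (F.pullback (S i).subtype)) :
    E.IsomorphismConjecture G F := by
  let D : DirectedCocone G.carrier := .ofSubgroups S hS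
  have hD : ∀ g, ∃ i k, D.toG i k = g := fun g => (hc g).imp fun i hi => ⟨⟨g, hi⟩, rfl⟩
  have hinj : ∀ i, Function.Injective (D.toG i) := fun _ => Subtype.val_injective
  have hex := DirectedCocone.isExhausting_of_injective hD hinj
  refine isomorphismConjecture_of_stages D F hD (hE.pointColim hD hinj) (fun L _ => ?_) h
  exact hE.pointColim (G := subgroupOver G L) (hex.restrict L).exists_eq fun i k l e => by
    have e' := congrArg Subtype.val e
    exact Subtype.ext (hinj i e')

variable {C : GroupClass.{u}}

theorem IsContinuous.isomorphismConjecture_of_fg (hE : E.IsContinuous)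
    (h : ∀ G : GroupOver.{u} Γ, Group.FG G.carrier → E.IsomorphismConjecture G (C.family G.carrier))
    (G : GroupOver.{u} Γ) : E.IsomorphismConjecture G (C.family G.carrier) := by
  have := DirectedCocone.directed_finset G.carrier
  refine hE.isomorphismConjecture_of_subgroups
    (fun t : Finset G.carrier => Subgroup.closure (t : Set G.carrier))
    (fun s t h => Subgroup.closure_mono (Finset.coe_subset.2 h))
    (fun g => ⟨{g}, Subgroup.subset_closure (by simp)⟩) fun t => ?_
  refine (h (subgroupOver G (Subgroup.closure (t : Set G.carrier)))
    (Group.closure_finset_fg t)).congr (fun _ => rfl) fun L => ?_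
  exact (C.mem_map_iff _ Subtype.val_injective L).symm

theorem IsContinuous.fiberedIsomorphismConjecture_of_fg (hE : E.IsContinuous)
    (h : ∀ G : GroupOver.{u} Γ, Group.FG G.carrier →
      E.FiberedIsomorphismConjecture G (C.family G.carrier))
    (G : GroupOver.{u} Γ) : E.FiberedIsomorphismConjecture G (C.family G.carrier) := by
  intro K _ φ
  have := DirectedCocone.directed_finset G.carrier
  let S : Finset G.carrier → Subgroup G.carrier := fun t => Subgroup.closure (t : Set G.carrier)
  refine hE.isomorphismConjecture_of_subgroups (G := G.pull φ) (fun t => (S t).comap φ)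
    (fun s t h => Subgroup.comap_mono (Subgroup.closure_mono (Finset.coe_subset.2 h)))
    (fun k => ⟨{φ k}, Subgroup.subset_closure (by simp)⟩) fun t => ?_
  let φ' : (S t).comap φ →* S t := φ.subgroupComap (S t)
  refine (h (subgroupOver G (S t)) (Group.closure_finset_fg t) _ φ').congr (fun _ => rfl)
    fun L => ?_
  have e : (L.map φ').map (S t).subtype = (L.map ((S t).comap φ).subtype).map φ := by
    rw [Subgroup.map_map, Subgroup.map_map]
    rfl
  change C.mem (L.map φ') ↔ C.mem ((L.map ((S t).comap φ).subtype).map φ)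
  rw [← e]
  exact (C.mem_map_iff _ Subtype.val_injective _).symm

/-- A fibered statement for a finitely generated group `G` is deduced from the finitely presented
groups `G_i` with colimit `G`.  Over a homomorphism `K → G` it is first obtained for the
fiber products `K_i = G_i ×_G K` and the family pulled back from `G_i`, then enlarged to the
family pulled back from `G`, and finally passes to the colimit `K`. -/
theorem IsStronglyContinuous.fiberedIsomorphismConjecture_of_isFinitelyPresented
    (hE : E.IsStronglyContinuous)
    (h : ∀ G : GroupOver.{u} Γ, Group.IsFinitelyPresented G.carrier →
      E.FiberedIsomorphismConjecture G (C.family G.carrier))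
    (G : GroupOver.{u} Γ) (hG : Group.FG G.carrier) :
    E.FiberedIsomorphismConjecture G (C.family G.carrier) := by
  intro K _ φ
  obtain ⟨D, hD, hfp⟩ := DirectedCocone.exists_isFinitelyPresented G.carrier
  have hDK := hD.pullback φ
  refine isomorphismConjecture_of_stages (G := G.pull φ) (D.pullback φ) _ hDK.exists_eq
    (hE.pointColim hDK) (fun L _ => hE.pointColim (hDK.restrict L)) fun i => ?_
  have hi := h (stage D i) (hfp i)
  have hcomp : ∀ k, D.toG i (D.pullbackFst φ i k) = φ ((D.pullback φ).toG i k) := fun k => k.2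
  refine IsomorphismConjecture.of_le
    (F := ((C.family (D.obj i)).pullback (D.pullbackFst φ i))) (fun L hL => ?_) ?_ fun L _ => ?_
  -- The smaller family is contained in the larger one because `C` is closed under quotients.
  · have := C.mem_map (D.toG i) _ hL
    rw [Subgroup.map_map, D.toG_pullbackFst, ← Subgroup.map_map] at this
    exact this
  · exact (hi _ (D.pullbackFst φ i)).congr (K := (D.pullback φ).obj i)
      (fun k => congrArg G.hom (hcomp k)) fun _ => Iff.rfl
  -- On a subgroup `L` of `K_i` the smaller family is pulled back from `G_i` along `L → K_i → G_i`.
  · refine (hi L ((D.pullbackFst φ i).comp L.subtype)).congr (K := L)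
      (fun k => congrArg G.hom (hcomp k)) fun M => ?_
    change C.mem _ ↔ C.mem _
    rw [← Subgroup.map_map]

end EquivariantHomologyTheory

end EquivariantHomology

theorem mainTheorem9 {Γ : Type x} [Group Γ] {Λ : Type v} [Ring Λ]
    (E : EquivariantHomology.EquivariantHomologyTheory.{u, v, w, x} Λ Γ)
    (C : EquivariantHomology.GroupClass.{u}) :
    (E.IsContinuous →
      ((∀ G : EquivariantHomology.GroupOver.{u} Γ,
          E.IsomorphismConjecture G (C.family G.carrier)) ↔
        (∀ G : EquivariantHomology.GroupOver.{u} Γ, Group.FG G.carrier →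
          E.IsomorphismConjecture G (C.family G.carrier))) ∧
      ((∀ G : EquivariantHomology.GroupOver.{u} Γ,
          E.FiberedIsomorphismConjecture G (C.family G.carrier)) ↔
        (∀ G : EquivariantHomology.GroupOver.{u} Γ, Group.FG G.carrier →
          E.FiberedIsomorphismConjecture G (C.family G.carrier)))) ∧
    (E.IsStronglyContinuous →
      ((∀ G : EquivariantHomology.GroupOver.{u} Γ,
          E.FiberedIsomorphismConjecture G (C.family G.carrier)) ↔
        (∀ G : EquivariantHomology.GroupOver.{u} Γ, Group.IsFinitelyPresented G.carrier →
          E.FiberedIsomorphismConjecture G (C.family G.carrier)))) :=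
  ⟨fun hE => ⟨⟨fun h G _ => h G, hE.isomorphismConjecture_of_fg⟩,
      ⟨fun h G _ => h G, hE.fiberedIsomorphismConjecture_of_fg⟩⟩,
    fun hE => ⟨fun h G _ => h G, fun h => hE.isContinuous.fiberedIsomorphismConjecture_of_fg
      (hE.fiberedIsomorphismConjecture_of_isFinitelyPresented h)⟩⟩
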